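/- Let $\mathscr I$ be a countable set and let $X_i$, $i\in\mathscr I$, be independent $\mathbb R^d$-valued random vectors with finite second moments, $\mathbb E X_i=0$ for all $i$ and $\sum_{i\in\mathscr I}\operatorname{Var}(X_i)=\mathbf I_d$, where $\operatorname{Var}$ denotes the covariance matrix. Let $W=\sum_{i\in\mathscr I}X_i$ (the sum exists almost surely, as the limit of partial sums along an exhaustion of $\mathscr I$ by an increasing sequence of finite sets). Write $|\cdot|$ for the Euclidean norm and $\mathcal N(0,\mathbf I_d)$ for the standard normal distribution on $\mathbb R^d$. Let $\mathscr A$ be a class of measurable subsets of $\mathbb R^d$, and for each $A\in\mathscr A$ let $\rho_A\colon\mathbb R^d\to\mathbb R$ be a measurable function whose positive part $\max\{\rho_A,0\}$ is continuous. For $t\in\mathbb R$ put $A^{t|\rho}:=\{x;\rho_A(x)\le t\}$, and put $$\gamma^*(\mathscr A|\rho):=\sup_{A\in\mathscr A}\ \sup_{\varepsilon>0}\ \max\Bigl\{\tfrac1\varepsilon\,\mathcal N(0,\mathbf I_d)\{A^{\varepsilon|\rho}\setminus A\},\ \tfrac1\varepsilon\,\mathcal N(0,\mathbf I_d)\{A\setminus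 A^{-\varepsilon|\rho}\}\Bigr\}\in[0,\infty].$$ Let $\kappa\ge0$ and assume: (A1) $\mathscr A$ is closed under translations and under uniform scalings by factors greater than one. (A2) For each $A\in\mathscr A$ and $t\in\mathbb R$, $A^{t|\rho}\in\mathscr A\cup\{\varnothing,\mathbb R^d\}$. (A3) For each $A\in\mathscr A$ and $\varepsilon>0$, either $A^{-\varepsilon|\rho}=\varnothing$ or $\{x;\rho_{A^{-\varepsilon|\rho}}(x)<\varepsilon\}\subseteq A$. (A4) For each $A\in\mathscr A$, $\rho_A(x)\le0$ for all $x\in A$ and $\rho_A(x)\ge0$ for all $x\notin A$. (A5) For each $A\in\mathscr A$ and $y\in\mathbb R^d$, $\rho_{A+y}(x+y)=\rho_A(x)$ for all $x\in\mathbb R^d$. (A6) For each $A\in\mathscr A$ and $q\ge1$, $|\rho_{qA}(qx)|\le q|\rho_A(x)|$ for all $x\in\mathbb R^d$. (A7) For each $A\in\mathscr A$, $|\rho_A(x)-\rho_A(y)|\le|x-y|$ for all $x,y$ with $\rho_A(x)\ge0$ and $\rho_A(y)\ge0$. (A8) For each $A\in\mathscr A$, $\rho_A$ is differentiable on $\{x;\rho_A(x)>0\}$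 and $$|\nabla\rho_A(x)-\nabla\rho_A(y)|\le\frac{\kappa|x-y|}{\min\{\rho_A(x),\rho_A(y)\}}$$ for all $x,y$ with $\rho_A(x)>0$ and $\rho_A(y)>0$. Then for every $A\in\mathscr A$, $$\bigl|\mathbb P(W\in A)-\mathcal N(0,\mathbf I_d)\{A\}\bigr|\le\max\bigl\{27,\,1+53\,\gamma^*(\mathscr A|\rho)\sqrt{1+\kappa}\bigr\}\sum_{i\in\mathscr I}\mathbb E|X_i|^3 ,$$ where the right-hand side may be $\infty$ (and is read as $0$ if its second factor is $0$). If, in addition, $\mathscr A$ is closed under symmetric linear maps whose smallest eigenvalue is at least one, then for every $A\in\mathscr A$ the same bound holds with $53$ replaced by $50$. -/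

import Mathlib

open MeasureTheory ProbabilityTheory Filter Topology

noncomputable section

/-- The Euclidean space `ℝ^d` (with the Euclidean norm). -/
abbrev Vec (d : ℕ) : Type := EuclideanSpace ℝ (Fin d)

/-- The sublevel set `A^{t|ρ} = {x ; ρ_A(x) ≤ t}`. -/
def sublevel {d : ℕ} (ρ : Set (Vec d) → Vec d → ℝ) (A : Set (Vec d)) (t : ℝ) : Set (Vec d) :=
  {x | ρ A x ≤ t}

/-- The generalized Gaussian perimeter `γ^*(A|ρ)` of a set, with values in `[0, ∞]`. -/
def gaussPerimeter {d : ℕ} (ρ : Set (Vec d) → Vec d → ℝ) (A : Set (Vec d)) : ENNReal :=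
  ⨆ (ε : ℝ) (_ : 0 < ε),
    max (stdGaussian (Vec d) (sublevel ρ A ε \ A) / ENNReal.ofReal ε)
      (stdGaussian (Vec d) (A \ sublevel ρ A (-ε)) / ENNReal.ofReal ε)

/-- The generalized Gaussian perimeter `γ^*(𝒜|ρ)` of a class of sets, with values in `[0, ∞]`. -/
def classGaussPerimeter {d : ℕ} (𝒜 : Set (Set (Vec d))) (ρ : Set (Vec d) → Vec d → ℝ) :
    ENNReal :=
  ⨆ (A : Set (Vec d)) (_ : A ∈ 𝒜), gaussPerimeter ρ A

/-- The class `𝒜` of measurable sets, together with the generalized signed distance functions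
`ρ A`, `A ∈ 𝒜`, meets the standing assumptions with curvature constant `κ`. The values of `ρ` at
sets outside `𝒜` play no role: the sets at which `ρ` is evaluated below all belong to `𝒜`. -/
structure IsAdmissibleClass {d : ℕ} (𝒜 : Set (Set (Vec d))) (ρ : Set (Vec d) → Vec d → ℝ)
    (κ : ℝ) : Prop where
  measurableSet : ∀ A ∈ 𝒜, MeasurableSet A
  measurable_dist : ∀ A ∈ 𝒜, Measurable (ρ A)
  translate_mem : ∀ A ∈ 𝒜, ∀ y : Vec d, (fun x => x + y) '' A ∈ 𝒜
  scale_mem : ∀ A ∈ 𝒜, ∀ q : ℝ, 1 < q → (fun x => q • x) '' A ∈ 𝒜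
  sublevel_mem : ∀ A ∈ 𝒜, ∀ t : ℝ,
    sublevel ρ A t ∈ 𝒜 ∨ sublevel ρ A t = ∅ ∨ sublevel ρ A t = Set.univ
  shrink_enlarge : ∀ A ∈ 𝒜, ∀ ε : ℝ, 0 < ε →
    sublevel ρ A (-ε) = ∅ ∨ {x | ρ (sublevel ρ A (-ε)) x < ε} ⊆ A
  nonpos_of_mem : ∀ A ∈ 𝒜, ∀ x ∈ A, ρ A x ≤ 0
  nonneg_of_notMem : ∀ A ∈ 𝒜, ∀ x ∉ A, 0 ≤ ρ A x
  dist_translate : ∀ A ∈ 𝒜, ∀ y x : Vec d, ρ ((fun z => z + y) '' A) (x + y) = ρ A x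
  dist_scale : ∀ A ∈ 𝒜, ∀ q : ℝ, 1 ≤ q → ∀ x : Vec d,
    |ρ ((fun z => q • z) '' A) (q • x)| ≤ q * |ρ A x|
  /-- The positive part of `ρ A` is continuous. -/
  continuous_posPart : ∀ A ∈ 𝒜, Continuous (fun x => max (ρ A x) 0)
  nonexpansive : ∀ A ∈ 𝒜, ∀ x y : Vec d, 0 ≤ ρ A x → 0 ≤ ρ A y → |ρ A x - ρ A y| ≤ ‖x - y‖
  differentiableAt : ∀ A ∈ 𝒜, ∀ x : Vec d, 0 < ρ A x → DifferentiableAt ℝ (ρ A) x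
  curvature_nonneg : 0 ≤ κ
  gradient_bound : ∀ A ∈ 𝒜, ∀ x y : Vec d, 0 < ρ A x → 0 < ρ A y →
    ‖gradient (ρ A) x - gradient (ρ A) y‖ ≤ κ * ‖x - y‖ / min (ρ A x) (ρ A y)

/-- The class `𝒜` is closed under symmetric linear transformations all of whose eigenvalues
are at least one. -/
def ClosedUnderSymmetricMaps {d : ℕ} (𝒜 : Set (Set (Vec d))) : Prop :=
  ∀ A ∈ 𝒜, ∀ L : Vec d →ₗ[ℝ] Vec d, L.IsSymmetric →
    (∀ c : ℝ, Module.End.HasEigenvalue L c → 1 ≤ c) → L '' A ∈ 𝒜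

/-- The covariance matrix `Var(Y)` of a random vector `Y`. -/
def covarianceMatrix {d : ℕ} {Ω : Type*} [MeasurableSpace Ω] (P : Measure Ω) (Y : Ω → Vec d) :
    Matrix (Fin d) (Fin d) ℝ :=
  Matrix.of fun j k => covariance (fun ω => Y ω j) (fun ω => Y ω k) P

/-- `W` is the almost sure sum of the countable family `X`: for some exhaustion of the index set
by an increasing sequence of finite sets, the partial sums converge to `W` almost surely. (Almost
sure convergence of the net of all finite partial sums would amount to absolute convergence and
is too strong for infinite families.) -/
def IsAlmostSureSum {d : ℕ} {Ω I : Type*} [MeasurableSpace Ω] (P : Measure Ω)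
    (X : I → Ω → Vec d) (W : Ω → Vec d) : Prop :=
  ∃ s : ℕ → Finset I, Monotone s ∧ (∀ i, ∃ n, i ∈ s n) ∧
    ∀ᵐ ω ∂P, Tendsto (fun n => ∑ i ∈ s n, X i ω) atTop (𝓝 (W ω))

end

/-! The proof interpolates along the rotation `cos α • W + sin α • Z`, where `Z` is Gaussian with
the covariance of `W`, and closes a circular estimate by induction on the set of summands. The
indicator of `A` is replaced by a function of `ρ A` that falls from 1 to 0 across the layer 0 < ρ_A
< ε. By (A3) and the definition of the perimeter γ*, this costs at most γ* ε
(`IsAdmissibleClass.abs_measureReal_sub_le`).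

Independence, Gaussian integration by parts and the matching of second moments bound the derivative
in α by (3/2) sin α cos² α · B · β, where β = Σ E|X_i|³ and B is a Lipschitz constant of the second
derivatives of the test function smoothed by a Gaussian and by the law of the sum without X_i
(`IsSmoothTest.abs_deriv_interp_le`). There are two estimates of B, both in terms of a bound δ for
the normal approximation of these shorter sums. For small α, one derivative falls on the Gaussian
and two on the test function; the latter yield (1+κ)/ε² times the probability of the layer, which is
at most a perimeter term plus 2δ. For large α, all derivatives fall on the Gaussian: the difference
between the shorter sum and its Gaussian counterpart costs δ/sin³ α, and the Gaussian counterpart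
itself a bounded amount. With ε proportional to β√(1+κ), and the two regimes separated at an angle
proportional to β, the total is at most Kβ as soon as δ ≤ 1.01 Kβ (`constants_close`).

The induction runs over sums whose covariance S dominates the identity, compared with N(0,S) =
N(0,S−I) ∗ N(0,I). Removing X_i leaves a covariance of at least (1 − E|X_i|²) I, so a scalar
dilation restores the hypothesis, and the factor 1.01 pays for it (`leaveOneOut_moment_le`).
Translations and uniform scalings thus carry the whole induction, with the constant 50. For
countable sums, finite partial sums are dilated by factors tending to 1 so that their covariances
dominate I; the limit is taken for the smoothed indicators, and then ε tends to 0. -/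

set_option linter.unusedSectionVars false

/-! ### Translation of the standard Gaussian measure and integration by parts. -/

section GaussianShift

open scoped RealInnerProductSpace

variable {E : Type*} [NormedAddCommGroup E] [InnerProductSpace ℝ E] [FiniteDimensional ℝ E]
  [MeasurableSpace E] [BorelSpace E]

lemma integrable_exp_mul_norm_stdGaussian (a : ℝ) :
    Integrable (fun z : E => Real.exp (a * ‖z‖)) (stdGaussian E) := by
  obtain ⟨C, hC, hint⟩ := IsGaussian.exists_integrable_exp_sq (stdGaussian E)
  refine (hint.const_mul (Real.exp (a ^ 2 / (4 * C)))).mono'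
    (by fun_prop) (ae_of_all _ fun z => ?_)
  rw [Real.norm_eq_abs, abs_of_pos (Real.exp_pos _), ← Real.exp_add]
  refine Real.exp_le_exp.2 ?_
  have h : 0 ≤ (a / (2 * C) - ‖z‖) ^ 2 * C := by positivity
  have h2 : (a / (2 * C) - ‖z‖) ^ 2 * C = a ^ 2 / (4 * C) + C * ‖z‖ ^ 2 - a * ‖z‖ := by
    field_simp
    ring
  linarith

lemma stdGaussian_map_inner (v : E) :
    (stdGaussian E).map (fun z => ⟪z, v⟫) = gaussianReal 0 (‖v‖₊ ^ 2) := by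
  have h := IsGaussian.map_eq_gaussianReal (μ := stdGaussian E) (innerSL ℝ v)
  rw [integral_strongDual_stdGaussian, variance_dual_stdGaussian, innerSL_apply_norm] at h
  convert h using 2
  · ext z
    simp [real_inner_comm]
  · rw [← Real.toNNReal_coe (r := ‖v‖₊ ^ 2)]
    simp

lemma integrable_exp_inner_stdGaussian (v : E) :
    Integrable (fun z : E => Real.exp ⟪z, v⟫) (stdGaussian E) := by
  refine (integrable_exp_mul_norm_stdGaussian (E := E) ‖v‖).mono'
    (by fun_prop) (ae_of_all _ fun z => ?_)
  rw [Real.norm_eq_abs, abs_of_pos (Real.exp_pos _)]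
  exact Real.exp_le_exp.2 ((real_inner_le_norm z v).trans_eq (mul_comm _ _))

/-- The joint Fourier–Laplace transform factorises over an orthonormal basis. It supplies both
characteristic functions compared in the Cameron–Martin formula. -/
lemma integral_cexp_stdGaussian (u v : E) :
    ∫ z, Complex.exp ((⟪z, u⟫ : ℝ) * Complex.I + (⟪z, v⟫ : ℝ)) ∂(stdGaussian E)
      = Complex.exp ((‖v‖ ^ 2 / 2 : ℝ) + (⟪u, v⟫ : ℝ) * Complex.I - (‖u‖ ^ 2 / 2 : ℝ)) := by
  rw [stdGaussian, integral_map (Measurable.aemeasurable (by fun_prop))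
    (Measurable.aestronglyMeasurable (by fun_prop))]
  set b := stdOrthonormalBasis ℝ E
  have h1 : ∀ x : Fin (Module.finrank ℝ E) → ℝ,
      Complex.exp ((⟪∑ i, x i • b i, u⟫ : ℝ) * Complex.I + (⟪∑ i, x i • b i, v⟫ : ℝ))
        = ∏ i, Complex.exp (((⟪b i, u⟫ : ℝ) * Complex.I + (⟪b i, v⟫ : ℝ)) * (x i : ℝ)) := by
    intro x
    rw [← Complex.exp_sum]
    congr 1
    simp only [sum_inner, real_inner_smul_left]
    push_cast
    rw [Finset.sum_mul, ← Finset.sum_add_distrib]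
    exact Finset.sum_congr rfl fun i _ => by ring
  simp_rw [h1]
  rw [integral_fintype_prod_eq_prod
    (f := fun i (x : ℝ) => Complex.exp (((⟪b i, u⟫ : ℝ) * Complex.I + (⟪b i, v⟫ : ℝ)) * (x : ℝ)))]
  have h2 : ∀ w : ℂ, ∫ x : ℝ, Complex.exp (w * (x : ℝ)) ∂(gaussianReal 0 1)
      = Complex.exp (w ^ 2 / 2) := by
    intro w
    have := complexMGF_id_gaussianReal (μ := 0) (v := 1) w
    simpa [complexMGF] using this
  simp_rw [h2]
  rw [← Complex.exp_sum]
  congr 1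
  have e1 : (‖v‖ ^ 2 : ℝ) = ∑ i, ⟪b i, v⟫ ^ 2 := (b.sum_sq_inner_right v).symm
  have e2 : (‖u‖ ^ 2 : ℝ) = ∑ i, ⟪b i, u⟫ ^ 2 := (b.sum_sq_inner_right u).symm
  have e3 : ⟪u, v⟫ = ∑ i, ⟪b i, u⟫ * ⟪b i, v⟫ := by
    rw [← b.sum_inner_mul_inner]
    simp_rw [real_inner_comm]
  rw [e1, e2, e3]
  push_cast
  rw [Finset.sum_div, Finset.sum_mul, Finset.sum_div, ← Finset.sum_add_distrib,
    ← Finset.sum_sub_distrib]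
  refine Finset.sum_congr rfl fun i _ => ?_
  ring_nf
  rw [Complex.I_sq]
  ring

/-- The Cameron–Martin formula for the standard Gaussian measure. -/
lemma stdGaussian_map_add_const (v : E) :
    (stdGaussian E).map (fun z => z + v) = (stdGaussian E).withDensity
      (fun z => ENNReal.ofReal (Real.exp (⟪z, v⟫ - ‖v‖ ^ 2 / 2))) := by
  have hint : Integrable (fun z : E => Real.exp (⟪z, v⟫ - ‖v‖ ^ 2 / 2)) (stdGaussian E) := by
    simp_rw [Real.exp_sub]
    exact (integrable_exp_inner_stdGaussian v).div_const _
  have hfin := isFiniteMeasure_withDensity_ofReal hint.2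
  have : IsProbabilityMeasure ((stdGaussian E).map (fun z => z + v)) :=
    Measure.isProbabilityMeasure_map (by fun_prop)
  refine Measure.ext_of_charFun ?_
  ext u
  rw [charFun_apply, charFun_apply, integral_map (by fun_prop) (by fun_prop),
    integral_withDensity_eq_integral_toReal_smul (by fun_prop) (ae_of_all _ fun _ => by simp)]
  simp_rw [ENNReal.toReal_ofReal (Real.exp_pos _).le, Complex.real_smul, Complex.ofReal_exp,
    ← Complex.exp_add]
  have h1 : ∀ z : E, Complex.exp (((⟪z, v⟫ - ‖v‖ ^ 2 / 2 : ℝ) : ℂ) + (⟪z, u⟫ : ℝ) * Complex.I)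
      = Complex.exp (-(‖v‖ ^ 2 / 2 : ℝ)) *
        Complex.exp ((⟪z, u⟫ : ℝ) * Complex.I + (⟪z, v⟫ : ℝ)) := by
    intro z
    rw [← Complex.exp_add]
    congr 1
    push_cast
    ring
  have h2 : ∀ z : E, Complex.exp ((⟪z + v, u⟫ : ℝ) * Complex.I)
      = Complex.exp ((⟪v, u⟫ : ℝ) * Complex.I) *
        Complex.exp ((⟪z, u⟫ : ℝ) * Complex.I + (⟪z, (0 : E)⟫ : ℝ)) := by
    intro z
    rw [← Complex.exp_add, inner_add_left]
    congr 1
    push_cast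
    simp
    ring
  simp_rw [h1, h2]
  rw [integral_const_mul, integral_const_mul, integral_cexp_stdGaussian,
    integral_cexp_stdGaussian, ← Complex.exp_add, ← Complex.exp_add, real_inner_comm u v]
  congr 1
  simp
  ring

lemma integral_add_const_stdGaussian {h : E → ℝ} (hh : Measurable h) (v : E) :
    ∫ z, h (z + v) ∂(stdGaussian E)
      = ∫ z, h z * Real.exp (⟪z, v⟫ - ‖v‖ ^ 2 / 2) ∂(stdGaussian E) := by
  rw [← integral_map (f := h) (by fun_prop) hh.aestronglyMeasurable, stdGaussian_map_add_const,
    integral_withDensity_eq_integral_toReal_smul (by fun_prop) (ae_of_all _ fun _ => by simp)]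
  simp_rw [ENNReal.toReal_ofReal (Real.exp_pos _).le, smul_eq_mul, mul_comm]

lemma integrable_of_linear_growth_stdGaussian {h : E → ℝ} (hh : Measurable h) {M : ℝ}
    (hM : ∀ z, |h z| ≤ M * (1 + ‖z‖)) : Integrable h (stdGaussian E) := by
  refine (((integrable_const (1 : ℝ)).add
    (IsGaussian.integrable_id (μ := stdGaussian E)).norm).const_mul M).mono'
    hh.aestronglyMeasurable (ae_of_all _ fun z => ?_)
  simpa using hM z

/-- Integration by parts without any smoothness of `h`: the Cameron–Martin formula moves the shift
into the density, whose derivative at zero shift is `⟪z, w⟫`. -/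
lemma hasDerivAt_integral_add_smul_stdGaussian {h : E → ℝ} (hh : Measurable h) {M : ℝ}
    (hM : ∀ z, |h z| ≤ M * (1 + ‖z‖)) (w : E) :
    HasDerivAt (fun r : ℝ => ∫ z, h (z + r • w) ∂(stdGaussian E))
      (∫ z, h z * ⟪z, w⟫ ∂(stdGaussian E)) 0 := by
  have hM0 : 0 ≤ M := by simpa using (abs_nonneg _).trans (hM 0)
  simp_rw [integral_add_const_stdGaussian hh]
  set F : ℝ → E → ℝ := fun r z => h z * Real.exp (⟪z, r • w⟫ - ‖r • w‖ ^ 2 / 2)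
  set F' : ℝ → E → ℝ := fun r z => h z * (Real.exp (⟪z, r • w⟫ - ‖r • w‖ ^ 2 / 2) *
    (⟪z, w⟫ - r * ‖w‖ ^ 2))
  have key := hasDerivAt_integral_of_dominated_loc_of_deriv_le (μ := stdGaussian E)
    (F := F) (F' := F') (x₀ := 0) (s := Metric.ball 0 1)
    -- For `|r| ≤ 1` the density is at most `exp (‖w‖ * ‖z‖)`; one further `exp ‖z‖` absorbs the
    -- growth of `h` and another the linear factor.
    (bound := fun z => M * (‖w‖ + ‖w‖ ^ 2) * Real.exp ((2 + ‖w‖) * ‖z‖))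
    (Metric.ball_mem_nhds _ one_pos) ?_ ?_ ?_ ?_ ?_ ?_
  · refine key.2.congr_deriv ?_
    simp [F']
  · exact Filter.Eventually.of_forall fun r =>
      (hh.mul (by fun_prop)).aestronglyMeasurable
  · simpa [F] using integrable_of_linear_growth_stdGaussian hh hM
  · exact (hh.mul (by fun_prop)).aestronglyMeasurable
  · refine ae_of_all _ fun z r hr => ?_
    have hr1 : |r| ≤ 1 := by simpa using (Metric.mem_ball.1 hr).le
    simp only [F', Real.norm_eq_abs, abs_mul, abs_of_pos (Real.exp_pos _)]
    have e1 : Real.exp (⟪z, r • w⟫ - ‖r • w‖ ^ 2 / 2) ≤ Real.exp (‖w‖ * ‖z‖) := by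
      refine Real.exp_le_exp.2 ?_
      have := real_inner_le_norm z (r • w)
      rw [norm_smul, Real.norm_eq_abs] at this
      have h3 : ‖z‖ * (|r| * ‖w‖) ≤ ‖z‖ * (1 * ‖w‖) := by gcongr
      nlinarith [sq_nonneg ‖r • w‖]
    have e2 : |⟪z, w⟫ - r * ‖w‖ ^ 2| ≤ (‖w‖ + ‖w‖ ^ 2) * Real.exp ‖z‖ := by
      have h4 := abs_real_inner_le_norm z w
      have h5 : |r * ‖w‖ ^ 2| ≤ 1 * ‖w‖ ^ 2 := by
        rw [abs_mul, abs_of_nonneg (sq_nonneg ‖w‖)]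
        gcongr
      have h6 : ‖z‖ ≤ Real.exp ‖z‖ := by linarith [Real.add_one_le_exp ‖z‖]
      have h7 : 1 ≤ Real.exp ‖z‖ := Real.one_le_exp (norm_nonneg _)
      calc |⟪z, w⟫ - r * ‖w‖ ^ 2| ≤ |⟪z, w⟫| + |r * ‖w‖ ^ 2| := abs_sub _ _
        _ ≤ ‖z‖ * ‖w‖ + ‖w‖ ^ 2 * 1 := by linarith
        _ ≤ Real.exp ‖z‖ * ‖w‖ + ‖w‖ ^ 2 * Real.exp ‖z‖ := by gcongr
        _ = _ := by ring
    have e3 : |h z| ≤ M * Real.exp ‖z‖ :=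
      (hM z).trans (by gcongr; linarith [Real.add_one_le_exp ‖z‖])
    calc |h z| * (Real.exp (⟪z, r • w⟫ - ‖r • w‖ ^ 2 / 2) * |⟪z, w⟫ - r * ‖w‖ ^ 2|)
        ≤ (M * Real.exp ‖z‖) * (Real.exp (‖w‖ * ‖z‖) * ((‖w‖ + ‖w‖ ^ 2) * Real.exp ‖z‖)) := by
          gcongr
      _ = M * (‖w‖ + ‖w‖ ^ 2) * (Real.exp ‖z‖ * Real.exp (‖w‖ * ‖z‖) * Real.exp ‖z‖) := by ring
      _ = _ := by
        rw [← Real.exp_add, ← Real.exp_add]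
        ring_nf
  · exact (integrable_exp_mul_norm_stdGaussian _).const_mul _
  · refine ae_of_all _ fun z r _ => ?_
    have h1 : HasDerivAt (fun r : ℝ => r * ⟪z, w⟫ - r ^ 2 * (‖w‖ ^ 2 / 2))
        (⟪z, w⟫ - r * ‖w‖ ^ 2) r := by
      refine (((hasDerivAt_id r).mul_const ⟪z, w⟫).sub
        (((hasDerivAt_id r).pow 2).mul_const (‖w‖ ^ 2 / 2))).congr_deriv ?_
      simp
      ring
    have h2 := (h1.exp).const_mul (h z)
    have h3 : ∀ r : ℝ, ⟪z, r • w⟫ - ‖r • w‖ ^ 2 / 2 = r * ⟪z, w⟫ - r ^ 2 * (‖w‖ ^ 2 / 2) := by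
      intro r
      rw [real_inner_smul_right, norm_smul, Real.norm_eq_abs, mul_pow, sq_abs]
      ring
    simp only [F, F', h3]
    exact h2

end GaussianShift

/-! ### Derivatives of Gaussian smoothings of bounded functions. -/

section GaussianSmoothing

open scoped RealInnerProductSpace

lemma integral_abs_gaussianReal : ∫ x, |x| ∂(gaussianReal 0 1) = √(2 / Real.pi) := by
  rw [integral_gaussianReal_eq_integral_smul one_ne_zero]
  have h1 : ∀ x : ℝ, gaussianPDFReal 0 1 x • |x|
      = (fun y : ℝ => (√(2 * Real.pi))⁻¹ * (y * Real.exp (-(1 / 2) * y ^ 2))) |x| := by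
    intro x
    simp only [gaussianPDFReal, smul_eq_mul, NNReal.coe_one, mul_one, sub_zero, sq_abs]
    rw [show -x ^ 2 / 2 = -(1 / 2) * x ^ 2 by ring]
    ring
  simp_rw [h1]
  rw [integral_comp_abs (f := fun y : ℝ => (√(2 * Real.pi))⁻¹ * (y * Real.exp (-(1 / 2) * y ^ 2))),
    integral_const_mul]
  have h2 : ∫ y in Set.Ioi (0 : ℝ), y * Real.exp (-(1 / 2) * y ^ 2) = 1 := by
    have h := integral_mul_cexp_neg_mul_sq (b := (1 / 2 : ℂ)) (by norm_num)
    have h3 : ∀ y : ℝ, (y : ℂ) * Complex.exp (-(1 / 2) * (y : ℂ) ^ 2)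
        = ((y * Real.exp (-(1 / 2) * y ^ 2) : ℝ) : ℂ) := by
      intro y
      push_cast
      rfl
    simp_rw [h3] at h
    rw [integral_complex_ofReal] at h
    have h4 : ((2 : ℂ) * (1 / 2))⁻¹ = ((1 : ℝ) : ℂ) := by norm_num
    rw [h4] at h
    exact_mod_cast h
  rw [h2, mul_one, ← Real.sqrt_inv]
  have h5 : (2 : ℝ) / Real.pi = 2 ^ 2 * (2 * Real.pi)⁻¹ := by
    field_simp
  rw [h5, Real.sqrt_mul (by norm_num), Real.sqrt_sq (by norm_num)]

/-- As x² − 1 has mean zero, the integral is minus twice the one over [−1, 1], where −x exp(−x²/2)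
is a primitive of the weighted integrand. -/
lemma integral_abs_sq_sub_one_gaussianReal :
    ∫ x, |x ^ 2 - 1| ∂(gaussianReal 0 1) = 4 * Real.exp (-(1 / 2)) / √(2 * Real.pi) := by
  have hsq : Integrable (fun x : ℝ => x ^ 2 - 1) (gaussianReal 0 1) :=
    ((memLp_id_gaussianReal' 2 (by simp)).integrable_sq).sub (integrable_const _)
  have hind : Integrable (Set.indicator (Set.Ioc (-1 : ℝ) 1) fun x => x ^ 2 - 1)
      (gaussianReal 0 1) := hsq.indicator measurableSet_Ioc
  have h0 : ∫ x, (x ^ 2 - 1) ∂(gaussianReal 0 1) = 0 := by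
    have hi : Integrable (fun x : ℝ => x ^ 2) (gaussianReal 0 1) :=
      (memLp_id_gaussianReal' 2 (by simp)).integrable_sq
    have h := variance_fun_id_gaussianReal (μ := 0) (v := 1)
    rw [variance_eq_integral (by fun_prop), integral_id_gaussianReal] at h
    rw [integral_sub hi (integrable_const _)]
    simp only [sub_zero, NNReal.coe_one] at h
    simp [h]
  have h1 : ∀ x : ℝ, |x ^ 2 - 1|
      = (x ^ 2 - 1) - 2 * Set.indicator (Set.Ioc (-1 : ℝ) 1) (fun x => x ^ 2 - 1) x := by
    intro x
    by_cases hx : x ∈ Set.Ioc (-1 : ℝ) 1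
    · rw [Set.indicator_of_mem hx, abs_of_nonpos (by nlinarith [hx.1, hx.2])]
      ring
    · rw [Set.indicator_of_notMem hx, abs_of_nonneg]
      · ring
      · by_contra! hlt
        have : |x| < 1 := (sq_lt_one_iff_abs_lt_one x).1 (by linarith)
        exact hx ⟨(abs_lt.1 this).1, (abs_lt.1 this).2.le⟩
  simp_rw [h1]
  rw [integral_sub hsq (hind.const_mul 2), integral_const_mul, h0,
    integral_gaussianReal_eq_integral_smul one_ne_zero]
  have h2 : ∀ x : ℝ, gaussianPDFReal 0 1 x • Set.indicator (Set.Ioc (-1 : ℝ) 1)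
      (fun x => x ^ 2 - 1) x = (Set.indicator (Set.Ioc (-1 : ℝ) 1)
      (fun x => (√(2 * Real.pi))⁻¹ * (Real.exp (-(1 / 2) * x ^ 2) * (x ^ 2 - 1)))) x := by
    intro x
    by_cases hx : x ∈ Set.Ioc (-1 : ℝ) 1
    · simp only [Set.indicator_of_mem hx, gaussianPDFReal, smul_eq_mul, NNReal.coe_one, mul_one,
        sub_zero]
      rw [show -x ^ 2 / 2 = -(1 / 2) * x ^ 2 by ring]
      ring
    · simp [Set.indicator_of_notMem hx]
  simp_rw [h2]
  rw [integral_indicator measurableSet_Ioc, ← intervalIntegral.integral_of_le (by norm_num),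
    intervalIntegral.integral_const_mul]
  have h3 : ∫ x in (-1 : ℝ)..1, Real.exp (-(1 / 2) * x ^ 2) * (x ^ 2 - 1)
      = -(1 * Real.exp (-(1 / 2) * 1 ^ 2)) - -(-1 * Real.exp (-(1 / 2) * (-1) ^ 2)) := by
    refine intervalIntegral.integral_eq_sub_of_hasDerivAt
      (f := fun x => -(x * Real.exp (-(1 / 2) * x ^ 2))) (fun x _ => ?_)
      (Continuous.intervalIntegrable (by fun_prop) _ _)
    have e1 : HasDerivAt (fun x : ℝ => -(1 / 2) * x ^ 2) (-x) x :=
      (((hasDerivAt_id x).pow 2).const_mul (-(1 / 2))).congr_deriv (by simp)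
    refine (((hasDerivAt_id x).mul e1.exp).neg).congr_deriv ?_
    simp
    ring
  rw [h3]
  norm_num
  ring

variable {E : Type*} [NormedAddCommGroup E] [InnerProductSpace ℝ E] [FiniteDimensional ℝ E]
  [MeasurableSpace E] [BorelSpace E]

lemma stdGaussian_map_inner_eq_map (v : E) :
    (stdGaussian E).map (fun z => ⟪z, v⟫) = (gaussianReal 0 1).map (fun x => ‖v‖ * x) := by
  rw [stdGaussian_map_inner, gaussianReal_map_const_mul]
  congr 1
  · simp
  · ext
    simp

lemma integral_abs_inner_stdGaussian (v : E) :
    ∫ z, |⟪z, v⟫| ∂(stdGaussian E) = √(2 / Real.pi) * ‖v‖ := by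
  rw [← integral_map (φ := fun z : E => ⟪z, v⟫) (f := fun x : ℝ => |x|) (by fun_prop)
    (by fun_prop), stdGaussian_map_inner_eq_map, integral_map (by fun_prop) (by fun_prop)]
  simp_rw [abs_mul, abs_norm]
  rw [integral_const_mul, integral_abs_gaussianReal, mul_comm]

lemma integral_abs_inner_sq_sub_stdGaussian (v : E) :
    ∫ z, |⟪z, v⟫ ^ 2 - ‖v‖ ^ 2| ∂(stdGaussian E)
      = 4 * Real.exp (-(1 / 2)) / √(2 * Real.pi) * ‖v‖ ^ 2 := by
  rw [← integral_map (φ := fun z : E => ⟪z, v⟫) (f := fun x : ℝ => |x ^ 2 - ‖v‖ ^ 2|)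
    (by fun_prop) (by fun_prop), stdGaussian_map_inner_eq_map,
    integral_map (by fun_prop) (by fun_prop)]
  have h : ∀ x : ℝ, |(‖v‖ * x) ^ 2 - ‖v‖ ^ 2| = ‖v‖ ^ 2 * |x ^ 2 - 1| := by
    intro x
    rw [show (‖v‖ * x) ^ 2 - ‖v‖ ^ 2 = ‖v‖ ^ 2 * (x ^ 2 - 1) by ring, abs_mul,
      abs_of_nonneg (sq_nonneg _)]
  simp_rw [h]
  rw [integral_const_mul, integral_abs_sq_sub_one_gaussianReal, mul_comm]

/-- `D₂ x v` is the second derivative of `Ψ` at `x` in the direction `v`. -/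
def HasSecondDirDeriv (Ψ : E → ℝ) (D₁ D₂ : E → E → ℝ) : Prop :=
  (∀ x v, HasDerivAt (fun r : ℝ => Ψ (x + r • v)) (D₁ x v) 0) ∧
    ∀ x v, HasDerivAt (fun r : ℝ => D₁ (x + r • v) v) (D₂ x v) 0

/-- Allows an estimate proved for one representation of a second derivative to be transferred to
another, such as `smoothD2`. -/
lemma HasSecondDirDeriv.unique {Ψ : E → ℝ} {D₁ D₂ D₁' D₂' : E → E → ℝ}
    (h : HasSecondDirDeriv Ψ D₁ D₂) (h' : HasSecondDirDeriv Ψ D₁' D₂') : D₂ = D₂' := by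
  have h1 : D₁ = D₁' := by
    ext x v
    exact (h.1 x v).unique (h'.1 x v)
  subst h1
  ext x v
  exact (h.2 x v).unique (h'.2 x v)

lemma HasSecondDirDeriv.add {Ψ Ψ' : E → ℝ} {D₁ D₂ D₁' D₂' : E → E → ℝ}
    (h : HasSecondDirDeriv Ψ D₁ D₂) (h' : HasSecondDirDeriv Ψ' D₁' D₂') :
    HasSecondDirDeriv (fun x => Ψ x + Ψ' x) (fun x v => D₁ x v + D₁' x v)
      (fun x v => D₂ x v + D₂' x v) :=
  ⟨fun x v => (h.1 x v).add (h'.1 x v), fun x v => (h.2 x v).add (h'.2 x v)⟩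

lemma HasSecondDirDeriv.sub_const {Ψ : E → ℝ} {D₁ D₂ : E → E → ℝ}
    (h : HasSecondDirDeriv Ψ D₁ D₂) (c : ℝ) :
    HasSecondDirDeriv (fun x => Ψ x - c) D₁ D₂ :=
  ⟨fun x v => (h.1 x v).sub_const c, h.2⟩

lemma hasDerivAt_along_line {Ψ : E → ℝ} {D₁ : E → E → ℝ}
    (h : ∀ x v, HasDerivAt (fun r : ℝ => Ψ (x + r • v)) (D₁ x v) 0) (x v : E) (t : ℝ) :
    HasDerivAt (fun r : ℝ => Ψ (x + r • v)) (D₁ (x + t • v) v) t := by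
  have h1 : HasDerivAt (fun r : ℝ => Ψ (x + t • v + r • v)) (D₁ (x + t • v) v) (t - t) := by
    rw [sub_self]
    exact h _ v
  have h2 := h1.comp_sub_const t t
  refine h2.congr_of_eventuallyEq (Eventually.of_forall fun r => ?_)
  simp only
  rw [add_assoc, ← add_smul]
  congr 3
  ring

lemma abs_sub_le_of_dirDeriv_le {Ψ : E → ℝ} {D₁ : E → E → ℝ}
    (h : ∀ x v, HasDerivAt (fun r : ℝ => Ψ (x + r • v)) (D₁ x v) 0) {C : ℝ} (x u : E)
    (hC : ∀ y, |D₁ y u| ≤ C) : |Ψ (x + u) - Ψ x| ≤ C := by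
  have := (convex_univ (𝕜 := ℝ) (E := ℝ)).norm_image_sub_le_of_norm_hasDerivWithin_le
    (f := fun r : ℝ => Ψ (x + r • u)) (f' := fun r => D₁ (x + r • u) u) (C := C) (x := 0) (y := 1)
    (fun r _ => (hasDerivAt_along_line h x u r).hasDerivWithinAt) (fun r _ => hC _)
    (Set.mem_univ _) (Set.mem_univ _)
  simpa using this

variable {g : E → ℝ} {M s : ℝ}

lemma linear_growth_of_bounded (hgM : ∀ x, |g x| ≤ M) (v : E) (x : E) (s : ℝ) (z : E) :
    |g (x + s • z) * ⟪z, v⟫| ≤ M * ‖v‖ * (1 + ‖z‖) := by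
  have hM0 : 0 ≤ M := (abs_nonneg _).trans (hgM 0)
  rw [abs_mul]
  calc |g (x + s • z)| * |⟪z, v⟫| ≤ M * (‖z‖ * ‖v‖) := by
        gcongr
        · exact hgM _
        · exact abs_real_inner_le_norm z v
    _ ≤ M * ‖v‖ * (1 + ‖z‖) := by nlinarith [mul_nonneg hM0 (norm_nonneg v)]

lemma hasDerivAt_smoothing (hg : Measurable g) (hgM : ∀ x, |g x| ≤ M) (hs : 0 < s) (x v : E) :
    HasDerivAt (fun r : ℝ => ∫ z, g (x + r • v + s • z) ∂(stdGaussian E))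
      (s⁻¹ * ∫ z, g (x + s • z) * ⟪z, v⟫ ∂(stdGaussian E)) 0 := by
  have hM0 : 0 ≤ M := (abs_nonneg _).trans (hgM 0)
  have h := hasDerivAt_integral_add_smul_stdGaussian (h := fun z => g (x + s • z))
    (hg.comp (by fun_prop)) (M := M)
    (fun z => (hgM _).trans (by nlinarith [norm_nonneg z])) (s⁻¹ • v)
  have e1 : ∀ (r : ℝ) (z : E), x + s • (z + r • s⁻¹ • v) = x + r • v + s • z := by
    intro r z
    rw [smul_add, smul_comm r, smul_smul, mul_inv_cancel₀ hs.ne', one_smul]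
    abel
  simp_rw [e1, real_inner_smul_right] at h
  refine h.congr_deriv ?_
  rw [← integral_const_mul]
  congr 1
  ext z
  ring

lemma hasDerivAt_smoothing_mul_inner (hg : Measurable g) (hgM : ∀ x, |g x| ≤ M) (hs : 0 < s)
    (x v : E) :
    HasDerivAt (fun r : ℝ => s⁻¹ * ∫ z, g (x + r • v + s • z) * ⟪z, v⟫ ∂(stdGaussian E))
      ((s ^ 2)⁻¹ * ∫ z, g (x + s • z) * (⟪z, v⟫ ^ 2 - ‖v‖ ^ 2) ∂(stdGaussian E)) 0 := by
  have hM0 : 0 ≤ M := (abs_nonneg _).trans (hgM 0)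
  have hgm : Measurable fun z : E => g (x + s • z) := hg.comp (by fun_prop)
  have h := hasDerivAt_integral_add_smul_stdGaussian (h := fun z => g (x + s • z) * ⟪z, v⟫)
    (hgm.mul (by fun_prop)) (linear_growth_of_bounded hgM v x s) (s⁻¹ • v)
  -- Translating `z` also changes the factor `⟪z, v⟫`, by `r * s⁻¹ * ‖v‖ ^ 2`. This surplus is
  -- differentiated separately and subtracted, which produces the `-‖v‖ ^ 2`.
  have h2 := (hasDerivAt_id (0 : ℝ)).mul (hasDerivAt_smoothing hg hgM hs x v)
  have h3 := (h.sub (h2.const_mul (s⁻¹ * ‖v‖ ^ 2))).const_mul s⁻¹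
  have e1 : ∀ (r : ℝ) (z : E), x + s • (z + r • s⁻¹ • v) = x + r • v + s • z := by
    intro r z
    rw [smul_add, smul_comm r, smul_smul, mul_inv_cancel₀ hs.ne', one_smul]
    abel
  have hb : ∀ (y : E), Integrable (fun z => g (y + s • z)) (stdGaussian E) := fun y =>
    integrable_of_linear_growth_stdGaussian (hg.comp (by fun_prop)) (M := M)
      (fun z => (hgM _).trans (by nlinarith [norm_nonneg z]))
  have hb2 : ∀ (y : E), Integrable (fun z => g (y + s • z) * ⟪z, v⟫) (stdGaussian E) := fun y =>
    integrable_of_linear_growth_stdGaussian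
      ((hg.comp (by fun_prop : Measurable fun z : E => y + s • z)).mul (by fun_prop))
      (linear_growth_of_bounded hgM v y s)
  refine (h3.congr_deriv ?_).congr_of_eventuallyEq (Eventually.of_forall fun r => ?_)
  · simp_rw [id, zero_mul, add_zero, one_mul, zero_smul, add_zero]
    rw [mul_sub, ← integral_const_mul, ← integral_const_mul, ← integral_const_mul,
      ← integral_const_mul, ← integral_sub]
    · congr 1
      ext z
      rw [real_inner_smul_right]
      field_simp
    · refine Integrable.const_mul ?_ _
      have hgr : Integrable (fun z : E => ⟪z, v⟫ ^ 2) (stdGaussian E) := by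
        have := (memLp_id_gaussianReal' (μ := 0) (v := ‖v‖₊ ^ 2) 2 (by simp)).integrable_sq
        rw [← stdGaussian_map_inner] at this
        exact this.comp_measurable (by fun_prop)
      refine ((hgr.const_mul (M * s⁻¹))).mono' ((hgm.mul (by fun_prop)).mul
        (by fun_prop)).aestronglyMeasurable (ae_of_all _ fun z => ?_)
      rw [real_inner_smul_right, Real.norm_eq_abs]
      rw [show g (x + s • z) * ⟪z, v⟫ * (s⁻¹ * ⟪z, v⟫)
        = g (x + s • z) * (s⁻¹ * ⟪z, v⟫ ^ 2) by ring, abs_mul, mul_assoc]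
      rw [abs_of_nonneg (by positivity : 0 ≤ s⁻¹ * ⟪z, v⟫ ^ 2)]
      gcongr
      exact hgM _
    · exact ((hb x).const_mul _).const_mul _
  · have e2 : ∀ z : E, g (x + s • (z + r • s⁻¹ • v)) * ⟪z + r • s⁻¹ • v, v⟫
        = g (x + r • v + s • z) * ⟪z, v⟫ + g (x + r • v + s • z) * (r * (s⁻¹ * ‖v‖ ^ 2)) := by
      intro z
      rw [e1, inner_add_left, real_inner_smul_left, real_inner_smul_left,
        real_inner_self_eq_norm_sq]
      ring
    simp only [Pi.sub_apply, Pi.mul_apply, id]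
    simp_rw [e2]
    rw [integral_add (hb2 _) ((hb _).mul_const _), integral_mul_const]
    ring

lemma hasSecondDirDeriv_smoothing (hg : Measurable g) (hgM : ∀ x, |g x| ≤ M) (hs : 0 < s) :
    HasSecondDirDeriv (fun x => ∫ z, g (x + s • z) ∂(stdGaussian E))
      (fun x v => s⁻¹ * ∫ z, g (x + s • z) * ⟪z, v⟫ ∂(stdGaussian E))
      (fun x v => (s ^ 2)⁻¹ * ∫ z, g (x + s • z) * (⟪z, v⟫ ^ 2 - ‖v‖ ^ 2) ∂(stdGaussian E)) :=
  ⟨hasDerivAt_smoothing hg hgM hs, hasDerivAt_smoothing_mul_inner hg hgM hs⟩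

lemma integrable_abs_inner_stdGaussian (v : E) :
    Integrable (fun z : E => |⟪z, v⟫|) (stdGaussian E) :=
  integrable_of_linear_growth_stdGaussian (M := ‖v‖) (by fun_prop) fun z => by
    rw [abs_abs]
    nlinarith [abs_real_inner_le_norm z v, norm_nonneg v]

lemma integrable_abs_inner_sq_sub_stdGaussian (v : E) :
    Integrable (fun z : E => |⟪z, v⟫ ^ 2 - ‖v‖ ^ 2|) (stdGaussian E) := by
  have := (memLp_id_gaussianReal' (μ := 0) (v := ‖v‖₊ ^ 2) 2 (by simp)).integrable_sq
  rw [← stdGaussian_map_inner] at this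
  exact ((this.comp_measurable (by fun_prop)).sub (integrable_const _)).abs

lemma abs_integral_mul_le {Ω : Type*} [MeasurableSpace Ω] {μ : Measure Ω} {a b : Ω → ℝ} {M : ℝ}
    (ha : ∀ ω, |a ω| ≤ M) (hb : Integrable (fun ω => |b ω|) μ) :
    |∫ ω, a ω * b ω ∂μ| ≤ M * ∫ ω, |b ω| ∂μ := by
  rw [← integral_const_mul]
  refine norm_integral_le_of_norm_le (f := fun ω => a ω * b ω) (hb.const_mul M)
    (ae_of_all _ fun ω => ?_)
  rw [Real.norm_eq_abs, abs_mul]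
  gcongr
  exact ha ω

lemma abs_smoothing_sub_le (hg : Measurable g) (hgM : ∀ x, |g x| ≤ M) (hs : 0 < s) (x u : E) :
    |∫ z, g (x + u + s • z) ∂(stdGaussian E) - ∫ z, g (x + s • z) ∂(stdGaussian E)|
      ≤ M * √(2 / Real.pi) / s * ‖u‖ := by
  refine abs_sub_le_of_dirDeriv_le (Ψ := fun x => ∫ z, g (x + s • z) ∂(stdGaussian E))
    (hasDerivAt_smoothing hg hgM hs) x u fun y => ?_
  rw [abs_mul, abs_of_pos (inv_pos.2 hs)]
  calc s⁻¹ * |∫ z, g (y + s • z) * ⟪z, u⟫ ∂(stdGaussian E)|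
      ≤ s⁻¹ * (M * ∫ z, |⟪z, u⟫| ∂(stdGaussian E)) := by
        gcongr
        exact abs_integral_mul_le (fun z => hgM _) (integrable_abs_inner_stdGaussian u)
    _ = _ := by
      rw [integral_abs_inner_stdGaussian]
      ring

lemma abs_second_smoothing_sub_le {K : ℝ} (hg : Measurable g) (hgM : ∀ x, |g x| ≤ M)
    (hs : 0 < s) (x u v : E) (hK : ∀ x, |g (x + u) - g x| ≤ K) :
    |(s ^ 2)⁻¹ * ∫ z, g (x + u + s • z) * (⟪z, v⟫ ^ 2 - ‖v‖ ^ 2) ∂(stdGaussian E)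
      - (s ^ 2)⁻¹ * ∫ z, g (x + s • z) * (⟪z, v⟫ ^ 2 - ‖v‖ ^ 2) ∂(stdGaussian E)|
      ≤ (s ^ 2)⁻¹ * (K * (4 * Real.exp (-(1 / 2)) / √(2 * Real.pi) * ‖v‖ ^ 2)) := by
  have hint : ∀ y : E, Integrable (fun z => g (y + s • z) * (⟪z, v⟫ ^ 2 - ‖v‖ ^ 2))
      (stdGaussian E) := by
    intro y
    refine ((integrable_abs_inner_sq_sub_stdGaussian v).const_mul M).mono'
      ((hg.comp (by fun_prop : Measurable fun z : E => y + s • z)).mul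
        (by fun_prop)).aestronglyMeasurable (ae_of_all _ fun z => ?_)
    rw [Real.norm_eq_abs, abs_mul]
    gcongr
    exact hgM _
  rw [← mul_sub, ← integral_sub (hint _) (hint _), abs_mul, abs_of_pos (by positivity),
    ← integral_abs_inner_sq_sub_stdGaussian]
  gcongr
  simp_rw [← sub_mul]
  refine abs_integral_mul_le (fun z => ?_) (integrable_abs_inner_sq_sub_stdGaussian v)
  rw [show x + u + s • z = x + s • z + u by abel]
  exact hK _

lemma charFun_map_smul_stdGaussian (s : ℝ) (t : E) :
    charFun ((stdGaussian E).map (s • ·)) t = Complex.exp (-(s ^ 2 * ‖t‖ ^ 2) / 2) := by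
  rw [charFun_map_smul, charFun_stdGaussian, norm_smul]
  congr 1
  push_cast
  rw [mul_pow, ← Complex.ofReal_pow, Real.norm_eq_abs, sq_abs]
  push_cast
  ring

lemma stdGaussian_smul_conv (a b c : ℝ) (h : a ^ 2 + b ^ 2 = c ^ 2) :
    ((stdGaussian E).map (a • ·)) ∗ ((stdGaussian E).map (b • ·)) = (stdGaussian E).map (c • ·) := by
  have : ∀ r : ℝ, IsProbabilityMeasure ((stdGaussian E).map (r • · : E → E)) := fun r =>
    Measure.isProbabilityMeasure_map (by fun_prop)
  refine Measure.ext_of_charFun ?_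
  ext t
  rw [charFun_conv, charFun_map_smul_stdGaussian, charFun_map_smul_stdGaussian,
    charFun_map_smul_stdGaussian, ← Complex.exp_add]
  congr 1
  have : (a : ℂ) ^ 2 + (b : ℂ) ^ 2 = (c : ℂ) ^ 2 := by exact_mod_cast h
  rw [← this]
  ring

lemma integral_stdGaussian_smul_smul {a b c : ℝ} (h : a ^ 2 + b ^ 2 = c ^ 2) (hg : Measurable g)
    (hgM : ∀ x, |g x| ≤ M) (x : E) :
    ∫ z, g (x + c • z) ∂(stdGaussian E)
      = ∫ z, ∫ z', g (x + a • z + b • z') ∂(stdGaussian E) ∂(stdGaussian E) := by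
  have : ∀ r : ℝ, IsProbabilityMeasure ((stdGaussian E).map (r • · : E → E)) := fun r =>
    Measure.isProbabilityMeasure_map (by fun_prop)
  have hgx : Measurable fun z => g (x + z) := hg.comp (by fun_prop)
  rw [← integral_map (φ := fun z : E => c • z) (f := fun z => g (x + z)) (by fun_prop)
    hgx.aestronglyMeasurable, ← stdGaussian_smul_conv a b c h, integral_conv, integral_map
    (by fun_prop)]
  · congr 1
    ext z
    rw [integral_map (by fun_prop)]
    · simp_rw [add_assoc]
    · exact (hgx.comp (by fun_prop)).aestronglyMeasurable
  · have : StronglyMeasurable fun p : E × E => g (x + (p.1 + p.2)) :=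
      (hgx.comp (by fun_prop : Measurable fun p : E × E => p.1 + p.2)).stronglyMeasurable
    exact (this.integral_prod_right').aestronglyMeasurable
  · exact (integrable_const M).mono' hgx.aestronglyMeasurable (ae_of_all _ fun z => hgM _)

/-- The constant in the bound for third derivatives of a Gaussian smoothing. -/
noncomputable def thirdConst : ℝ :=
  √(2 / Real.pi) * (4 * Real.exp (-(1 / 2)) / √(2 * Real.pi)) * (3 * √3 / 2)

/-- The Gaussian of variance s² is split into independent parts of variances a² and b²: two
derivatives fall on the first, the increment along `u` on the second. The price 1/(a² b) is least
for a² = 2s²/3 and b² = s²/3, whence the factor 3√3/2 in `thirdConst`. -/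
lemma exists_second_smoothing_lipschitz (hg : Measurable g) (hgM : ∀ x, |g x| ≤ M)
    (hs : 0 < s) :
    ∃ D₁ D₂ : E → E → ℝ, HasSecondDirDeriv (fun x => ∫ z, g (x + s • z) ∂(stdGaussian E)) D₁ D₂ ∧
      ∀ x u v, |D₂ (x + u) v - D₂ x v| ≤ thirdConst * M / s ^ 3 * ‖u‖ * ‖v‖ ^ 2 := by
  have hM0 : 0 ≤ M := (abs_nonneg _).trans (hgM 0)
  have h3 : (0 : ℝ) < √3 := by positivity
  have h3s : √3 ^ 2 = 3 := Real.sq_sqrt (by norm_num)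
  have h2 : (0 : ℝ) < √(2 / 3) := by positivity
  have h2s : √(2 / 3 : ℝ) ^ 2 = 2 / 3 := Real.sq_sqrt (by norm_num)
  set a : ℝ := s * √(2 / 3)
  set b : ℝ := s / √3
  have ha : 0 < a := by positivity
  have hb : 0 < b := by positivity
  have hab : a ^ 2 + b ^ 2 = s ^ 2 := by
    simp only [a, b, mul_pow, div_pow, h2s, h3s]
    ring
  set g₂ : E → ℝ := fun x => ∫ z, g (x + b • z) ∂(stdGaussian E)
  have hg₂ : Measurable g₂ := by
    have : StronglyMeasurable fun p : E × E => g (p.1 + b • p.2) :=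
      (hg.comp (by fun_prop : Measurable fun p : E × E => p.1 + b • p.2)).stronglyMeasurable
    exact this.integral_prod_right'.measurable
  have hg₂M : ∀ x, |g₂ x| ≤ M := fun x => by
    have := norm_integral_le_of_norm_le_const (μ := stdGaussian E)
      (f := fun z => g (x + b • z)) (C := M) (ae_of_all _ fun z => hgM _)
    simpa using this
  have hΨ : (fun x => ∫ z, g (x + s • z) ∂(stdGaussian E))
      = fun x => ∫ z, g₂ (x + a • z) ∂(stdGaussian E) := by
    ext x
    exact integral_stdGaussian_smul_smul hab hg hgM x
  rw [hΨ]
  refine ⟨_, _, hasSecondDirDeriv_smoothing hg₂ hg₂M ha, fun x u v => ?_⟩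
  refine (abs_second_smoothing_sub_le hg₂ hg₂M ha x u v
    (fun y => abs_smoothing_sub_le hg hgM hb y u)).trans_eq ?_
  have ha2 : a ^ 2 = s ^ 2 * (2 / 3) := by rw [mul_pow, h2s]
  rw [ha2, thirdConst]
  simp only [b]
  field_simp

end GaussianSmoothing

/-! ### Smooth test functions and two Lipschitz estimates for their second derivatives. -/

section TestFunctions

open scoped RealInnerProductSpace

variable {E : Type*} [NormedAddCommGroup E] [InnerProductSpace ℝ E] [FiniteDimensional ℝ E]
  [MeasurableSpace E] [BorelSpace E]

/-- A function with values in `[0, 1]` and with bounded Lipschitz gradient `G`, which vanishes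
outside the open set `U`. -/
structure IsSmoothTest (f : E → ℝ) (G : E → E) (U : Set E) (M₁ M₂ : ℝ) : Prop where
  nonneg : ∀ x, 0 ≤ f x
  le_one : ∀ x, f x ≤ 1
  hasGradientAt : ∀ x, HasGradientAt f (G x) x
  norm_le : ∀ x, ‖G x‖ ≤ M₁
  lipschitz : ∀ x y, ‖G x - G y‖ ≤ M₂ * ‖x - y‖
  isOpen : IsOpen U
  eq_zero : ∀ x, x ∉ U → G x = 0

variable {f : E → ℝ} {G : E → E} {U : Set E} {M₁ M₂ : ℝ}

lemma IsSmoothTest.continuous (h : IsSmoothTest f G U M₁ M₂) : Continuous f :=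
  continuous_iff_continuousAt.2 fun x => (h.hasGradientAt x).continuousAt

lemma IsSmoothTest.continuous_gradient (h : IsSmoothTest f G U M₁ M₂) : Continuous G :=
  (LipschitzWith.of_dist_le' fun x y => by
    rw [dist_eq_norm, dist_eq_norm]
    exact h.lipschitz x y).continuous

lemma IsSmoothTest.abs_le_one (h : IsSmoothTest f G U M₁ M₂) (x : E) : |f x| ≤ 1 :=
  abs_le.2 ⟨by linarith [h.nonneg x], h.le_one x⟩

lemma IsSmoothTest.nonneg_left (h : IsSmoothTest f G U M₁ M₂) : 0 ≤ M₁ :=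
  (norm_nonneg _).trans (h.norm_le 0)

/-- Between the first and the last point of [0, 1] outside `T` the net change is zero, and beyond
these two points only elements of `T` remain. This avoids almost everywhere derivatives of a
Lipschitz gradient. -/
lemma abs_sub_le_mul_volume_of_lipschitz {φ : ℝ → ℝ} {L : ℝ} (hL : 0 ≤ L)
    (hφ : ∀ a b, |φ a - φ b| ≤ L * |a - b|) {T : Set ℝ} (hT : IsOpen T)
    (h0 : ∀ r, r ∉ T → φ r = 0) :
    |φ 1 - φ 0| ≤ L * volume.real (Set.Icc (0 : ℝ) 1 ∩ T) := by
  have hfin : ∀ s : Set ℝ, s ⊆ Set.Icc (0 : ℝ) 1 → volume s ≠ ⊤ := fun s hs =>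
    ((measure_mono hs).trans_lt (by simp)).ne
  by_cases hsub : Set.Icc (0 : ℝ) 1 ⊆ T
  · rw [Set.inter_eq_left.2 hsub]
    simpa using hφ 1 0
  · have hne : (Set.Icc (0 : ℝ) 1 ∩ Tᶜ).Nonempty := by
      obtain ⟨x, hx, hxT⟩ := Set.not_subset.1 hsub
      exact ⟨x, hx, hxT⟩
    have hcomp : IsCompact (Set.Icc (0 : ℝ) 1 ∩ Tᶜ) := isCompact_Icc.inter_right hT.isClosed_compl
    obtain ⟨a, ⟨ha, haT⟩, hamin⟩ := hcomp.exists_isLeast hne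
    obtain ⟨b, ⟨hb, hbT⟩, hbmax⟩ := hcomp.exists_isGreatest hne
    have hab : a ≤ b := hamin ⟨hb, hbT⟩
    have hsub2 : Set.Ico 0 a ∪ Set.Ioc b 1 ⊆ Set.Icc (0 : ℝ) 1 ∩ T := by
      rintro r (hr | hr)
      · have hr1 : r ∈ Set.Icc (0 : ℝ) 1 := ⟨hr.1, hr.2.le.trans ha.2⟩
        refine ⟨hr1, ?_⟩
        by_contra hrT
        exact absurd (hamin ⟨hr1, hrT⟩) (not_le.2 hr.2)
      · have hr1 : r ∈ Set.Icc (0 : ℝ) 1 := ⟨hb.1.trans hr.1.le, hr.2⟩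
        refine ⟨hr1, ?_⟩
        by_contra hrT
        exact absurd (hbmax ⟨hr1, hrT⟩) (not_le.2 hr.1)
    have hvol : a + (1 - b) ≤ volume.real (Set.Icc (0 : ℝ) 1 ∩ T) := by
      have h1 := measureReal_mono hsub2 (hfin _ Set.inter_subset_left)
      rw [measureReal_union (Set.disjoint_left.2 fun x hx hx' =>
        absurd (hx.2.trans_le hab) (not_lt.2 hx'.1.le)) measurableSet_Ioc
        (by simp) (by simp)] at h1
      simpa [measureReal_def, ha.1, hb.2] using h1
    have h1 := hφ 1 b
    have h2 := hφ a 0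
    rw [h0 b hbT, abs_of_nonneg (by linarith [hb.2] : (0 : ℝ) ≤ 1 - b)] at h1
    rw [h0 a haT, abs_of_nonneg (by linarith [ha.1] : (0 : ℝ) ≤ a - 0)] at h2
    calc |φ 1 - φ 0| = |(φ 1 - 0) + (0 - φ 0)| := by ring_nf
      _ ≤ |φ 1 - 0| + |0 - φ 0| := abs_add_le _ _
      _ ≤ L * (a + (1 - b)) := by linarith
      _ ≤ _ := by gcongr

lemma IsSmoothTest.abs_inner_sub_le (h : IsSmoothTest f G U M₁ M₂) (hM₂ : 0 ≤ M₂) (x u v : E) :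
    |⟪G (x + u) - G x, v⟫| ≤
      M₂ * ‖u‖ * ‖v‖ * volume.real (Set.Icc (0 : ℝ) 1 ∩ {r | x + r • u ∈ U}) := by
  have := abs_sub_le_mul_volume_of_lipschitz (φ := fun r => ⟪G (x + r • u), v⟫)
    (L := M₂ * ‖u‖ * ‖v‖) (T := {r | x + r • u ∈ U}) (by positivity) (fun a b => ?_)
    (h.isOpen.preimage (by fun_prop : Continuous fun r : ℝ => x + r • u))
    (fun r hr => by rw [h.eq_zero _ hr, inner_zero_left])
  · simpa [inner_sub_left] using this
  · rw [← inner_sub_left]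
    refine (abs_real_inner_le_norm _ _).trans ?_
    have h1 := h.lipschitz (x + a • u) (x + b • u)
    rw [add_sub_add_left_eq_sub, ← sub_smul, norm_smul, Real.norm_eq_abs] at h1
    calc ‖G (x + a • u) - G (x + b • u)‖ * ‖v‖ ≤ (M₂ * (|a - b| * ‖u‖)) * ‖v‖ := by gcongr
      _ = _ := by ring

lemma IsSmoothTest.integrable_inner (h : IsSmoothTest f G U M₁ M₂) (κ : Measure E)
    [IsFiniteMeasure κ] (x v : E) : Integrable (fun w => ⟪G (x + w), v⟫) κ := by
  refine (integrable_const (M₁ * ‖v‖)).mono' ?_ (ae_of_all _ fun w => ?_)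
  · have := h.continuous_gradient
    exact Continuous.aestronglyMeasurable (by fun_prop)
  · refine (abs_real_inner_le_norm _ _).trans ?_
    gcongr
    exact h.norm_le _

/-- Only the part of the segment inside `U` counts. By Fubini, its mean length is an average over
the segment of probabilities of translates of `U`, each at most `S`; this gains the factor `S` over
the plain Lipschitz bound. -/
lemma IsSmoothTest.abs_integral_inner_sub_le (h : IsSmoothTest f G U M₁ M₂) (hM₂ : 0 ≤ M₂)
    (κ : Measure E) [IsProbabilityMeasure κ] {S : ℝ} (hS : ∀ y, κ.real {w | y + w ∈ U} ≤ S)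
    (x u v : E) :
    |∫ w, ⟪G (x + u + w), v⟫ ∂κ - ∫ w, ⟪G (x + w), v⟫ ∂κ| ≤ M₂ * ‖u‖ * ‖v‖ * S := by
  have hS0 : 0 ≤ S := measureReal_nonneg.trans (hS 0)
  set A : Set (E × ℝ) := {p | x + p.1 + p.2 • u ∈ U}
  have hA : MeasurableSet A := (h.isOpen.preimage (by fun_prop :
    Continuous fun p : E × ℝ => x + p.1 + p.2 • u)).measurableSet
  set vol := (volume : Measure ℝ).restrict (Set.Icc 0 1)
  have : IsProbabilityMeasure vol := ⟨by simp [vol]⟩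
  have h1 : ∀ w, volume.real (Set.Icc (0 : ℝ) 1 ∩ {r | x + w + r • u ∈ U})
      = vol.real (Prod.mk w ⁻¹' A) := by
    intro w
    rw [measureReal_def, measureReal_def, Measure.restrict_apply (measurable_prodMk_left hA),
      Set.inter_comm]
    rfl
  have hfib : Measurable fun w => vol.real (Prod.mk w ⁻¹' A) :=
    (measurable_measure_prodMk_left hA).ennreal_toReal
  have hint : Integrable (fun w => vol.real (Prod.mk w ⁻¹' A)) κ :=
    (integrable_const (1 : ℝ)).mono' hfib.aestronglyMeasurable
      (ae_of_all _ fun w => by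
        rw [Real.norm_eq_abs, abs_of_nonneg measureReal_nonneg]
        exact measureReal_le_one)
  have h2 : ∫ w, vol.real (Prod.mk w ⁻¹' A) ∂κ ≤ S := by
    have e1 : ∫ w, vol.real (Prod.mk w ⁻¹' A) ∂κ = (κ.prod vol).real A := by
      rw [measureReal_def, Measure.prod_apply hA]
      simp_rw [measureReal_def]
      rw [integral_toReal (measurable_measure_prodMk_left hA).aemeasurable
        (ae_of_all _ fun w => measure_lt_top _ _)]
    rw [e1, measureReal_def, Measure.prod_apply_symm hA]
    refine ENNReal.toReal_le_of_le_ofReal hS0 ?_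
    calc ∫⁻ r, κ ((fun w => (w, r)) ⁻¹' A) ∂vol ≤ ∫⁻ _, ENNReal.ofReal S ∂vol := by
          refine lintegral_mono fun r => ?_
          rw [← ENNReal.ofReal_toReal (measure_ne_top κ _)]
          refine ENNReal.ofReal_le_ofReal ?_
          have := hS (x + r • u)
          rw [measureReal_def] at this
          convert this using 3
          ext w
          simp only [A, Set.mem_preimage, Set.mem_ofPred_eq]
          rw [show x + w + r • u = x + r • u + w by abel]
      _ = ENNReal.ofReal S := by simp
  rw [← integral_sub (h.integrable_inner κ _ _) (h.integrable_inner κ _ _)]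
  simp_rw [← inner_sub_left]
  calc |∫ w, ⟪G (x + u + w) - G (x + w), v⟫ ∂κ|
      ≤ ∫ w, M₂ * ‖u‖ * ‖v‖ * vol.real (Prod.mk w ⁻¹' A) ∂κ := by
        refine norm_integral_le_of_norm_le (f := fun w => ⟪G (x + u + w) - G (x + w), v⟫)
          (hint.const_mul _) (ae_of_all _ fun w => ?_)
        rw [← h1, Real.norm_eq_abs, show x + u + w = x + w + u by abel]
        exact h.abs_inner_sub_le hM₂ (x + w) u v
    _ = M₂ * ‖u‖ * ‖v‖ * ∫ w, vol.real (Prod.mk w ⁻¹' A) ∂κ := integral_const_mul _ _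
    _ ≤ _ := by gcongr

lemma IsSmoothTest.hasDerivAt_line (h : IsSmoothTest f G U M₁ M₂) (x v : E) (r : ℝ) :
    HasDerivAt (fun r : ℝ => f (x + r • v)) ⟪G (x + r • v), v⟫ r := by
  have h1 := (h.hasGradientAt (x + r • v)).hasFDerivAt
  have h2 : HasDerivAt (fun r : ℝ => x + r • v) v r := by
    simpa using ((hasDerivAt_id r).smul_const v).const_add x
  have h3 := h1.comp_hasDerivAt r h2
  exact h3.congr_deriv (by simp)

lemma IsSmoothTest.hasDerivAt_integral (h : IsSmoothTest f G U M₁ M₂) (κ : Measure E)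
    [IsProbabilityMeasure κ] (x v : E) :
    HasDerivAt (fun r : ℝ => ∫ w, f (x + r • v + w) ∂κ) (∫ w, ⟪G (x + w), v⟫ ∂κ) 0 := by
  have hc := h.continuous
  have hG := h.continuous_gradient
  have key := hasDerivAt_integral_of_dominated_loc_of_deriv_le (μ := κ)
    (F := fun r w => f (x + w + r • v)) (F' := fun r w => ⟪G (x + w + r • v), v⟫) (x₀ := (0 : ℝ))
    (s := Set.univ) (bound := fun _ => M₁ * ‖v‖) univ_mem
    (Eventually.of_forall fun r => Continuous.aestronglyMeasurable (by fun_prop))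
    ((integrable_const (1 : ℝ)).mono' (Continuous.aestronglyMeasurable (by fun_prop))
      (ae_of_all _ fun w => h.abs_le_one _))
    (Continuous.aestronglyMeasurable (by fun_prop))
    (ae_of_all _ fun w r _ => (abs_real_inner_le_norm _ _).trans (by gcongr; exact h.norm_le _))
    (integrable_const _) (ae_of_all _ fun w r _ => h.hasDerivAt_line _ _ _)
  have h2 := key.2
  simp only [zero_smul, add_zero] at h2
  refine h2.congr_of_eventuallyEq (Eventually.of_forall fun r => ?_)
  simp only
  congr 1
  ext w
  rw [show x + r • v + w = x + w + r • v by abel]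

/-- The second directional derivative of the smoothing of a function with gradient `G` by the
convolution of `κ` with a centred Gaussian of standard deviation `s`. -/
noncomputable def smoothD2 (G : E → E) (κ : Measure E) (s : ℝ) (x v : E) : ℝ :=
  s⁻¹ * ∫ z, (∫ w, ⟪G (x + s • z + w), v⟫ ∂κ) * ⟪z, v⟫ ∂(stdGaussian E)

lemma IsSmoothTest.abs_integral_inner_le (h : IsSmoothTest f G U M₁ M₂) (κ : Measure E)
    [IsProbabilityMeasure κ] (x v : E) : |∫ w, ⟪G (x + w), v⟫ ∂κ| ≤ M₁ * ‖v‖ := by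
  have := norm_integral_le_of_norm_le_const (μ := κ) (f := fun w => ⟪G (x + w), v⟫)
    (C := M₁ * ‖v‖) (ae_of_all _ fun w => (abs_real_inner_le_norm _ _).trans
      (by gcongr; exact h.norm_le _))
  simpa using this

lemma IsSmoothTest.measurable_integral_inner (h : IsSmoothTest f G U M₁ M₂) (κ : Measure E)
    [IsProbabilityMeasure κ] (v : E) : Measurable fun x => ∫ w, ⟪G (x + w), v⟫ ∂κ := by
  have hG := h.continuous_gradient
  have : StronglyMeasurable fun p : E × E => ⟪G (p.1 + p.2), v⟫ :=
    Continuous.stronglyMeasurable (by fun_prop)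
  exact this.integral_prod_right'.measurable

instance isProbabilityMeasure_map_smul (κ : Measure E) [IsProbabilityMeasure κ] (s : ℝ) :
    IsProbabilityMeasure (κ.map (s • ·)) := Measure.isProbabilityMeasure_map (by fun_prop)

lemma integral_conv_smul_stdGaussian (κ : Measure E) [IsProbabilityMeasure κ] {g : E → ℝ}
    (hg : Measurable g) {M : ℝ} (hgM : ∀ x, |g x| ≤ M) (s : ℝ) (x : E) :
    ∫ y, g (x + y) ∂(κ ∗ (stdGaussian E).map (s • ·))
      = ∫ z, ∫ w, g (x + s • z + w) ∂κ ∂(stdGaussian E) := by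
  have hm : Measurable fun p : E × E => g (x + (p.1 + p.2)) := hg.comp (by fun_prop)
  rw [Measure.conv_comm, integral_conv, integral_map (by fun_prop)]
  · simp_rw [add_assoc]
  · exact hm.stronglyMeasurable.integral_prod_right'.aestronglyMeasurable
  · exact (integrable_const M).mono' (hg.comp (by fun_prop)).aestronglyMeasurable
      (ae_of_all _ fun z => hgM _)

lemma IsSmoothTest.hasSecondDirDeriv (h : IsSmoothTest f G U M₁ M₂) (κ : Measure E)
    [IsProbabilityMeasure κ] {s : ℝ} (hs : 0 < s) :
    HasSecondDirDeriv (fun x => ∫ w, f (x + w) ∂(κ ∗ (stdGaussian E).map (s • ·)))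
      (fun x v => ∫ w, ⟪G (x + w), v⟫ ∂(κ ∗ (stdGaussian E).map (s • ·)))
      (smoothD2 G κ s) := by
  refine ⟨h.hasDerivAt_integral _, fun x v => ?_⟩
  have hd := hasDerivAt_smoothing (h.measurable_integral_inner κ v)
    (fun x => h.abs_integral_inner_le κ x v) hs x v
  refine hd.congr_of_eventuallyEq (Eventually.of_forall fun r => ?_)
  have hG := h.continuous_gradient
  exact integral_conv_smul_stdGaussian κ (g := fun y => ⟪G y, v⟫) (M := M₁ * ‖v‖)
    (Continuous.measurable (by fun_prop))
    (fun y => (abs_real_inner_le_norm _ _).trans (by gcongr; exact h.norm_le _)) s _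

/-- The estimate for small angles. One derivative falls on the Gaussian, at the price E|N|/s only,
and the rest is an increment of the gradient of the test function. -/
lemma IsSmoothTest.abs_smoothD2_sub_le_of_measure_le (h : IsSmoothTest f G U M₁ M₂)
    (hM₂ : 0 ≤ M₂) (κ : Measure E) [IsProbabilityMeasure κ] {s : ℝ} (hs : 0 < s) {S : ℝ}
    (hS : ∀ y, κ.real {w | y + w ∈ U} ≤ S) (x u v : E) :
    |smoothD2 G κ s (x + u) v - smoothD2 G κ s x v|
      ≤ M₂ * √(2 / Real.pi) * S / s * ‖u‖ * ‖v‖ ^ 2 := by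
  have hint : ∀ y : E, Integrable (fun z => (∫ w, ⟪G (y + s • z + w), v⟫ ∂κ) * ⟪z, v⟫)
      (stdGaussian E) := fun y => by
    refine integrable_of_linear_growth_stdGaussian (M := M₁ * ‖v‖ * ‖v‖)
      (((h.measurable_integral_inner κ v).comp
        (by fun_prop : Measurable fun z : E => y + s • z)).mul (by fun_prop)) (fun z => ?_)
    exact linear_growth_of_bounded (fun x => h.abs_integral_inner_le κ x v) v y s z
  rw [smoothD2, smoothD2, ← mul_sub, ← integral_sub (hint _) (hint _), abs_mul,
    abs_of_pos (inv_pos.2 hs)]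
  simp_rw [← sub_mul]
  calc s⁻¹ * |∫ z, (∫ w, ⟪G (x + u + s • z + w), v⟫ ∂κ - ∫ w, ⟪G (x + s • z + w), v⟫ ∂κ) * ⟪z, v⟫
        ∂(stdGaussian E)|
      ≤ s⁻¹ * ((M₂ * ‖u‖ * ‖v‖ * S) * ∫ z, |⟪z, v⟫| ∂(stdGaussian E)) := by
        gcongr
        refine abs_integral_mul_le (fun z => ?_) (integrable_abs_inner_stdGaussian v)
        rw [show x + u + s • z = x + s • z + u by abel]
        exact h.abs_integral_inner_sub_le hM₂ κ hS _ u v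
    _ = _ := by
      rw [integral_abs_inner_stdGaussian]
      ring

/-- The estimate for large angles. Replacing `μ` by `μ'` leaves a remainder of sup norm `δ` smoothed
at scale `s`, and what is left has, by `heq`, a Gaussian component of scale `σ`, which may be much
larger than `s`. All derivatives fall on the Gaussians. -/
lemma IsSmoothTest.abs_smoothD2_sub_le_of_integral_le (h : IsSmoothTest f G U M₁ M₂)
    (μ μ' τ τ' : Measure E) [IsProbabilityMeasure μ] [IsProbabilityMeasure μ']
    [IsProbabilityMeasure τ] [IsProbabilityMeasure τ'] {s σ δ : ℝ} (hs : 0 < s) (hσ : 0 < σ)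
    (hδ : ∀ y, |∫ w, f (y + w) ∂μ - ∫ w, f (y + w) ∂μ'| ≤ δ)
    (heq : (μ' ∗ τ) ∗ (stdGaussian E).map (s • ·) = τ' ∗ (stdGaussian E).map (σ • ·))
    (x u v : E) :
    |smoothD2 G (μ ∗ τ) s (x + u) v - smoothD2 G (μ ∗ τ) s x v|
      ≤ thirdConst * (δ / s ^ 3 + 1 / 2 / σ ^ 3) * ‖u‖ * ‖v‖ ^ 2 := by
  have hf := h.continuous
  have hfint : ∀ (κ : Measure E) [IsProbabilityMeasure κ] (y : E),
      Integrable (fun w => f (y + w)) κ := fun κ _ y =>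
    (integrable_const (1 : ℝ)).mono' (Continuous.aestronglyMeasurable (by fun_prop))
      (ae_of_all _ fun w => h.abs_le_one _)
  have hmeas : ∀ (κ : Measure E) [IsProbabilityMeasure κ], Measurable fun y => ∫ w, f (y + w) ∂κ :=
    fun κ _ => by
      have : StronglyMeasurable fun p : E × E => f (p.1 + p.2) :=
        Continuous.stronglyMeasurable (by fun_prop)
      exact this.integral_prod_right'.measurable
  have hbd : ∀ (κ : Measure E) [IsProbabilityMeasure κ] (y : E),
      0 ≤ ∫ w, f (y + w) ∂κ ∧ ∫ w, f (y + w) ∂κ ≤ 1 := fun κ _ y => by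
    refine ⟨integral_nonneg fun w => h.nonneg _, ?_⟩
    have := integral_mono (hfint κ y) (integrable_const (1 : ℝ)) fun w => h.le_one _
    simpa using this
  have hconv : ∀ (κ κ' : Measure E) [IsProbabilityMeasure κ] [IsProbabilityMeasure κ'] (y : E),
      ∫ w, f (y + w) ∂(κ ∗ κ') = ∫ t, ∫ w, f (y + t + w) ∂κ ∂κ' := fun κ κ' _ _ y => by
    rw [Measure.conv_comm, integral_conv]
    · simp_rw [add_assoc]
    · exact hfint _ y
  set g : E → ℝ := fun y => ∫ w, f (y + w) ∂(μ ∗ τ) - ∫ w, f (y + w) ∂(μ' ∗ τ)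
  -- Subtracting 1/2 does not affect derivatives and brings the sup norm from 1 down to 1/2.
  set g' : E → ℝ := fun y => ∫ w, f (y + w) ∂τ' - 1 / 2
  have hg : Measurable g := (hmeas _).sub (hmeas _)
  have hg' : Measurable g' := (hmeas _).sub_const _
  have hgδ : ∀ y, |g y| ≤ δ := fun y => by
    simp only [g]
    rw [hconv, hconv, ← integral_sub]
    · have := norm_integral_le_of_norm_le_const (μ := τ)
        (f := fun t => ∫ w, f (y + t + w) ∂μ - ∫ w, f (y + t + w) ∂μ') (C := δ)
        (ae_of_all _ fun t => hδ _)
      simpa using this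
    · exact (integrable_const (1 : ℝ)).mono' ((hmeas μ).comp
        (measurable_const_add y)).aestronglyMeasurable (ae_of_all _ fun t =>
        abs_le.2 ⟨by linarith [(hbd μ (y + t)).1], (hbd μ (y + t)).2⟩)
    · exact (integrable_const (1 : ℝ)).mono' ((hmeas μ').comp
        (measurable_const_add y)).aestronglyMeasurable (ae_of_all _ fun t =>
        abs_le.2 ⟨by linarith [(hbd μ' (y + t)).1], (hbd μ' (y + t)).2⟩)
  have hg'2 : ∀ y, |g' y| ≤ 1 / 2 := fun y =>
    abs_le.2 ⟨by simp only [g']; linarith [(hbd τ' y).1], by simp only [g']; linarith [(hbd τ' y).2]⟩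
  obtain ⟨A₁, A₂, hA, hAl⟩ := exists_second_smoothing_lipschitz hg hgδ hs
  obtain ⟨B₁, B₂, hB, hBl⟩ := exists_second_smoothing_lipschitz hg' hg'2 hσ
  have hsum := (hA.add hB).sub_const (-(1 / 2))
  have hgi : ∀ (k : E → ℝ) (M : ℝ), Measurable k → (∀ y, |k y| ≤ M) → ∀ (c : ℝ) (y : E),
      Integrable (fun z => k (y + c • z)) (stdGaussian E) := fun k M hk hkM c y =>
    (integrable_const M).mono' (hk.comp (by fun_prop)).aestronglyMeasurable
      (ae_of_all _ fun z => hkM _)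
  have hb1 : ∀ (κ : Measure E) [IsProbabilityMeasure κ] (y : E), |∫ w, f (y + w) ∂κ| ≤ 1 :=
    fun κ _ y => abs_le.2 ⟨by linarith [(hbd κ y).1], (hbd κ y).2⟩
  have hfun : (fun y => ∫ w, f (y + w) ∂((μ ∗ τ) ∗ (stdGaussian E).map (s • ·)))
      = fun y => ∫ z, g (y + s • z) ∂(stdGaussian E) + ∫ z, g' (y + σ • z) ∂(stdGaussian E)
          - (-(1 / 2)) := by
    ext y
    simp only [g, g']
    rw [integral_sub (hgi _ 1 (hmeas _) (hb1 _) _ _) (hgi _ 1 (hmeas _) (hb1 _) _ _),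
      integral_sub (hgi _ 1 (hmeas _) (hb1 _) _ _) (integrable_const _),
      ← integral_conv_smul_stdGaussian _ hf.measurable h.abs_le_one,
      ← integral_conv_smul_stdGaussian _ hf.measurable h.abs_le_one,
      ← integral_conv_smul_stdGaussian _ hf.measurable h.abs_le_one, heq]
    simp
  have hD := (h.hasSecondDirDeriv (μ ∗ τ) hs)
  rw [hfun] at hD
  rw [hD.unique hsum]
  have e1 := hAl x u v
  have e2 := hBl x u v
  rw [add_sub_add_comm]
  refine (abs_add_le _ _).trans ((add_le_add e1 e2).trans_eq ?_)
  ring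

end TestFunctions

/-! ### Gaussian integration by parts and the contribution of one summand. -/

section Stein

open scoped RealInnerProductSpace

variable {d : ℕ} {f : Vec d → ℝ} {G : Vec d → Vec d} {U : Set (Vec d)} {M₁ M₂ : ℝ}

lemma IsSmoothTest.continuous_inner_comp (h : IsSmoothTest f G U M₁ M₂) {α : Type*}
    [TopologicalSpace α] {a b : α → Vec d} (ha : Continuous a) (hb : Continuous b) :
    Continuous fun p => ⟪G (a p), b p⟫ :=
  (h.continuous_gradient.comp ha).inner hb

lemma integrable_mul_inner_stdGaussian {a : Vec d → ℝ} (ha : Measurable a) {C : ℝ}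
    (hC : ∀ z, |a z| ≤ C) (v : Vec d) :
    Integrable (fun z => a z * ⟪z, v⟫) (stdGaussian (Vec d)) :=
  integrable_of_linear_growth_stdGaussian (ha.mul (by fun_prop)) fun z => by
    simpa using linear_growth_of_bounded hC v 0 1 z

/-- The same derivative is computed twice: through the standard component in `ν = ν₀ ∗ stdGaussian`,
which gives `smoothD2`, and through the standard Gaussian vector that `S` maps to `ν`. -/
lemma IsSmoothTest.smoothD2_linear_image (h : IsSmoothTest f G U M₁ M₂) (ν ν₀ : Measure (Vec d))
    [IsProbabilityMeasure ν₀] (S : Vec d →L[ℝ] Vec d)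
    (hνS : ν = (stdGaussian (Vec d)).map S) (hν₀ : ν = ν₀ ∗ stdGaussian (Vec d)) {s : ℝ}
    (hs : 0 < s) (x e : Vec d) :
    smoothD2 G (ν₀.map (s • ·)) s x (S e)
      = s⁻¹ * ∫ z, ⟪G (x + s • S z), S e⟫ * ⟪z, e⟫ ∂(stdGaussian (Vec d)) := by
  have hG := h.continuous_gradient
  have hD := (h.hasSecondDirDeriv (ν₀.map (s • ·)) hs).2 x (S e)
  have hκ : (ν₀.map (s • ·)) ∗ (stdGaussian (Vec d)).map (s • ·)
      = (stdGaussian (Vec d)).map (fun z => s • S z) := by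
    have h1 := Measure.map_conv_continuousLinearMap (μ := ν₀) (ν := stdGaussian (Vec d))
      (s • ContinuousLinearMap.id ℝ (Vec d))
    rw [← hν₀, hνS, Measure.map_map (by fun_prop) (by fun_prop)] at h1
    exact h1.symm
  rw [hκ] at hD
  have h2 := hasDerivAt_integral_add_smul_stdGaussian (E := Vec d)
    (h := fun z => ⟪G (x + s • S z), S e⟫)
    (h.continuous_inner_comp (by fun_prop) (by fun_prop)).measurable (M := M₁ * ‖S e‖)
    (fun z => (abs_real_inner_le_norm _ _).trans (by
      have := mul_le_mul_of_nonneg_right (h.norm_le (x + s • S z)) (norm_nonneg (S e))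
      nlinarith [mul_nonneg (mul_nonneg h.nonneg_left (norm_nonneg (S e))) (norm_nonneg z)]))
    (s⁻¹ • e)
  have h3 : (fun r : ℝ => ∫ w, ⟪G (x + r • S e + w), S e⟫
        ∂((stdGaussian (Vec d)).map (fun z => s • S z)))
      = fun r : ℝ => ∫ z, ⟪G (x + s • S (z + r • s⁻¹ • e)), S e⟫ ∂(stdGaussian (Vec d)) := by
    ext r
    rw [integral_map (by fun_prop)
      (h.continuous_inner_comp (by fun_prop) (by fun_prop)).aestronglyMeasurable]
    congr 1
    ext z
    rw [map_add, map_smul, map_smul, smul_add, smul_comm s r, smul_smul s, mul_inv_cancel₀ hs.ne',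
      one_smul, add_assoc, add_comm (r • S e)]
  rw [h3] at hD
  rw [hD.unique h2, ← integral_const_mul]
  congr 1
  ext z
  rw [real_inner_smul_right]
  ring

lemma IsSmoothTest.integral_inner_gaussian (h : IsSmoothTest f G U M₁ M₂)
    (ν ν₀ : Measure (Vec d)) [IsProbabilityMeasure ν₀] (S : Vec d →L[ℝ] Vec d)
    (hνS : ν = (stdGaussian (Vec d)).map S) (hν₀ : ν = ν₀ ∗ stdGaussian (Vec d)) {s : ℝ}
    (hs : 0 < s) (x : Vec d) :
    ∫ g, ⟪G (x + s • g), g⟫ ∂ν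
      = s * ∑ j, smoothD2 G (ν₀.map (s • ·)) s x (S (EuclideanSpace.basisFun (Fin d) ℝ j)) := by
  simp_rw [h.smoothD2_linear_image ν ν₀ S hνS hν₀ hs]
  rw [← Finset.mul_sum, ← mul_assoc, mul_inv_cancel₀ hs.ne', one_mul, ← integral_finsetSum, hνS,
    integral_map (by fun_prop)
      (h.continuous_inner_comp (by fun_prop) (by fun_prop)).aestronglyMeasurable]
  · congr 1
    ext z
    have e1 : S z = ∑ j, ⟪z, EuclideanSpace.basisFun (Fin d) ℝ j⟫ •
        S (EuclideanSpace.basisFun (Fin d) ℝ j) := by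
      conv_lhs => rw [← (EuclideanSpace.basisFun (Fin d) ℝ).sum_repr' z]
      simp_rw [map_sum, map_smul, real_inner_comm]
    conv_lhs => rw [e1, inner_sum]
    rw [← e1]
    exact Finset.sum_congr rfl fun j _ => by rw [real_inner_smul_right, mul_comm]
  · intro j _
    exact integrable_mul_inner_stdGaussian
      (h.continuous_inner_comp (by fun_prop) (by fun_prop)).measurable
      (fun z => (abs_real_inner_le_norm _ _).trans
        (mul_le_mul_of_nonneg_right (h.norm_le _) (norm_nonneg _))) _

/-- Exhibits a quadratic form in `v`, so that averages over `v` depend on the second moments of `v`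
only. -/
lemma IsSmoothTest.smoothD2_eq_sum (h : IsSmoothTest f G U M₁ M₂) (κ : Measure (Vec d))
    [IsProbabilityMeasure κ] (s : ℝ) (x v : Vec d) :
    smoothD2 G κ s x v = ∑ k, ∑ l, v k * v l *
      (s⁻¹ * ∫ z, (∫ w, ⟪G (x + s • z + w), EuclideanSpace.basisFun (Fin d) ℝ k⟫ ∂κ) *
        ⟪z, EuclideanSpace.basisFun (Fin d) ℝ l⟫ ∂(stdGaussian (Vec d))) := by
  set b := EuclideanSpace.basisFun (Fin d) ℝ
  have hv : ∀ y : Vec d, ⟪y, v⟫ = ∑ k, v k * ⟪y, b k⟫ := by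
    intro y
    conv_lhs => rw [← b.sum_repr v, inner_sum]
    simp [b, real_inner_smul_right]
  have e1 : ∀ y, ∫ w, ⟪G (y + w), v⟫ ∂κ = ∑ k, v k * ∫ w, ⟪G (y + w), b k⟫ ∂κ := by
    intro y
    simp_rw [hv]
    rw [integral_finsetSum]
    · simp_rw [integral_const_mul]
    · exact fun k _ => (h.integrable_inner κ y (b k)).const_mul _
  rw [smoothD2]
  simp_rw [e1, hv, Finset.sum_mul_sum]
  rw [integral_finsetSum, Finset.mul_sum]
  · refine Finset.sum_congr rfl fun k _ => ?_
    rw [integral_finsetSum, Finset.mul_sum]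
    · refine Finset.sum_congr rfl fun l _ => ?_
      rw [← integral_const_mul, ← integral_const_mul, ← integral_const_mul]
      congr 1
      ext z
      ring
    · intro l _
      have := (integrable_mul_inner_stdGaussian ((h.measurable_integral_inner κ (b k)).comp
        (by fun_prop : Measurable fun z : Vec d => x + s • z))
        (fun z => h.abs_integral_inner_le κ _ _) (b l)).const_mul (v k * v l)
      refine this.congr (ae_of_all _ fun z => ?_)
      simp only [Function.comp_apply]
      ring
  · intro k _
    refine integrable_finsetSum _ fun l _ => ?_
    have := (integrable_mul_inner_stdGaussian ((h.measurable_integral_inner κ (b k)).comp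
      (by fun_prop : Measurable fun z : Vec d => x + s • z))
      (fun z => h.abs_integral_inner_le κ _ _) (b l)).const_mul (v k * v l)
    refine this.congr (ae_of_all _ fun z => ?_)
    simp only [Function.comp_apply]
    ring

/-- Here the agreement of the covariances of the sum and of the Gaussian vector enters: the Gaussian
trace term is redistributed over the summands. -/
lemma IsSmoothTest.sum_smoothD2_image_eq (h : IsSmoothTest f G U M₁ M₂) (κ : Measure (Vec d))
    [IsProbabilityMeasure κ] (s : ℝ) (x : Vec d) {ι : Type*} (t : Finset ι)
    (law : ι → Measure (Vec d)) (e : Fin d → Vec d)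
    (hint : ∀ i ∈ t, ∀ k l, Integrable (fun v : Vec d => v k * v l) (law i))
    (hcov : ∀ k l, ∑ j, e j k * e j l = ∑ i ∈ t, ∫ v, v k * v l ∂(law i)) :
    ∑ j, smoothD2 G κ s x (e j) = ∑ i ∈ t, ∫ v, smoothD2 G κ s x v ∂(law i) := by
  simp_rw [h.smoothD2_eq_sum κ s x]
  have h1 : ∀ i ∈ t, ∀ m : Fin d → Fin d → ℝ,
      ∫ v, ∑ k, ∑ l, v k * v l * m k l ∂(law i) = ∑ k, ∑ l, (∫ v, v k * v l ∂(law i)) * m k l := by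
    intro i hi m
    rw [integral_finsetSum]
    · refine Finset.sum_congr rfl fun k _ => ?_
      rw [integral_finsetSum]
      · simp_rw [integral_mul_const]
      · exact fun l _ => (hint i hi k l).mul_const _
    · exact fun k _ => integrable_finsetSum _ fun l _ => (hint i hi k l).mul_const _
  rw [Finset.sum_congr rfl fun i hi => h1 i hi _, Finset.sum_comm]
  rw [Finset.sum_comm (s := t)]
  refine Finset.sum_congr rfl fun k _ => ?_
  rw [Finset.sum_comm, Finset.sum_comm (s := t)]
  refine Finset.sum_congr rfl fun l _ => ?_
  rw [← Finset.sum_mul, ← Finset.sum_mul, hcov]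

/-- Serves integrability only; `M₁` does not enter the quantitative bounds. -/
lemma IsSmoothTest.abs_smoothD2_le (h : IsSmoothTest f G U M₁ M₂) (κ : Measure (Vec d))
    [IsProbabilityMeasure κ] {s : ℝ} (hs : 0 < s) (x v : Vec d) :
    |smoothD2 G κ s x v| ≤ s⁻¹ * M₁ * √(2 / Real.pi) * ‖v‖ ^ 2 := by
  rw [smoothD2, abs_mul, abs_of_pos (inv_pos.2 hs)]
  calc _ ≤ s⁻¹ * (M₁ * ‖v‖ * ∫ z, |⟪z, v⟫| ∂(stdGaussian (Vec d))) := by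
        gcongr
        exact abs_integral_mul_le (fun z => h.abs_integral_inner_le κ _ _)
          (integrable_abs_inner_stdGaussian v)
    _ = _ := by
      rw [integral_abs_inner_stdGaussian]
      ring

lemma IsSmoothTest.measurable_smoothD2 (h : IsSmoothTest f G U M₁ M₂) (κ : Measure (Vec d))
    [IsProbabilityMeasure κ] (s : ℝ) :
    Measurable fun p : Vec d × Vec d => smoothD2 G κ s p.1 p.2 := by
  have h1 : StronglyMeasurable fun q : ((Vec d × Vec d) × Vec d) × Vec d =>
      ⟪G (q.1.1.1 + s • q.1.2 + q.2), q.1.1.2⟫ :=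
    (h.continuous_inner_comp (by fun_prop) (by fun_prop)).stronglyMeasurable
  have h2 : StronglyMeasurable fun q : (Vec d × Vec d) × Vec d =>
      (∫ w, ⟪G (q.1.1 + s • q.2 + w), q.1.2⟫ ∂κ) * ⟪q.2, q.1.2⟫ :=
    h1.integral_prod_right'.mul (Continuous.stronglyMeasurable (by fun_prop))
  exact (h2.integral_prod_right'.measurable).const_mul _

lemma IsSmoothTest.abs_taylor_le (h : IsSmoothTest f G U M₁ M₂) (κ : Measure (Vec d))
    [IsProbabilityMeasure κ] {s B c : ℝ} (hs : 0 < s) (hc : 0 ≤ c)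
    (hB : ∀ x u v, |smoothD2 G κ s (x + u) v - smoothD2 G κ s x v| ≤ B * ‖u‖ * ‖v‖ ^ 2)
    (x : Vec d) :
    |∫ w, ⟪G (c • x + w), x⟫ ∂(κ ∗ (stdGaussian (Vec d)).map (s • ·))
      - ∫ w, ⟪G (0 + w), x⟫ ∂(κ ∗ (stdGaussian (Vec d)).map (s • ·))
      - c * smoothD2 G κ s 0 x| ≤ B * c ^ 2 / 2 * ‖x‖ ^ 3 := by
  have hD := (h.hasSecondDirDeriv κ hs).2
  set D₁ : Vec d → Vec d → ℝ :=
    fun x v => ∫ w, ⟪G (x + w), v⟫ ∂(κ ∗ (stdGaussian (Vec d)).map (s • ·))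
  have hline : ∀ t : ℝ, HasDerivAt (fun r : ℝ => D₁ (0 + r • x) x)
      (smoothD2 G κ s (0 + t • x) x) t := by
    intro t
    have h1 : HasDerivAt (fun r : ℝ => D₁ (0 + t • x + r • x) x)
        (smoothD2 G κ s (0 + t • x) x) (t - t) := by
      rw [sub_self]
      exact hD _ x
    refine (h1.comp_sub_const t t).congr_of_eventuallyEq (Eventually.of_forall fun r => ?_)
    simp only
    rw [add_assoc, ← add_smul]
    congr 3
    ring
  have hφ : ∀ t : ℝ, HasDerivAt
      (fun r : ℝ => D₁ (0 + r • x) x - D₁ 0 x - r * smoothD2 G κ s 0 x)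
      (smoothD2 G κ s (0 + t • x) x - smoothD2 G κ s 0 x) t := by
    intro t
    refine (((hline t).sub_const _).sub ((hasDerivAt_id t).mul_const _)).congr_deriv ?_
    ring
  have hBd : ∀ t : ℝ, HasDerivAt (fun r : ℝ => B * ‖x‖ ^ 3 / 2 * r ^ 2) (B * ‖x‖ ^ 3 * t) t := by
    intro t
    refine ((hasDerivAt_pow 2 t).const_mul (B * ‖x‖ ^ 3 / 2)).congr_deriv ?_
    simp
    ring
  have key := image_norm_le_of_norm_deriv_right_le_deriv_boundary (a := 0) (b := c)
    (f := fun r : ℝ => D₁ (0 + r • x) x - D₁ 0 x - r * smoothD2 G κ s 0 x)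
    (fun t _ => (hφ t).continuousAt.continuousWithinAt)
    (fun t _ => (hφ t).hasDerivWithinAt) (B := fun r => B * ‖x‖ ^ 3 / 2 * r ^ 2)
    (B' := fun t => B * ‖x‖ ^ 3 * t) (by simp) hBd (fun t ht => by
      refine (hB 0 (t • x) x).trans_eq ?_
      rw [norm_smul, Real.norm_eq_abs, abs_of_nonneg ht.1]
      ring) (Set.right_mem_Icc.2 hc)
  rw [Real.norm_eq_abs, zero_add] at key
  refine key.trans_eq ?_
  ring

/-- Integrate (‖x‖ + ‖y‖)(‖x‖ − ‖y‖)² ≥ 0 over two independent copies. -/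
lemma integral_norm_mul_integral_norm_sq_le (law : Measure (Vec d)) [IsProbabilityMeasure law]
    (h3 : Integrable (fun x : Vec d => ‖x‖ ^ 3) law) :
    (∫ x, ‖x‖ ∂law) * ∫ x, ‖x‖ ^ 2 ∂law ≤ ∫ x, ‖x‖ ^ 3 ∂law := by
  have h1 : Integrable (fun x : Vec d => ‖x‖) law :=
    (h3.add (integrable_const (1 : ℝ))).mono' (by fun_prop) (ae_of_all _ fun x => by
      simp only [norm_norm, Pi.add_apply]
      nlinarith [norm_nonneg x, sq_nonneg (‖x‖ - 1)])
  have h2 : Integrable (fun x : Vec d => ‖x‖ ^ 2) law :=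
    (h3.add (integrable_const (1 : ℝ))).mono' (by fun_prop) (ae_of_all _ fun x => by
      simp only [norm_pow, norm_norm, Pi.add_apply]
      nlinarith [norm_nonneg x, sq_nonneg (‖x‖ - 1)])
  have key : ∀ x : Vec d, (∫ y, ‖y‖ ∂law) * ‖x‖ ^ 2 + (∫ y, ‖y‖ ^ 2 ∂law) * ‖x‖
      ≤ ‖x‖ ^ 3 + ∫ y, ‖y‖ ^ 3 ∂law := by
    intro x
    have e : ∫ y : Vec d, (‖y‖ * ‖x‖ ^ 2 + ‖y‖ ^ 2 * ‖x‖) ∂law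
        ≤ ∫ y : Vec d, (‖x‖ ^ 3 + ‖y‖ ^ 3) ∂law := by
      refine integral_mono ((h1.mul_const _).add (h2.mul_const _))
        ((integrable_const _).add h3) fun y => ?_
      simp only
      nlinarith [mul_nonneg (add_nonneg (norm_nonneg x) (norm_nonneg y)) (sq_nonneg (‖x‖ - ‖y‖))]
    rw [integral_add (h1.mul_const _) (h2.mul_const _), integral_add (integrable_const _) h3,
      integral_mul_const, integral_mul_const] at e
    simpa using e
  have e := integral_mono ((h2.const_mul (∫ y, ‖y‖ ∂law)).add
    (h1.const_mul (∫ y, ‖y‖ ^ 2 ∂law))) (h3.add (integrable_const _)) key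
  simp only [Pi.add_apply] at e
  rw [integral_add (h2.const_mul _) (h1.const_mul _), integral_add h3 (integrable_const _),
    integral_const_mul, integral_const_mul, integral_const] at e
  simp only [probReal_univ, one_smul] at e
  linarith

/-- The contribution of one summand with distribution `law` to the derivative of the
interpolation. -/
lemma IsSmoothTest.abs_summand_le (h : IsSmoothTest f G U M₁ M₂) (κ law : Measure (Vec d))
    [IsProbabilityMeasure κ] [IsProbabilityMeasure law]
    (h3 : Integrable (fun x : Vec d => ‖x‖ ^ 3) law) (hmean : ∫ x, x ∂law = 0)
    {s B c : ℝ} (hs : 0 < s) (hc : 0 ≤ c) (hB0 : 0 ≤ B)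
    (hB : ∀ x u v, |smoothD2 G κ s (x + u) v - smoothD2 G κ s x v| ≤ B * ‖u‖ * ‖v‖ ^ 2) :
    |-(s * ∫ x, ∫ w, ⟪G (c • x + w), x⟫ ∂(κ ∗ (stdGaussian (Vec d)).map (s • ·)) ∂law)
      + c * s * ∫ x, ∫ v, smoothD2 G κ s (c • x) v ∂law ∂law|
      ≤ 3 / 2 * (s * c ^ 2) * B * ∫ x, ‖x‖ ^ 3 ∂law := by
  have h1 : Integrable (fun x : Vec d => ‖x‖) law :=
    (h3.add (integrable_const (1 : ℝ))).mono' (by fun_prop) (ae_of_all _ fun x => by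
      simp only [norm_norm, Pi.add_apply]
      nlinarith [norm_nonneg x, sq_nonneg (‖x‖ - 1)])
  have h2 : Integrable (fun x : Vec d => ‖x‖ ^ 2) law :=
    (h3.add (integrable_const (1 : ℝ))).mono' (by fun_prop) (ae_of_all _ fun x => by
      simp only [norm_pow, norm_norm, Pi.add_apply]
      nlinarith [norm_nonneg x, sq_nonneg (‖x‖ - 1)])
  have hid : Integrable (fun x : Vec d => x) law := (integrable_norm_iff (by fun_prop)).1 h1
  set κ' := κ ∗ (stdGaussian (Vec d)).map (s • ·)
  set L := s⁻¹ * M₁ * √(2 / Real.pi)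
  have hD2m := h.measurable_smoothD2 κ s
  have hDv : ∀ y, Integrable (fun v => smoothD2 G κ s y v) law := fun y =>
    (h2.const_mul L).mono' (hD2m.comp measurable_prodMk_left).aestronglyMeasurable
      (ae_of_all _ fun v => h.abs_smoothD2_le κ hs y v)
  have hD1m : ∀ a : ℝ, Measurable fun x : Vec d => ∫ w, ⟪G (a • x + w), x⟫ ∂κ' := fun a => by
    have : StronglyMeasurable fun p : Vec d × Vec d => ⟪G (a • p.1 + p.2), p.1⟫ :=
      (h.continuous_inner_comp (by fun_prop) (by fun_prop)).stronglyMeasurable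
    exact this.integral_prod_right'.measurable
  have hD1 : ∀ a : ℝ, Integrable (fun x : Vec d => ∫ w, ⟪G (a • x + w), x⟫ ∂κ') law := fun a =>
    (h1.const_mul M₁).mono' (hD1m a).aestronglyMeasurable
      (ae_of_all _ fun x => h.abs_integral_inner_le κ' _ _)
  have hD10 := hD1 0
  simp only [zero_smul] at hD10
  -- The zeroth-order Taylor term is linear in `x` and vanishes because the summand is centred.
  have hzero : ∫ x, ∫ w, ⟪G (0 + w), x⟫ ∂κ' ∂law = 0 := by
    have hGi : Integrable (fun w => G (0 + w)) κ' :=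
      (integrable_const M₁).mono'
        (h.continuous_gradient.comp (by fun_prop)).aestronglyMeasurable
        (ae_of_all _ fun w => h.norm_le _)
    have e1 : ∀ x : Vec d, ∫ w, ⟪G (0 + w), x⟫ ∂κ' = ⟪∫ w, G (0 + w) ∂κ', x⟫ := fun x => by
      rw [real_inner_comm, ← integral_inner hGi x]
      exact integral_congr_ae (ae_of_all _ fun w => real_inner_comm _ _)
    simp_rw [e1]
    rw [integral_inner hid, hmean, inner_zero_right]
  have hDD : Integrable (fun x => ∫ v, smoothD2 G κ s (c • x) v ∂law) law := by
    have hm : StronglyMeasurable fun p : Vec d × Vec d => smoothD2 G κ s (c • p.1) p.2 :=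
      (hD2m.comp (by fun_prop : Measurable fun p : Vec d × Vec d =>
        (c • p.1, p.2))).stronglyMeasurable
    refine (integrable_const (∫ v, L * ‖v‖ ^ 2 ∂law)).mono'
      hm.integral_prod_right'.aestronglyMeasurable (ae_of_all _ fun x => ?_)
    exact norm_integral_le_of_norm_le (f := fun v => smoothD2 G κ s (c • x) v) (h2.const_mul L)
      (ae_of_all _ fun v => h.abs_smoothD2_le κ hs _ v)
  have hA : |∫ x, (∫ w, ⟪G (c • x + w), x⟫ ∂κ' - ∫ w, ⟪G (0 + w), x⟫ ∂κ'
      - c * smoothD2 G κ s 0 x) ∂law| ≤ B * c ^ 2 / 2 * ∫ x, ‖x‖ ^ 3 ∂law := by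
    rw [← integral_const_mul]
    exact norm_integral_le_of_norm_le (f := fun x => ∫ w, ⟪G (c • x + w), x⟫ ∂κ'
      - ∫ w, ⟪G (0 + w), x⟫ ∂κ' - c * smoothD2 G κ s 0 x) (h3.const_mul _)
      (ae_of_all _ fun x => h.abs_taylor_le κ hs hc hB x)
  have hA2 : ∫ x, (∫ w, ⟪G (c • x + w), x⟫ ∂κ' - ∫ w, ⟪G (0 + w), x⟫ ∂κ'
      - c * smoothD2 G κ s 0 x) ∂law
      = ∫ x, ∫ w, ⟪G (c • x + w), x⟫ ∂κ' ∂law - c * ∫ v, smoothD2 G κ s 0 v ∂law := by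
    have e := integral_sub ((hD1 c).sub hD10) ((hDv 0).const_mul c)
    simp only [Pi.sub_apply] at e
    rw [e, integral_sub (hD1 c) hD10, hzero, integral_const_mul, sub_zero]
  have hC : |∫ x, (∫ v, smoothD2 G κ s (c • x) v ∂law - ∫ v, smoothD2 G κ s 0 v ∂law) ∂law|
      ≤ B * c * ∫ x, ‖x‖ ^ 3 ∂law := by
    have e1 : ∀ x, |∫ v, smoothD2 G κ s (c • x) v ∂law - ∫ v, smoothD2 G κ s 0 v ∂law|
        ≤ B * c * ‖x‖ * ∫ v, ‖v‖ ^ 2 ∂law := fun x => by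
      rw [← integral_sub (hDv _) (hDv _), ← integral_const_mul]
      refine norm_integral_le_of_norm_le
        (f := fun v => smoothD2 G κ s (c • x) v - smoothD2 G κ s 0 v) (h2.const_mul _)
        (ae_of_all _ fun v => ?_)
      have := hB 0 (c • x) v
      rw [zero_add, norm_smul, Real.norm_eq_abs, abs_of_nonneg hc, ← mul_assoc] at this
      exact this
    refine (norm_integral_le_of_norm_le (f := fun x => ∫ v, smoothD2 G κ s (c • x) v ∂law
      - ∫ v, smoothD2 G κ s 0 v ∂law) ((h1.const_mul (B * c)).mul_const _)
      (ae_of_all _ e1)).trans ?_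
    rw [integral_mul_const, integral_const_mul, mul_assoc]
    gcongr
    exact integral_norm_mul_integral_norm_sq_le law h3
  have hC2 : ∫ x, (∫ v, smoothD2 G κ s (c • x) v ∂law - ∫ v, smoothD2 G κ s 0 v ∂law) ∂law
      = ∫ x, ∫ v, smoothD2 G κ s (c • x) v ∂law ∂law - ∫ v, smoothD2 G κ s 0 v ∂law := by
    rw [integral_sub hDD (integrable_const _)]
    simp
  rw [hA2] at hA
  rw [hC2] at hC
  set p := ∫ x, ∫ w, ⟪G (c • x + w), x⟫ ∂κ' ∂law
  set q := ∫ x, ∫ v, smoothD2 G κ s (c • x) v ∂law ∂law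
  set r := ∫ v, smoothD2 G κ s 0 v ∂law
  set τ := ∫ x, ‖x‖ ^ 3 ∂law
  -- Both terms are compared with the second derivative `r` at the origin. The Taylor remainder
  -- contributes 1/2 and the displacement of the second derivative contributes 1, in total 3/2.
  calc |-(s * p) + c * s * q| = |-(s * (p - c * r)) + c * s * (q - r)| := by ring_nf
    _ ≤ |-(s * (p - c * r))| + |c * s * (q - r)| := abs_add_le _ _
    _ = s * |p - c * r| + c * s * |q - r| := by
      rw [abs_neg, abs_mul, abs_mul, abs_of_pos hs, abs_of_nonneg (by positivity : 0 ≤ c * s)]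
    _ ≤ s * (B * c ^ 2 / 2 * τ) + c * s * (B * c * τ) := by gcongr
    _ = _ := by ring

end Stein

/-! ### The derivative of the trigonometric interpolation. -/

section Interpolation

open scoped RealInnerProductSpace

variable {d : ℕ} {f : Vec d → ℝ} {G : Vec d → Vec d} {U : Set (Vec d)} {M₁ M₂ : ℝ}

lemma IsSmoothTest.smoothD2_conv (h : IsSmoothTest f G U M₁ M₂) (μ τ : Measure (Vec d))
    [IsProbabilityMeasure μ] [IsProbabilityMeasure τ] (s : ℝ) (y v : Vec d) :
    smoothD2 G (μ ∗ τ) s y v = ∫ w, smoothD2 G τ s (y + w) v ∂μ := by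
  have e1 : ∀ x, ∫ w, ⟪G (x + w), v⟫ ∂(μ ∗ τ) = ∫ a, ∫ b, ⟪G (x + (a + b)), v⟫ ∂τ ∂μ := fun x =>
    integral_conv (h.integrable_inner _ x v)
  have hm : StronglyMeasurable fun p : (Vec d × Vec d) × Vec d =>
      ⟪G (y + p.1.2 + s • p.1.1 + p.2), v⟫ :=
    (h.continuous_inner_comp (by fun_prop) (by fun_prop)).stronglyMeasurable
  have hm2 : StronglyMeasurable fun p : Vec d × Vec d =>
      (∫ b, ⟪G (y + p.2 + s • p.1 + b), v⟫ ∂τ) * ⟪p.1, v⟫ :=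
    hm.integral_prod_right'.mul (Continuous.stronglyMeasurable (by fun_prop))
  have hint : Integrable (fun p : Vec d × Vec d =>
      (∫ b, ⟪G (y + p.2 + s • p.1 + b), v⟫ ∂τ) * ⟪p.1, v⟫) ((stdGaussian (Vec d)).prod μ) := by
    have hdom : Integrable (fun p : Vec d × Vec d => M₁ * ‖v‖ * |⟪p.1, v⟫| * 1)
        ((stdGaussian (Vec d)).prod μ) :=
      ((integrable_abs_inner_stdGaussian v).const_mul (M₁ * ‖v‖)).mul_prod
        (integrable_const (1 : ℝ))
    refine hdom.mono' hm2.aestronglyMeasurable (ae_of_all _ fun p => ?_)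
    rw [Real.norm_eq_abs, abs_mul, mul_one]
    gcongr
    exact h.abs_integral_inner_le τ _ v
  simp only [smoothD2]
  simp_rw [e1]
  rw [integral_const_mul]
  congr 1
  rw [← integral_integral_swap hint]
  congr 1
  ext z
  rw [← integral_mul_const]
  congr 1
  ext w
  congr 2
  ext b
  rw [show y + s • z + (w + b) = y + w + s • z + b by abel]

/-- Interpolation between a random vector and an independent Gaussian vector. -/
noncomputable def interp {Ω : Type*} [MeasurableSpace Ω] (P : Measure Ω) (ν : Measure (Vec d))
    (f : Vec d → ℝ) (W : Ω → Vec d) (α : ℝ) : ℝ :=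
  ∫ p, f (Real.cos α • W p.1 + Real.sin α • p.2) ∂(P.prod ν)

variable {Ω I : Type*} [MeasurableSpace Ω] {P : Measure Ω} [IsProbabilityMeasure P]

lemma IsSmoothTest.hasDerivAt_interp (h : IsSmoothTest f G U M₁ M₂) (ν : Measure (Vec d))
    [IsProbabilityMeasure ν] (hν : Integrable (fun g : Vec d => g) ν) {W : Ω → Vec d}
    (hW : Measurable W) (hWi : Integrable W P) (α : ℝ) :
    HasDerivAt (interp P ν f W)
      (∫ p, ⟪G (Real.cos α • W p.1 + Real.sin α • p.2),
        -(Real.sin α • W p.1) + Real.cos α • p.2⟫ ∂(P.prod ν)) α := by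
  have hf := h.continuous
  have hG := h.continuous_gradient
  have hc : ∀ a : ℝ, Measurable fun p : Ω × Vec d => Real.cos a • W p.1 + Real.sin a • p.2 :=
    fun a => by fun_prop
  have hc' : ∀ a : ℝ, Measurable fun p : Ω × Vec d => -(Real.sin a • W p.1) + Real.cos a • p.2 :=
    fun a => by fun_prop
  have hderiv : ∀ (p : Ω × Vec d) (a : ℝ), HasDerivAt
      (fun a => f (Real.cos a • W p.1 + Real.sin a • p.2))
      ⟪G (Real.cos a • W p.1 + Real.sin a • p.2), -(Real.sin a • W p.1) + Real.cos a • p.2⟫ a := by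
    intro p a
    have h1 : HasDerivAt (fun a : ℝ => Real.cos a • W p.1 + Real.sin a • p.2)
        (-(Real.sin a • W p.1) + Real.cos a • p.2) a := by
      rw [← neg_smul]
      exact ((Real.hasDerivAt_cos a).smul_const _).add ((Real.hasDerivAt_sin a).smul_const _)
    have h2 := (h.hasGradientAt (Real.cos a • W p.1 + Real.sin a • p.2)).hasFDerivAt
    exact (h2.comp_hasDerivAt a h1).congr_deriv (by simp)
  have hbound : ∀ (p : Ω × Vec d) (a : ℝ), ‖⟪G (Real.cos a • W p.1 + Real.sin a • p.2),
      -(Real.sin a • W p.1) + Real.cos a • p.2⟫‖ ≤ M₁ * (‖W p.1‖ + ‖p.2‖) := by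
    intro p a
    refine (abs_real_inner_le_norm _ _).trans ?_
    refine mul_le_mul (h.norm_le _) ?_ (norm_nonneg _) h.nonneg_left
    refine (norm_add_le _ _).trans ?_
    rw [norm_neg, norm_smul, norm_smul, Real.norm_eq_abs, Real.norm_eq_abs]
    have h1 := Real.abs_sin_le_one a
    have h2 := Real.abs_cos_le_one a
    nlinarith [norm_nonneg (W p.1), norm_nonneg p.2]
  have key := (hasDerivAt_integral_of_dominated_loc_of_deriv_le (μ := P.prod ν) (x₀ := α)
    (F := fun a p => f (Real.cos a • W p.1 + Real.sin a • p.2))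
    (F' := fun a p => ⟪G (Real.cos a • W p.1 + Real.sin a • p.2),
      -(Real.sin a • W p.1) + Real.cos a • p.2⟫)
    (s := Set.univ) (bound := fun p => M₁ * (‖W p.1‖ + ‖p.2‖)) univ_mem
    (Eventually.of_forall fun a => (hf.measurable.comp (hc a)).aestronglyMeasurable)
    ((integrable_const (1 : ℝ)).mono' (hf.measurable.comp (hc α)).aestronglyMeasurable
      (ae_of_all _ fun p => h.abs_le_one _))
    ((hG.measurable.comp (hc α)).inner (hc' α)).aestronglyMeasurable
    (ae_of_all _ fun p a _ => hbound p a)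
    (((hWi.norm.comp_fst ν).add (hν.norm.comp_snd P)).const_mul _)
    (ae_of_all _ fun p a _ => hderiv p a)).2
  exact key

lemma integral_indep_pair {X Y : Ω → Vec d} (hX : Measurable X) (hY : Measurable Y)
    (hXY : IndepFun X Y P) {F : Vec d × Vec d → ℝ} (hF : Measurable F)
    (hint : Integrable (fun ω => F (X ω, Y ω)) P) :
    ∫ ω, F (X ω, Y ω) ∂P = ∫ x, ∫ y, F (x, y) ∂(P.map Y) ∂(P.map X) := by
  have h1 := (indepFun_iff_map_prod_eq_prod_map_map hX.aemeasurable hY.aemeasurable).1 hXY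
  have hm : AEMeasurable (fun ω => (X ω, Y ω)) P := (hX.prodMk hY).aemeasurable
  have : IsProbabilityMeasure (P.map X) := Measure.isProbabilityMeasure_map hX.aemeasurable
  have : IsProbabilityMeasure (P.map Y) := Measure.isProbabilityMeasure_map hY.aemeasurable
  rw [← integral_map (f := F) hm hF.aestronglyMeasurable, h1, integral_prod]
  rw [← h1]
  exact (integrable_map_measure hF.aestronglyMeasurable hm).2 hint

/-- The distribution of the sum without the summand `i`, scaled by `c`, convolved with the
scaled auxiliary measure `ν₀`. -/
noncomputable def leaveOneOut [DecidableEq I] (P : Measure Ω) (X : I → Ω → Vec d) (t : Finset I)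
    (ν₀ : Measure (Vec d)) (c s : ℝ) (i : I) : Measure (Vec d) :=
  ((P.map fun ω => ∑ j ∈ t.erase i, X j ω).map (c • ·)) ∗ (ν₀.map (s • ·))

instance [DecidableEq I] (X : I → Ω → Vec d) (t : Finset I)
    (ν₀ : Measure (Vec d)) [IsProbabilityMeasure ν₀] (c s : ℝ) (i : I)
    [IsProbabilityMeasure (P.map fun ω => ∑ j ∈ t.erase i, X j ω)] :
    IsProbabilityMeasure (leaveOneOut P X t ν₀ c s i) := by
  unfold leaveOneOut
  infer_instance

lemma integrable_norm_of_integrable_norm_cube {law : Measure Ω} [IsProbabilityMeasure law]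
    {Y : Ω → Vec d} (hY : Measurable Y) (h3 : Integrable (fun ω => ‖Y ω‖ ^ 3) law) :
    Integrable (fun ω => ‖Y ω‖) law ∧ Integrable (fun ω => ‖Y ω‖ ^ 2) law := by
  constructor
  all_goals
    refine (h3.add (integrable_const (1 : ℝ))).mono' (by fun_prop) (ae_of_all _ fun x => ?_)
    simp only [norm_norm, norm_pow, Pi.add_apply]
    nlinarith [norm_nonneg (Y x), sq_nonneg (‖Y x‖ - 1)]

lemma IsSmoothTest.integral_inner_split (h : IsSmoothTest f G U M₁ M₂)
    (ν : Measure (Vec d)) [IsProbabilityMeasure ν] (hν : Integrable (fun g : Vec d => g) ν)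
    {W : Ω → Vec d} (hW : Measurable W) (hWi : Integrable W P) (s c : ℝ) :
    ∫ p, ⟪G (c • W p.1 + s • p.2), -(s • W p.1) + c • p.2⟫ ∂(P.prod ν)
      = -(s * ∫ ω, ∫ g, ⟪G (c • W ω + s • g), W ω⟫ ∂ν ∂P)
        + c * ∫ ω, ∫ g, ⟪G (c • W ω + s • g), g⟫ ∂ν ∂P := by
  have hG := h.continuous_gradient
  have hpm : Measurable fun p : Ω × Vec d => c • W p.1 + s • p.2 :=
    by fun_prop
  have hI1 : Integrable (fun p : Ω × Vec d => ⟪G (c • W p.1 + s • p.2), W p.1⟫) (P.prod ν) := by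
    refine ((hWi.norm.comp_fst ν).const_mul M₁).mono'
      ((hG.measurable.comp hpm).inner (hW.comp measurable_fst)).aestronglyMeasurable
      (ae_of_all _ fun p => (abs_real_inner_le_norm _ _).trans ?_)
    exact mul_le_mul_of_nonneg_right (h.norm_le _) (norm_nonneg _)
  have hI2 : Integrable (fun p : Ω × Vec d => ⟪G (c • W p.1 + s • p.2), p.2⟫) (P.prod ν) := by
    refine ((hν.norm.comp_snd P).const_mul M₁).mono'
      ((hG.measurable.comp hpm).inner measurable_snd).aestronglyMeasurable
      (ae_of_all _ fun p => (abs_real_inner_le_norm _ _).trans ?_)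
    exact mul_le_mul_of_nonneg_right (h.norm_le _) (norm_nonneg _)
  have e := integral_add (hI1.const_mul (-s)) (hI2.const_mul c)
  rw [integral_const_mul, integral_const_mul, integral_prod _ hI1, integral_prod _ hI2,
    neg_mul] at e
  rw [← e]
  congr 1
  ext p
  rw [inner_add_right, inner_neg_right, real_inner_smul_right, real_inner_smul_right]
  ring

lemma integrable_of_integrable_norm_cube {Y : Ω → Vec d} (hY : Measurable Y)
    (h3 : Integrable (fun ω => ‖Y ω‖ ^ 3) P) : Integrable Y P :=
  (integrable_norm_iff hY.aestronglyMeasurable).1 (integrable_norm_of_integrable_norm_cube hY h3).1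

lemma iIndepFun.indepFun_sum_erase [DecidableEq I] {X : I → Ω → Vec d}
    (hX : ∀ i, Measurable (X i)) (hindep : iIndepFun X P) (t : Finset I) (i : I) :
    IndepFun (X i) (fun ω => ∑ j ∈ t.erase i, X j ω) P := by
  have := (hindep.indepFun_finsetSum_of_notMem hX (Finset.notMem_erase i t)).symm
  rwa [show (fun ω => ∑ j ∈ t.erase i, X j ω) = ∑ j ∈ t.erase i, X j by
    ext ω
    simp]

lemma integrable_coord_mul {Y : Ω → Vec d} (hY : Measurable Y)
    (h2 : Integrable (fun ω => ‖Y ω‖ ^ 2) P) (k l : Fin d) :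
    Integrable (fun ω => Y ω k * Y ω l) P := by
  refine h2.mono' ((by fun_prop : Measurable fun v : Vec d => v k * v l).comp
    hY).aestronglyMeasurable (ae_of_all _ fun ω => ?_)
  simp only [Real.norm_eq_abs, abs_mul, sq]
  exact mul_le_mul (PiLp.norm_apply_le (Y ω) k) (PiLp.norm_apply_le (Y ω) l)
    (abs_nonneg _) (norm_nonneg _)

/-- Each `X i` is independent of the remaining sum. That sum and the component `ν₀` of `ν` are
absorbed into `leaveOneOut`, which leaves a standard Gaussian of scale `s` for smoothing. -/
lemma IsSmoothTest.integral_inner_sum (h : IsSmoothTest f G U M₁ M₂) [DecidableEq I]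
    {X : I → Ω → Vec d} (hX : ∀ i, Measurable (X i)) (hindep : iIndepFun X P) (t : Finset I)
    (h3 : ∀ i ∈ t, Integrable (fun ω => ‖X i ω‖ ^ 3) P)
    (ν ν₀ : Measure (Vec d)) [IsProbabilityMeasure ν] [IsProbabilityMeasure ν₀]
    (hν₀ : ν = ν₀ ∗ stdGaussian (Vec d)) (s c : ℝ) :
    ∫ ω, ∫ g, ⟪G (c • (∑ i ∈ t, X i ω) + s • g), ∑ i ∈ t, X i ω⟫ ∂ν ∂P
      = ∑ i ∈ t, ∫ x, ∫ w, ⟪G (c • x + w), x⟫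
          ∂(leaveOneOut P X t ν₀ c s i ∗ (stdGaussian (Vec d)).map (s • ·)) ∂(P.map (X i)) := by
  have hG := h.continuous_gradient
  set W : Ω → Vec d := fun ω => ∑ i ∈ t, X i ω
  have hW : Measurable W := Finset.measurable_sum _ fun i _ => hX i
  have hR : ∀ i, Measurable fun ω => ∑ j ∈ t.erase i, X j ω := fun i =>
    Finset.measurable_sum _ fun i _ => hX i
  have hRp : ∀ i, IsProbabilityMeasure (P.map fun ω => ∑ j ∈ t.erase i, X j ω) := fun i =>
    Measure.isProbabilityMeasure_map (hR i).aemeasurable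
  have hWsplit : ∀ i ∈ t, ∀ ω, X i ω + ∑ j ∈ t.erase i, X j ω = W ω := fun i hi ω =>
    Finset.add_sum_erase t (fun j => X j ω) hi
  have hconvs : (ν₀.map (s • ·)) ∗ (stdGaussian (Vec d)).map (s • ·) = ν.map (s • ·) := by
    have h1 := Measure.map_conv_continuousLinearMap (μ := ν₀) (ν := stdGaussian (Vec d))
      (s • ContinuousLinearMap.id ℝ (Vec d))
    rw [← hν₀] at h1
    exact h1.symm
  have hbd : ∀ y v, |∫ g, ⟪G (y + s • g), v⟫ ∂ν| ≤ M₁ * ‖v‖ := fun y v => by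
    have := h.abs_integral_inner_le (ν.map (s • ·)) y v
    rwa [integral_map (by fun_prop)
      (h.continuous_inner_comp (by fun_prop) (by fun_prop)).aestronglyMeasurable] at this
  have hm : Measurable fun p : Vec d × Vec d => ∫ g, ⟪G (p.1 + s • g), p.2⟫ ∂ν := by
    have : StronglyMeasurable fun p : (Vec d × Vec d) × Vec d =>
        ⟪G (p.1.1 + s • p.2), p.1.2⟫ :=
      (h.continuous_inner_comp (by fun_prop) (by fun_prop)).stronglyMeasurable
    exact this.integral_prod_right'.measurable
  have hgi : ∀ y v, Integrable (fun g => ⟪G (y + s • g), v⟫) ν := fun y v => by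
    have hc : Continuous fun g : Vec d => ⟪G (y + s • g), v⟫ :=
      h.continuous_inner_comp (by fun_prop) (by fun_prop)
    exact (integrable_const (M₁ * ‖v‖)).mono' hc.aestronglyMeasurable
      (ae_of_all _ fun g => (abs_real_inner_le_norm _ _).trans
        (mul_le_mul_of_nonneg_right (h.norm_le _) (norm_nonneg _)))
  have e1 : ∀ ω, ∫ g, ⟪G (c • W ω + s • g), W ω⟫ ∂ν
      = ∑ i ∈ t, ∫ g, ⟪G (c • W ω + s • g), X i ω⟫ ∂ν := fun ω => by
    rw [← integral_finsetSum]
    · congr 1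
      ext g
      rw [← inner_sum]
    · exact fun i _ => hgi _ _
  have hint : ∀ i ∈ t, Integrable (fun ω => ∫ g, ⟪G (c • W ω + s • g), X i ω⟫ ∂ν) P := by
    intro i hi
    exact ((integrable_of_integrable_norm_cube (hX i) (h3 i hi)).norm.const_mul M₁).mono'
      (hm.comp ((hW.const_smul c).prodMk (hX i))).aestronglyMeasurable
      (ae_of_all _ fun ω => hbd _ _)
  change ∫ ω, ∫ g, ⟪G (c • W ω + s • g), W ω⟫ ∂ν ∂P = _
  rw [integral_congr_ae (ae_of_all _ e1), integral_finsetSum _ hint]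
  apply Finset.sum_congr rfl
  intro i hi
  have hFm : Measurable fun p : Vec d × Vec d => ∫ g, ⟪G (c • (p.1 + p.2) + s • g), p.1⟫ ∂ν := by
    have : StronglyMeasurable fun p : (Vec d × Vec d) × Vec d =>
        ⟪G (c • (p.1.1 + p.1.2) + s • p.2), p.1.1⟫ :=
      (h.continuous_inner_comp (by fun_prop) (by fun_prop)).stronglyMeasurable
    exact this.integral_prod_right'.measurable
  have hcongr : ∀ ω, ∫ g, ⟪G (c • (X i ω + ∑ j ∈ t.erase i, X j ω) + s • g), X i ω⟫ ∂ν
      = ∫ g, ⟪G (c • W ω + s • g), X i ω⟫ ∂ν := fun ω => by rw [hWsplit i hi]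
  have hint' : Integrable (fun ω =>
      ∫ g, ⟪G (c • (X i ω + ∑ j ∈ t.erase i, X j ω) + s • g), X i ω⟫ ∂ν) P := by
    simp_rw [hcongr]
    exact hint i hi
  have e2 := integral_indep_pair (hX i) (hR i) (iIndepFun.indepFun_sum_erase hX hindep t i)
    (F := fun p => ∫ g, ⟪G (c • (p.1 + p.2) + s • g), p.1⟫ ∂ν) hFm hint'
  have e4 : ∀ x, ∫ w, ⟪G (c • x + w), x⟫
      ∂(leaveOneOut P X t ν₀ c s i ∗ (stdGaussian (Vec d)).map (s • ·))
      = ∫ w, ∫ g, ⟪G (c • (x + w) + s • g), x⟫ ∂ν ∂(P.map fun ω => ∑ j ∈ t.erase i, X j ω) := by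
    intro x
    rw [leaveOneOut, Measure.conv_assoc, hconvs, integral_conv (h.integrable_inner _ _ _),
      integral_map (by fun_prop)]
    · congr 1
      ext w
      rw [integral_map (by fun_prop)
        (h.continuous_inner_comp (by fun_prop) (by fun_prop)).aestronglyMeasurable]
      simp_rw [smul_add, add_assoc]
    · have : StronglyMeasurable fun p : Vec d × Vec d => ⟪G (c • x + (p.1 + p.2)), x⟫ :=
        (h.continuous_inner_comp (by fun_prop) (by fun_prop)).stronglyMeasurable
      exact this.integral_prod_right'.aestronglyMeasurable
  rw [← integral_congr_ae (ae_of_all _ hcongr), e2]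
  simp_rw [e4]

/-- For a fixed value of the sum, integration by parts and the matching of second moments produce
averages over `v` distributed as `X i`. Only then is the sum split into `X i` and the rest, so `v`
acts as an independent copy of `X i`. -/
lemma IsSmoothTest.integral_inner_gaussian_sum (h : IsSmoothTest f G U M₁ M₂) [DecidableEq I]
    {X : I → Ω → Vec d} (hX : ∀ i, Measurable (X i)) (hindep : iIndepFun X P) (t : Finset I)
    (h3 : ∀ i ∈ t, Integrable (fun ω => ‖X i ω‖ ^ 3) P)
    (ν ν₀ : Measure (Vec d)) [IsProbabilityMeasure ν₀] (S : Vec d →L[ℝ] Vec d)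
    (hνS : ν = (stdGaussian (Vec d)).map S) (hν₀ : ν = ν₀ ∗ stdGaussian (Vec d))
    (hcov : ∀ k l, ∑ j, S (EuclideanSpace.basisFun (Fin d) ℝ j) k *
      S (EuclideanSpace.basisFun (Fin d) ℝ j) l = ∑ i ∈ t, ∫ ω, X i ω k * X i ω l ∂P)
    {s : ℝ} (hs : 0 < s) (c : ℝ) :
    ∫ ω, ∫ g, ⟪G (c • (∑ i ∈ t, X i ω) + s • g), g⟫ ∂ν ∂P
      = s * ∑ i ∈ t, ∫ x, ∫ v, smoothD2 G (leaveOneOut P X t ν₀ c s i) s (c • x) v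
          ∂(P.map (X i)) ∂(P.map (X i)) := by
  set W : Ω → Vec d := fun ω => ∑ i ∈ t, X i ω with hWdef
  have hW : Measurable W := Finset.measurable_sum _ fun i _ => hX i
  have hR : ∀ i, Measurable fun ω => ∑ j ∈ t.erase i, X j ω := fun i =>
    Finset.measurable_sum _ fun i _ => hX i
  have hRp : ∀ i, IsProbabilityMeasure (P.map fun ω => ∑ j ∈ t.erase i, X j ω) := fun i =>
    Measure.isProbabilityMeasure_map (hR i).aemeasurable
  have hlp : ∀ i, IsProbabilityMeasure (P.map (X i)) := fun i =>
    Measure.isProbabilityMeasure_map (hX i).aemeasurable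
  have hWsplit : ∀ i ∈ t, ∀ ω, X i ω + ∑ j ∈ t.erase i, X j ω = W ω := fun i hi ω =>
    Finset.add_sum_erase t (fun j => X j ω) hi
  have h2i : ∀ i ∈ t, Integrable (fun ω => ‖X i ω‖ ^ 2) P := fun i hi =>
    (integrable_norm_of_integrable_norm_cube (hX i) (h3 i hi)).2
  have hvv : ∀ i ∈ t, ∀ k l, Integrable (fun v : Vec d => v k * v l) (P.map (X i)) := by
    intro i hi k l
    rw [integrable_map_measure (by fun_prop) (hX i).aemeasurable]
    exact integrable_coord_mul (hX i) (h2i i hi) k l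
  have e1 : ∀ y, ∫ g, ⟪G (y + s • g), g⟫ ∂ν
      = s * ∑ i ∈ t, ∫ v, smoothD2 G (ν₀.map (s • ·)) s y v ∂(P.map (X i)) := fun y => by
    rw [h.integral_inner_gaussian ν ν₀ S hνS hν₀ hs,
      h.sum_smoothD2_image_eq (ν₀.map (s • ·)) s y t (fun i => P.map (X i)) _ hvv]
    intro k l
    rw [hcov]
    refine Finset.sum_congr rfl fun i _ => ?_
    rw [integral_map (hX i).aemeasurable (by fun_prop)]
  have hD2m := h.measurable_smoothD2 (ν₀.map (s • ·)) s
  set L := s⁻¹ * M₁ * √(2 / Real.pi)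
  have h2l : ∀ i ∈ t, Integrable (fun v : Vec d => ‖v‖ ^ 2) (P.map (X i)) := fun i hi => by
    rw [integrable_map_measure (by fun_prop) (hX i).aemeasurable]
    exact h2i i hi
  have hbd : ∀ i ∈ t, ∀ y, |∫ v, smoothD2 G (ν₀.map (s • ·)) s y v ∂(P.map (X i))|
      ≤ ∫ v, L * ‖v‖ ^ 2 ∂(P.map (X i)) := fun i hi y =>
    norm_integral_le_of_norm_le (f := fun v => smoothD2 G (ν₀.map (s • ·)) s y v)
      ((h2l i hi).const_mul L) (ae_of_all _ fun v => h.abs_smoothD2_le _ hs y v)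
  have hm : ∀ i, Measurable fun y => ∫ v, smoothD2 G (ν₀.map (s • ·)) s y v ∂(P.map (X i)) :=
    fun i => (hD2m.stronglyMeasurable.integral_prod_right').measurable
  have hint : ∀ i ∈ t, Integrable
      (fun ω => ∫ v, smoothD2 G (ν₀.map (s • ·)) s (c • W ω) v ∂(P.map (X i))) P :=
    fun i hi => (integrable_const _).mono' ((hm i).comp (hW.const_smul c)).aestronglyMeasurable
      (ae_of_all _ fun ω => hbd i hi _)
  change ∫ ω, ∫ g, ⟪G (c • W ω + s • g), g⟫ ∂ν ∂P = _
  rw [integral_congr_ae (ae_of_all _ fun ω => e1 (c • W ω)), integral_const_mul,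
    integral_finsetSum _ hint]
  congr 1
  refine Finset.sum_congr rfl fun i hi => ?_
  have hFm : Measurable fun p : Vec d × Vec d =>
      ∫ v, smoothD2 G (ν₀.map (s • ·)) s (c • (p.1 + p.2)) v ∂(P.map (X i)) :=
    (hm i).comp (by fun_prop : Measurable fun p : Vec d × Vec d => c • (p.1 + p.2))
  have hcongr : ∀ ω, ∫ v, smoothD2 G (ν₀.map (s • ·)) s
      (c • (X i ω + ∑ j ∈ t.erase i, X j ω)) v ∂(P.map (X i))
      = ∫ v, smoothD2 G (ν₀.map (s • ·)) s (c • W ω) v ∂(P.map (X i)) := fun ω => by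
    rw [hWsplit i hi]
  have e2 := integral_indep_pair (hX i) (hR i) (iIndepFun.indepFun_sum_erase hX hindep t i) hFm
    ((hint i hi).congr (ae_of_all _ fun ω => (hcongr ω).symm))
  rw [← integral_congr_ae (ae_of_all _ hcongr), e2]
  congr 1
  ext x
  have e3 : ∀ v, smoothD2 G (leaveOneOut P X t ν₀ c s i) s (c • x) v
      = ∫ w, smoothD2 G (ν₀.map (s • ·)) s (c • (x + w)) v
        ∂(P.map fun ω => ∑ j ∈ t.erase i, X j ω) := fun v => by
    rw [leaveOneOut, h.smoothD2_conv, integral_map (by fun_prop)]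
    · simp_rw [smul_add]
    · exact (hD2m.comp (by fun_prop : Measurable fun w : Vec d =>
        (c • x + w, v))).aestronglyMeasurable
  simp_rw [e3]
  rw [integral_integral_swap]
  have hdom := (integrable_const (1 : ℝ)
    (μ := P.map fun ω => ∑ j ∈ t.erase i, X j ω)).mul_prod ((h2l i hi).const_mul L)
  refine hdom.mono' ?_ (ae_of_all _ fun p => ?_)
  · exact (hD2m.comp (by fun_prop : Measurable fun p : Vec d × Vec d =>
      (c • (x + p.1), p.2))).aestronglyMeasurable
  · rw [one_mul]
    exact h.abs_smoothD2_le _ hs _ _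

lemma IsSmoothTest.integral_inner_interp (h : IsSmoothTest f G U M₁ M₂) [DecidableEq I]
    {X : I → Ω → Vec d} (hX : ∀ i, Measurable (X i)) (hindep : iIndepFun X P) (t : Finset I)
    (h3 : ∀ i ∈ t, Integrable (fun ω => ‖X i ω‖ ^ 3) P)
    (ν ν₀ : Measure (Vec d)) [IsProbabilityMeasure ν] [IsProbabilityMeasure ν₀]
    (hν : Integrable (fun g : Vec d => g) ν) (S : Vec d →L[ℝ] Vec d)
    (hνS : ν = (stdGaussian (Vec d)).map S) (hν₀ : ν = ν₀ ∗ stdGaussian (Vec d))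
    (hcov : ∀ k l, ∑ j, S (EuclideanSpace.basisFun (Fin d) ℝ j) k *
      S (EuclideanSpace.basisFun (Fin d) ℝ j) l = ∑ i ∈ t, ∫ ω, X i ω k * X i ω l ∂P)
    {s c : ℝ} (hs : 0 < s) :
    ∫ p, ⟪G (c • (∑ i ∈ t, X i p.1) + s • p.2), -(s • ∑ i ∈ t, X i p.1) + c • p.2⟫ ∂(P.prod ν)
      = ∑ i ∈ t, (-(s * ∫ x, ∫ w, ⟪G (c • x + w), x⟫
          ∂(leaveOneOut P X t ν₀ c s i ∗ (stdGaussian (Vec d)).map (s • ·)) ∂(P.map (X i)))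
        + c * s * ∫ x, ∫ v, smoothD2 G (leaveOneOut P X t ν₀ c s i) s (c • x) v
          ∂(P.map (X i)) ∂(P.map (X i))) := by
  have hW : Measurable fun ω => ∑ i ∈ t, X i ω := Finset.measurable_sum _ fun i _ => hX i
  have hWi : Integrable (fun ω => ∑ i ∈ t, X i ω) P := integrable_finsetSum _ fun i hi =>
    integrable_of_integrable_norm_cube (hX i) (h3 i hi)
  rw [h.integral_inner_split ν hν hW hWi s c, h.integral_inner_sum hX hindep t h3 ν ν₀ hν₀ s c,
    h.integral_inner_gaussian_sum hX hindep t h3 ν ν₀ S hνS hν₀ hcov hs c,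
    Finset.sum_add_distrib, Finset.sum_neg_distrib, ← Finset.mul_sum, ← Finset.mul_sum,
    mul_assoc c s]

/-- Bound on the derivative of the interpolation between the sum and the Gaussian vector. -/
lemma IsSmoothTest.abs_deriv_interp_le (h : IsSmoothTest f G U M₁ M₂) [DecidableEq I]
    {X : I → Ω → Vec d} (hX : ∀ i, Measurable (X i)) (hindep : iIndepFun X P) (t : Finset I)
    (h3 : ∀ i ∈ t, Integrable (fun ω => ‖X i ω‖ ^ 3) P) (hmean : ∀ i ∈ t, ∫ ω, X i ω ∂P = 0)
    (ν ν₀ : Measure (Vec d)) [IsProbabilityMeasure ν] [IsProbabilityMeasure ν₀]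
    (hν : Integrable (fun g : Vec d => g) ν) (S : Vec d →L[ℝ] Vec d)
    (hνS : ν = (stdGaussian (Vec d)).map S) (hν₀ : ν = ν₀ ∗ stdGaussian (Vec d))
    (hcov : ∀ k l, ∑ j, S (EuclideanSpace.basisFun (Fin d) ℝ j) k *
      S (EuclideanSpace.basisFun (Fin d) ℝ j) l = ∑ i ∈ t, ∫ ω, X i ω k * X i ω l ∂P)
    {s c B : ℝ} (hs : 0 < s) (hc : 0 ≤ c) (hB0 : 0 ≤ B)
    (hB : ∀ i ∈ t, ∀ x u v, |smoothD2 G (leaveOneOut P X t ν₀ c s i) s (x + u) v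
      - smoothD2 G (leaveOneOut P X t ν₀ c s i) s x v| ≤ B * ‖u‖ * ‖v‖ ^ 2) :
    |∫ p, ⟪G (c • (∑ i ∈ t, X i p.1) + s • p.2), -(s • ∑ i ∈ t, X i p.1) + c • p.2⟫ ∂(P.prod ν)|
      ≤ 3 / 2 * (s * c ^ 2) * B * ∑ i ∈ t, ∫ ω, ‖X i ω‖ ^ 3 ∂P := by
  rw [h.integral_inner_interp hX hindep t h3 ν ν₀ hν S hνS hν₀ hcov hs, Finset.mul_sum]
  refine (Finset.abs_sum_le_sum_abs _ _).trans (Finset.sum_le_sum fun i hi => ?_)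
  have hlp : IsProbabilityMeasure (P.map (X i)) :=
    Measure.isProbabilityMeasure_map (hX i).aemeasurable
  have hRp : IsProbabilityMeasure (P.map fun ω => ∑ j ∈ t.erase i, X j ω) :=
    Measure.isProbabilityMeasure_map (Finset.measurable_sum _ fun i _ => hX i).aemeasurable
  have key := h.abs_summand_le (leaveOneOut P X t ν₀ c s i) (P.map (X i))
    ((integrable_map_measure (by fun_prop) (hX i).aemeasurable).2 (h3 i hi))
    (by rw [integral_map (hX i).aemeasurable (by fun_prop)]; exact hmean i hi) hs hc hB0 (hB i hi)
  rwa [integral_map (hX i).aemeasurable (f := fun x : Vec d => ‖x‖ ^ 3) (by fun_prop)] at key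

end Interpolation

/-! ### The smoothed indicator of a set. -/

section SmoothIndicator

/-- A continuously differentiable cutoff, equal to `1` on `(-∞, 0]` and to `0` on `[ε, ∞)`. -/
noncomputable def cutoff (ε r : ℝ) : ℝ :=
  1 - 2 / ε ^ 2 * (max r 0) ^ 2 + 4 / ε ^ 2 * (max (r - ε / 2) 0) ^ 2
    - 2 / ε ^ 2 * (max (r - ε) 0) ^ 2

/-- The derivative of `cutoff`. -/
noncomputable def cutoffDeriv (ε r : ℝ) : ℝ := -(4 / ε ^ 2 * max 0 (min r (ε - r)))

lemma hasDerivAt_max_sq (a x : ℝ) :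
    HasDerivAt (fun r : ℝ => (max (r - a) 0) ^ 2) (2 * max (x - a) 0) x := by
  rcases lt_trichotomy x a with h | h | h
  · rw [max_eq_right (by linarith), mul_zero]
    refine (hasDerivAt_const x (0 : ℝ)).congr_of_eventuallyEq ?_
    filter_upwards [Iio_mem_nhds h] with y hy
    rw [max_eq_right (by linarith [Set.mem_Iio.1 hy])]
    norm_num
  · subst h
    rw [sub_self, max_self, mul_zero]
    have h1 : (fun r : ℝ => (max (r - x) 0) ^ 2) =O[𝓝 x] fun r => ‖r - x‖ ^ 2 := by
      refine Asymptotics.IsBigO.of_bound 1 (Eventually.of_forall fun r => ?_)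
      rw [one_mul, norm_pow, norm_pow, norm_norm, Real.norm_eq_abs, Real.norm_eq_abs]
      refine pow_le_pow_left₀ (abs_nonneg _) ?_ 2
      rcases le_total (r - x) 0 with h | h
      · rw [max_eq_right h, abs_zero]
        exact abs_nonneg _
      · rw [max_eq_left h]
    have h2 := h1.hasFDerivAt (𝕜 := ℝ) (by norm_num)
    simpa using h2.hasDerivAt
  · rw [max_eq_left (by linarith)]
    have h1 : HasDerivAt (fun r : ℝ => (r - a) ^ 2) (2 * (x - a)) x :=
      (((hasDerivAt_id x).sub_const a).pow 2).congr_deriv (by simp)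
    refine h1.congr_of_eventuallyEq ?_
    filter_upwards [Ioi_mem_nhds h] with y hy
    rw [max_eq_left (by linarith [Set.mem_Ioi.1 hy])]

variable {ε : ℝ}

lemma hasDerivAt_cutoff (hε : 0 < ε) (x : ℝ) :
    HasDerivAt (cutoff ε) (cutoffDeriv ε x) x := by
  have h0 := hasDerivAt_max_sq 0 x
  simp only [sub_zero] at h0
  refine ((((h0.const_mul (2 / ε ^ 2)).const_sub 1).add
    ((hasDerivAt_max_sq (ε / 2) x).const_mul (4 / ε ^ 2))).sub
    ((hasDerivAt_max_sq ε x).const_mul (2 / ε ^ 2))).congr_deriv ?_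
  -- The tent over [0, ε] is a combination of three ramps, with kinks at 0, ε/2 and ε; `cutoff`
  -- integrates these ramps.
  have h : max 0 (min x (ε - x)) = max x 0 - 2 * max (x - ε / 2) 0 + max (x - ε) 0 := by
    rcases le_total x 0 with h1 | h1
    · rw [min_eq_left (by linarith), max_eq_left h1, max_eq_right h1, max_eq_right (by linarith),
        max_eq_right (by linarith)]
      ring
    · rw [max_eq_left h1]
      rcases le_total x (ε / 2) with h2 | h2
      · rw [min_eq_left (by linarith), max_eq_right h1, max_eq_right (by linarith),
          max_eq_right (by linarith)]
        ring
      · rw [min_eq_right (by linarith), max_eq_left (by linarith : (0 : ℝ) ≤ x - ε / 2)]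
        rcases le_total x ε with h3 | h3
        · rw [max_eq_right (by linarith), max_eq_right (by linarith)]
          ring
        · rw [max_eq_left (by linarith), max_eq_left (by linarith)]
          ring
  rw [cutoffDeriv, h]
  ring

lemma cutoff_of_nonpos (hε : 0 < ε) {r : ℝ} (hr : r ≤ 0) : cutoff ε r = 1 := by
  rw [cutoff, max_eq_right hr, max_eq_right (by linarith), max_eq_right (by linarith)]
  ring

lemma cutoff_of_le (hε : 0 < ε) {r : ℝ} (hr : ε ≤ r) : cutoff ε r = 0 := by
  rw [cutoff, max_eq_left (by linarith), max_eq_left (by linarith), max_eq_left (by linarith)]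
  field_simp
  ring

lemma cutoffDeriv_nonpos (r : ℝ) : cutoffDeriv ε r ≤ 0 := by
  rw [cutoffDeriv, neg_nonpos]
  exact mul_nonneg (by positivity) (le_max_left _ _)

lemma antitone_cutoff (hε : 0 < ε) : Antitone (cutoff ε) :=
  antitone_of_deriv_nonpos (fun x => (hasDerivAt_cutoff hε x).differentiableAt) fun x => by
    rw [(hasDerivAt_cutoff hε x).deriv]
    exact cutoffDeriv_nonpos x

lemma cutoff_nonneg (hε : 0 < ε) (r : ℝ) : 0 ≤ cutoff ε r := by
  rcases le_total ε r with h | h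
  · exact (cutoff_of_le hε h).ge
  · exact (cutoff_of_le hε le_rfl).ge.trans (antitone_cutoff hε h)

lemma cutoff_le_one (hε : 0 < ε) (r : ℝ) : cutoff ε r ≤ 1 := by
  rcases le_total r 0 with h | h
  · exact (cutoff_of_nonpos hε h).le
  · exact (antitone_cutoff hε h).trans (cutoff_of_nonpos hε le_rfl).le

lemma one_sub_cutoff_le (hε : 0 < ε) (r : ℝ) : 1 - cutoff ε r ≤ 2 / ε ^ 2 * (max r 0) ^ 2 := by
  have h1 : max (r - ε) 0 ≤ max (r - ε / 2) 0 := max_le_max (by linarith) le_rfl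
  have h2 : (max (r - ε) 0) ^ 2 ≤ (max (r - ε / 2) 0) ^ 2 := by gcongr
  have h3 : 2 / ε ^ 2 * (max (r - ε) 0) ^ 2 ≤ 4 / ε ^ 2 * (max (r - ε / 2) 0) ^ 2 := by
    gcongr
    norm_num
  rw [cutoff]
  linarith

lemma cutoffDeriv_of_nonpos {r : ℝ} (hr : r ≤ 0) : cutoffDeriv ε r = 0 := by
  rw [cutoffDeriv, max_eq_left ((min_le_left _ _).trans hr), mul_zero, neg_zero]

lemma cutoffDeriv_of_le {r : ℝ} (hr : ε ≤ r) : cutoffDeriv ε r = 0 := by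
  rw [cutoffDeriv, max_eq_left ((min_le_right _ _).trans (by linarith)), mul_zero, neg_zero]

lemma abs_cutoffDeriv_le_of_nonneg {r : ℝ} (hr : 0 ≤ r) :
    |cutoffDeriv ε r| ≤ 4 / ε ^ 2 * r := by
  rw [cutoffDeriv, abs_neg, abs_of_nonneg (mul_nonneg (by positivity) (le_max_left _ _))]
  gcongr
  exact max_le hr (min_le_left _ _)

lemma abs_cutoffDeriv_le (hε : 0 < ε) (r : ℝ) : |cutoffDeriv ε r| ≤ 4 / ε := by
  rcases le_total r 0 with h | h
  · rw [cutoffDeriv_of_nonpos h, abs_zero]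
    positivity
  rcases le_total ε r with h' | h'
  · rw [cutoffDeriv_of_le h', abs_zero]
    positivity
  refine (abs_cutoffDeriv_le_of_nonneg h).trans ?_
  calc 4 / ε ^ 2 * r ≤ 4 / ε ^ 2 * ε := by gcongr
    _ = 4 / ε := by field_simp

lemma abs_cutoffDeriv_sub_le (a b : ℝ) :
    |cutoffDeriv ε a - cutoffDeriv ε b| ≤ 4 / ε ^ 2 * |a - b| := by
  rw [cutoffDeriv, cutoffDeriv, neg_sub_neg, ← mul_sub, abs_mul,
    abs_of_nonneg (by positivity : 0 ≤ 4 / ε ^ 2), abs_sub_comm a b]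
  refine mul_le_mul_of_nonneg_left ?_ (by positivity)
  have h1 := abs_max_sub_max_le_max (0 : ℝ) (min b (ε - b)) 0 (min a (ε - a))
  have h2 := abs_min_sub_min_le_max b (ε - b) a (ε - a)
  rw [show ε - b - (ε - a) = -(b - a) by ring, abs_neg, max_self] at h2
  rw [sub_self, abs_zero,
    max_eq_right (abs_nonneg (min b (ε - b) - min a (ε - a)))] at h1
  exact h1.trans h2

variable {d : ℕ} {𝒜 : Set (Set (Vec d))} {ρ : Set (Vec d) → Vec d → ℝ} {κ : ℝ} {A : Set (Vec d)}

/-- Where `ρ A` is negative neither continuity nor nonexpansiveness is available. By the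
intermediate value theorem for the positive part, the segment from `x` to `y` meets a small level δ
> 0, from which nonexpansiveness applies. A positive level is needed, since a zero positive part
does not make `ρ A` nonnegative. -/
lemma IsAdmissibleClass.max_zero_le_of_neg (h : IsAdmissibleClass 𝒜 ρ κ) (hA : A ∈ 𝒜)
    {x y : Vec d} (hx : ρ A x < 0) : max (ρ A y) 0 ≤ ‖y - x‖ := by
  rcases le_or_gt (ρ A y) 0 with hy | hy
  · rw [max_eq_right hy]
    exact norm_nonneg _
  rw [max_eq_left hy.le]
  refine le_of_forall_pos_le_add fun δ hδ => ?_
  rcases le_total (ρ A y) δ with hyδ | hyδ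
  · linarith [norm_nonneg (y - x)]
  have hc : ContinuousOn (fun t : ℝ => max (ρ A (x + t • (y - x))) 0) (Set.Icc 0 1) :=
    ((h.continuous_posPart A hA).comp
      (by fun_prop : Continuous fun t : ℝ => x + t • (y - x))).continuousOn
  have hmem : δ ∈ Set.Icc (max (ρ A (x + (0 : ℝ) • (y - x))) 0)
      (max (ρ A (x + (1 : ℝ) • (y - x))) 0) := by
    rw [zero_smul, one_smul, add_zero, add_sub_cancel, max_eq_right hx.le, max_eq_left hy.le]
    exact ⟨hδ.le, hyδ⟩
  obtain ⟨t, ht, hteq⟩ := intermediate_value_Icc zero_le_one hc hmem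
  simp only at hteq
  have hpos : 0 < ρ A (x + t • (y - x)) := by
    by_contra! hle
    rw [max_eq_right hle] at hteq
    exact hδ.ne hteq
  rw [max_eq_left hpos.le] at hteq
  have h1 := h.nonexpansive A hA y (x + t • (y - x)) hy.le hpos.le
  rw [hteq, show y - (x + t • (y - x)) = (1 - t) • (y - x) by
    rw [sub_smul, one_smul]; abel, norm_smul, Real.norm_eq_abs,
    abs_of_nonneg (by linarith [ht.2] : (0 : ℝ) ≤ 1 - t)] at h1
  have h2 := le_of_abs_le h1
  nlinarith [norm_nonneg (y - x), ht.1]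

lemma IsAdmissibleClass.abs_max_zero_sub_le (h : IsAdmissibleClass 𝒜 ρ κ) (hA : A ∈ 𝒜)
    (x y : Vec d) : |max (ρ A x) 0 - max (ρ A y) 0| ≤ ‖x - y‖ := by
  rcases lt_or_ge (ρ A x) 0 with hx | hx
  · rw [max_eq_right hx.le, zero_sub, abs_neg, abs_of_nonneg (le_max_right _ _), norm_sub_rev]
    exact h.max_zero_le_of_neg hA hx
  rcases lt_or_ge (ρ A y) 0 with hy | hy
  · rw [max_eq_right hy.le, sub_zero, abs_of_nonneg (le_max_right _ _)]
    exact h.max_zero_le_of_neg hA hy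
  rw [max_eq_left hx, max_eq_left hy]
  exact h.nonexpansive A hA x y hx hy

lemma IsAdmissibleClass.isOpen_pos (h : IsAdmissibleClass 𝒜 ρ κ) (hA : A ∈ 𝒜) :
    IsOpen {x | 0 < ρ A x} := by
  have : {x | 0 < ρ A x} = {x | 0 < max (ρ A x) 0} := by
    ext x
    simp
  rw [this]
  exact isOpen_lt continuous_const (h.continuous_posPart A hA)

lemma IsAdmissibleClass.isOpen_annulus (h : IsAdmissibleClass 𝒜 ρ κ) (hA : A ∈ 𝒜) (hε : 0 < ε) :
    IsOpen {x | 0 < ρ A x ∧ ρ A x < ε} := by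
  have : {x | 0 < ρ A x ∧ ρ A x < ε} = {x | 0 < ρ A x} ∩ {x | max (ρ A x) 0 < ε} := by
    ext x
    simp [hε]
  rw [this]
  exact (h.isOpen_pos hA).inter (isOpen_lt (h.continuous_posPart A hA) continuous_const)

lemma IsAdmissibleClass.norm_gradient_le (h : IsAdmissibleClass 𝒜 ρ κ) (hA : A ∈ 𝒜) {x : Vec d}
    (hx : 0 < ρ A x) : ‖gradient (ρ A) x‖ ≤ 1 := by
  have h1 := (h.differentiableAt A hA x hx).hasFDerivAt
  have h2 : LipschitzOnWith 1 (ρ A) {x | 0 < ρ A x} :=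
    LipschitzOnWith.of_dist_le_mul fun y hy z hz => by
      rw [NNReal.coe_one, one_mul, Real.dist_eq, dist_eq_norm]
      exact h.nonexpansive A hA y z (le_of_lt hy) (le_of_lt hz)
  have h3 := h1.le_of_lipschitzOn ((h.isOpen_pos hA).mem_nhds hx) h2
  rw [gradient, LinearIsometryEquiv.norm_map]
  simpa using h3

/-- The smoothed indicator of the set `A`. -/
noncomputable def smoothInd (ρ : Set (Vec d) → Vec d → ℝ) (A : Set (Vec d)) (ε : ℝ) (x : Vec d) :
    ℝ := cutoff ε (ρ A x)

open Classical in
/-- The gradient of `smoothInd`. -/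
noncomputable def smoothIndGrad (ρ : Set (Vec d) → Vec d → ℝ) (A : Set (Vec d)) (ε : ℝ)
    (x : Vec d) : Vec d :=
  if 0 < ρ A x then cutoffDeriv ε (ρ A x) • gradient (ρ A) x else 0

/-- At a point with `ρ A x ≤ 0`, the quadratic onset of the cutoff keeps the function within O(‖y −
x‖²) of 1, so the gradient vanishes however irregular `ρ A` is there. -/
lemma IsAdmissibleClass.hasGradientAt_smoothInd (h : IsAdmissibleClass 𝒜 ρ κ) (hA : A ∈ 𝒜)
    (hε : 0 < ε) (x : Vec d) :
    HasGradientAt (smoothInd ρ A ε) (smoothIndGrad ρ A ε x) x := by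
  rw [smoothIndGrad]
  split_ifs with hx
  · have h1 := (h.differentiableAt A hA x hx).hasGradientAt.hasFDerivAt
    have h2 := (hasDerivAt_cutoff hε (ρ A x)).comp_hasFDerivAt x h1
    rw [hasGradientAt_iff_hasFDerivAt, map_smul]
    exact h2
  · rw [hasGradientAt_iff_hasFDerivAt, map_zero]
    have h1 : (fun y => smoothInd ρ A ε y - 1) =O[𝓝 x] fun y => ‖y - x‖ ^ 2 := by
      refine Asymptotics.IsBigO.of_bound (2 / ε ^ 2) (Eventually.of_forall fun y => ?_)
      rw [Real.norm_eq_abs, abs_sub_comm, smoothInd,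
        abs_of_nonneg (by linarith [cutoff_le_one hε (ρ A y)])]
      refine (one_sub_cutoff_le hε _).trans ?_
      rw [norm_pow, norm_norm]
      have := h.abs_max_zero_sub_le hA y x
      rw [max_eq_right (not_lt.1 hx), sub_zero, abs_of_nonneg (le_max_right _ _)] at this
      gcongr
    have h2 := (h1.hasFDerivAt (𝕜 := ℝ) (by norm_num)).add_const 1
    simpa using h2

lemma IsAdmissibleClass.norm_smoothIndGrad_le (h : IsAdmissibleClass 𝒜 ρ κ) (hA : A ∈ 𝒜)
    (hε : 0 < ε) (x : Vec d) :
    ‖smoothIndGrad ρ A ε x‖ ≤ 4 / ε ∧ ‖smoothIndGrad ρ A ε x‖ ≤ 4 / ε ^ 2 * max (ρ A x) 0 := by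
  rw [smoothIndGrad]
  split_ifs with hx
  · rw [norm_smul, Real.norm_eq_abs, max_eq_left hx.le]
    have h1 := h.norm_gradient_le hA hx
    exact ⟨(mul_le_of_le_one_right (abs_nonneg _) h1).trans (abs_cutoffDeriv_le hε _),
      (mul_le_of_le_one_right (abs_nonneg _) h1).trans (abs_cutoffDeriv_le_of_nonneg hx.le)⟩
  · rw [norm_zero]
    exact ⟨by positivity, by positivity⟩

/-- The curvature bound κ/ρ is singular at the boundary, but the cutoff has derivative at most
4ρ/ε², so the product stays below 4κ/ε²; the slope of the tent adds 4/ε². The ordering of `x` and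
`y` makes the minimum in (A8) equal to `ρ A x`, which the cutoff derivative at `x` then cancels. -/
lemma IsAdmissibleClass.norm_smoothIndGrad_sub_le_of_le (h : IsAdmissibleClass 𝒜 ρ κ)
    (hA : A ∈ 𝒜) (hε : 0 < ε) {x y : Vec d} (hxy : ρ A x ≤ ρ A y) :
    ‖smoothIndGrad ρ A ε x - smoothIndGrad ρ A ε y‖ ≤ 4 * (1 + κ) / ε ^ 2 * ‖x - y‖ := by
  have hκ := h.curvature_nonneg
  by_cases hx : 0 < ρ A x
  · have hy := hx.trans_le hxy
    rw [smoothIndGrad, smoothIndGrad, if_pos hx, if_pos hy]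
    have e : cutoffDeriv ε (ρ A x) • gradient (ρ A) x - cutoffDeriv ε (ρ A y) • gradient (ρ A) y
        = cutoffDeriv ε (ρ A x) • (gradient (ρ A) x - gradient (ρ A) y)
          + (cutoffDeriv ε (ρ A x) - cutoffDeriv ε (ρ A y)) • gradient (ρ A) y := by
      rw [smul_sub, sub_smul]
      abel
    rw [e]
    refine (norm_add_le _ _).trans ?_
    rw [norm_smul, norm_smul, Real.norm_eq_abs, Real.norm_eq_abs]
    have h1 := h.gradient_bound A hA x y hx hy
    rw [min_eq_left hxy] at h1
    have h2 := abs_cutoffDeriv_le_of_nonneg (ε := ε) hx.le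
    have h3 := abs_cutoffDeriv_sub_le (ε := ε) (ρ A x) (ρ A y)
    have h4 := h.nonexpansive A hA x y hx.le hy.le
    have h5 := h.norm_gradient_le hA hy
    calc |cutoffDeriv ε (ρ A x)| * ‖gradient (ρ A) x - gradient (ρ A) y‖
          + |cutoffDeriv ε (ρ A x) - cutoffDeriv ε (ρ A y)| * ‖gradient (ρ A) y‖
        ≤ (4 / ε ^ 2 * ρ A x) * (κ * ‖x - y‖ / ρ A x) + (4 / ε ^ 2 * ‖x - y‖) * 1 := by
          gcongr
          exact h3.trans (by gcongr)
      _ = _ := by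
        field_simp
        ring
  · have hx' : smoothIndGrad ρ A ε x = 0 := by rw [smoothIndGrad, if_neg hx]
    rw [hx', zero_sub, norm_neg]
    refine (h.norm_smoothIndGrad_le hA hε y).2.trans ?_
    have h1 := h.abs_max_zero_sub_le hA y x
    rw [max_eq_right (not_lt.1 hx), sub_zero, abs_of_nonneg (le_max_right _ _),
      norm_sub_rev] at h1
    gcongr
    linarith

lemma IsAdmissibleClass.isSmoothTest (h : IsAdmissibleClass 𝒜 ρ κ) (hA : A ∈ 𝒜) (hε : 0 < ε) :
    IsSmoothTest (smoothInd ρ A ε) (smoothIndGrad ρ A ε) {x | 0 < ρ A x ∧ ρ A x < ε} (4 / ε)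
      (4 * (1 + κ) / ε ^ 2) where
  nonneg x := cutoff_nonneg hε _
  le_one x := cutoff_le_one hε _
  hasGradientAt := h.hasGradientAt_smoothInd hA hε
  norm_le x := (h.norm_smoothIndGrad_le hA hε x).1
  lipschitz x y := by
    rcases le_total (ρ A x) (ρ A y) with hxy | hxy
    · exact h.norm_smoothIndGrad_sub_le_of_le hA hε hxy
    · rw [norm_sub_rev, norm_sub_rev x]
      exact h.norm_smoothIndGrad_sub_le_of_le hA hε hxy
  isOpen := h.isOpen_annulus hA hε
  eq_zero x hx := by
    rw [smoothIndGrad]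
    split_ifs with h0
    · rw [cutoffDeriv_of_le, zero_smul]
      by_contra! hlt
      exact hx ⟨h0, hlt⟩
    · rfl

lemma exists_superlevel_smoothInd (hε : 0 < ε) {t : ℝ} (ht0 : 0 < t) (ht1 : t ≤ 1) :
    ∃ b, {x | t ≤ smoothInd ρ A ε x} = sublevel ρ A b := by
  have hcont : Continuous (cutoff ε) :=
    continuous_iff_continuousAt.2 fun x => (hasDerivAt_cutoff hε x).continuousAt
  have hne : {r | t ≤ cutoff ε r}.Nonempty := ⟨0, by
    change t ≤ cutoff ε 0
    rwa [cutoff_of_nonpos hε le_rfl]⟩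
  have hbdd : BddAbove {r | t ≤ cutoff ε r} := ⟨ε, fun r hr => by
    by_contra! hlt
    have h1 : t ≤ cutoff ε r := hr
    rw [cutoff_of_le hε hlt.le] at h1
    linarith⟩
  have hcl : IsClosed {r | t ≤ cutoff ε r} := isClosed_le continuous_const hcont
  refine ⟨sSup {r | t ≤ cutoff ε r}, ?_⟩
  ext x
  change t ≤ cutoff ε (ρ A x) ↔ ρ A x ≤ _
  refine ⟨fun hx => le_csSup hbdd hx, fun hx => ?_⟩
  have h1 : t ≤ cutoff ε (sSup {r | t ≤ cutoff ε r}) := hcl.csSup_mem hne hbdd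
  exact h1.trans (antitone_cutoff hε hx)

lemma IsAdmissibleClass.measurableSet_sublevel (h : IsAdmissibleClass 𝒜 ρ κ) (hA : A ∈ 𝒜) (b : ℝ) :
    MeasurableSet (sublevel ρ A b) :=
  measurableSet_le (h.measurable_dist A hA) measurable_const

/-- The layer cake comparison of the integrals of a smoothed indicator. -/
lemma IsAdmissibleClass.abs_integral_smoothInd_sub_le (h : IsAdmissibleClass 𝒜 ρ κ) (hA : A ∈ 𝒜)
    (hε : 0 < ε) (μ μ' : Measure (Vec d)) [IsProbabilityMeasure μ] [IsProbabilityMeasure μ']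
    (y : Vec d) {δ : ℝ}
    (hδ : ∀ b, |μ.real {w | y + w ∈ sublevel ρ A b} - μ'.real {w | y + w ∈ sublevel ρ A b}| ≤ δ) :
    |∫ w, smoothInd ρ A ε (y + w) ∂μ - ∫ w, smoothInd ρ A ε (y + w) ∂μ'| ≤ δ := by
  have hT := h.isSmoothTest hA hε
  have hc := hT.continuous
  have hmeas : Measurable fun w => smoothInd ρ A ε (y + w) := by fun_prop
  have key : ∀ (m : Measure (Vec d)) [IsProbabilityMeasure m],
      ∫ w, smoothInd ρ A ε (y + w) ∂m
        = ∫ t in Set.Ioc (0 : ℝ) 1, m.real {w | t ≤ smoothInd ρ A ε (y + w)} := by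
    intro m _
    exact Integrable.integral_eq_integral_Ioc_meas_le
      ((integrable_const (1 : ℝ)).mono' hmeas.aestronglyMeasurable
        (ae_of_all _ fun w => hT.abs_le_one _))
      (ae_of_all _ fun w => hT.nonneg _) (ae_of_all _ fun w => hT.le_one _)
  have hint : ∀ (m : Measure (Vec d)) [IsProbabilityMeasure m], IntegrableOn
      (fun t : ℝ => m.real {w | t ≤ smoothInd ρ A ε (y + w)}) (Set.Ioc (0 : ℝ) 1) := by
    intro m _
    have hanti : Antitone fun t : ℝ => m.real {w | t ≤ smoothInd ρ A ε (y + w)} :=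
      fun a b hab => measureReal_mono fun w hw => hab.trans hw
    refine Measure.integrableOn_of_bounded (M := 1) (by simp)
      hanti.measurable.aestronglyMeasurable (ae_of_all _ fun t => ?_)
    rw [Real.norm_eq_abs, abs_of_nonneg measureReal_nonneg]
    exact measureReal_le_one
  rw [key μ, key μ', ← integral_sub (hint μ) (hint μ')]
  have h1 := norm_setIntegral_le_of_norm_le_const (μ := volume) (s := Set.Ioc (0 : ℝ) 1) (C := δ)
    (f := fun t : ℝ => μ.real {w | t ≤ smoothInd ρ A ε (y + w)}
      - μ'.real {w | t ≤ smoothInd ρ A ε (y + w)}) (by simp) (fun t ht => by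
      -- The cutoff is antitone, so each layer is a sublevel set of `ρ A` and obeys the bound `δ`.
      obtain ⟨b, hb⟩ := exists_superlevel_smoothInd (ρ := ρ) (A := A) hε ht.1 ht.2
      have e : {w | t ≤ smoothInd ρ A ε (y + w)} = {w | y + w ∈ sublevel ρ A b} := by
        rw [← hb]
        rfl
      rw [e]
      exact hδ b)
  simpa using h1

end SmoothIndicator

/-! ### Centred Gaussian measures and second moment matrices. -/

section GaussianCovariance
open Matrix
open scoped MatrixOrder RealInnerProductSpace

variable {d : ℕ} {S T : Matrix (Fin d) (Fin d) ℝ}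

lemma multivariateGaussian_conv (hS : S.PosSemidef) (hT : T.PosSemidef) :
    multivariateGaussian 0 S ∗ multivariateGaussian 0 T = multivariateGaussian 0 (S + T) := by
  refine Measure.ext_of_charFun (funext fun x => ?_)
  rw [charFun_conv, charFun_multivariateGaussian hS, charFun_multivariateGaussian hT,
    charFun_multivariateGaussian (hS.add hT), ← Complex.exp_add, Matrix.add_mulVec,
    dotProduct_add, inner_zero_right]
  congr 1
  push_cast
  ring

lemma multivariateGaussian_map_smul (hS : S.PosSemidef) (a : ℝ) :
    (multivariateGaussian 0 S).map (a • ·) = multivariateGaussian 0 (a ^ 2 • S) := by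
  have : IsProbabilityMeasure ((multivariateGaussian 0 S).map (a • ·)) :=
    Measure.isProbabilityMeasure_map (by fun_prop)
  refine Measure.ext_of_charFun (funext fun x => ?_)
  rw [charFun_map_smul, charFun_multivariateGaussian hS,
    charFun_multivariateGaussian (hS.smul (sq_nonneg a)), Matrix.smul_mulVec, dotProduct_smul,
    WithLp.ofLp_smul, Matrix.mulVec_smul, dotProduct_smul, smul_dotProduct]
  simp only [inner_zero_right, smul_eq_mul]
  congr 3
  push_cast
  ring

lemma stdGaussian_map_smul (a : ℝ) :
    (stdGaussian (Vec d)).map (a • ·) = multivariateGaussian 0 (a ^ 2 • (1 : Matrix _ _ ℝ)) := by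
  rw [← multivariateGaussian_zero_one, multivariateGaussian_map_smul PosSemidef.one]

lemma multivariateGaussian_zero_eq_map :
    multivariateGaussian 0 S
      = (stdGaussian (Vec d)).map (toEuclideanCLM (𝕜 := ℝ) (CFC.sqrt S)) := by
  simp [multivariateGaussian]

lemma sum_sqrt_apply_basisFun (hS : S.PosSemidef) (k l : Fin d) :
    ∑ j, toEuclideanCLM (𝕜 := ℝ) (CFC.sqrt S) (EuclideanSpace.basisFun (Fin d) ℝ j) k *
      toEuclideanCLM (𝕜 := ℝ) (CFC.sqrt S) (EuclideanSpace.basisFun (Fin d) ℝ j) l = S k l := by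
  have h1 : ∀ j k, toEuclideanCLM (𝕜 := ℝ) (CFC.sqrt S)
      (EuclideanSpace.basisFun (Fin d) ℝ j) k = CFC.sqrt S k j := by
    intro j k
    simp
  have h2 := CFC.sqrt_mul_sqrt_self S hS.nonneg
  have h3 : (CFC.sqrt S).IsHermitian := (CFC.sqrt_nonneg S).posSemidef.isHermitian
  conv_rhs => rw [← h2, Matrix.mul_apply]
  refine Finset.sum_congr rfl fun j _ => ?_
  rw [h1, h1, ← h3.apply j l]
  simp

variable {Ω : Type*} [MeasurableSpace Ω] {P : Measure Ω} [IsProbabilityMeasure P]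

/-- The matrix of second moments of a random vector. -/
noncomputable def secondMomentMatrix (P : Measure Ω) (Y : Ω → Vec d) : Matrix (Fin d) (Fin d) ℝ :=
  Matrix.of fun k l => ∫ ω, Y ω k * Y ω l ∂P

lemma dotProduct_secondMomentMatrix {Y : Ω → Vec d}
    (hY : MemLp Y 2 P) (x : Fin d → ℝ) :
    x ⬝ᵥ secondMomentMatrix P Y *ᵥ x = ∫ ω, ⟪WithLp.toLp 2 x, Y ω⟫ ^ 2 ∂P := by
  have hc : ∀ k, MemLp (fun ω => Y ω k) 2 P := fun k =>
    (EuclideanSpace.proj k : Vec d →L[ℝ] ℝ).comp_memLp' hY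
  have hi : ∀ k l, Integrable (fun ω => Y ω k * Y ω l) P := fun k l => (hc k).integrable_mul (hc l)
  have e : ∀ ω, ⟪WithLp.toLp 2 x, Y ω⟫ ^ 2 = ∑ k, ∑ l, x k * (x l * (Y ω k * Y ω l)) := by
    intro ω
    rw [PiLp.inner_apply, sq, Finset.sum_mul_sum]
    refine Finset.sum_congr rfl fun k _ => Finset.sum_congr rfl fun l _ => ?_
    simp only [RCLike.inner_apply, conj_trivial]
    ring
  simp_rw [e]
  rw [integral_finsetSum _ fun k _ => integrable_finsetSum _ fun l _ =>
    ((hi k l).const_mul _).const_mul _]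
  refine Finset.sum_congr rfl fun k _ => ?_
  rw [integral_finsetSum _ fun l _ => ((hi k l).const_mul _).const_mul _, Matrix.mulVec,
    dotProduct, Finset.mul_sum]
  refine Finset.sum_congr rfl fun l _ => ?_
  rw [integral_const_mul, integral_const_mul, secondMomentMatrix, Matrix.of_apply]
  ring

lemma isHermitian_secondMomentMatrix (Y : Ω → Vec d) : (secondMomentMatrix P Y).IsHermitian := by
  ext k l
  simp [secondMomentMatrix, mul_comm]

lemma posSemidef_secondMomentMatrix {Y : Ω → Vec d} (hY : MemLp Y 2 P) :
    (secondMomentMatrix P Y).PosSemidef := by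
  refine PosSemidef.of_dotProduct_mulVec_nonneg (isHermitian_secondMomentMatrix Y) fun x => ?_
  rw [star_trivial, dotProduct_secondMomentMatrix hY]
  positivity

/-- Cauchy–Schwarz. It limits the loss of covariance caused by removing one summand. -/
lemma posSemidef_smul_one_sub_secondMomentMatrix {Y : Ω → Vec d} (hY : MemLp Y 2 P) :
    ((∫ ω, ‖Y ω‖ ^ 2 ∂P) • (1 : Matrix (Fin d) (Fin d) ℝ) - secondMomentMatrix P Y).PosSemidef := by
  refine PosSemidef.of_dotProduct_mulVec_nonneg
    ((isHermitian_one.smul (IsSelfAdjoint.all _)).sub (isHermitian_secondMomentMatrix Y))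
    fun x => ?_
  rw [star_trivial, Matrix.sub_mulVec, dotProduct_sub, dotProduct_secondMomentMatrix hY,
    Matrix.smul_mulVec, Matrix.one_mulVec, dotProduct_smul, sub_nonneg, smul_eq_mul,
    ← integral_mul_const]
  have hx : x ⬝ᵥ x = ‖WithLp.toLp 2 x‖ ^ 2 := by
    rw [EuclideanSpace.real_norm_sq_eq, dotProduct]
    simp [sq]
  rw [hx]
  refine integral_mono_of_nonneg (ae_of_all _ fun ω => sq_nonneg _)
    (hY.integrable_norm_pow (by norm_num) |>.mul_const _) (ae_of_all _ fun ω => ?_)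
  change ⟪WithLp.toLp 2 x, Y ω⟫ ^ 2 ≤ ‖Y ω‖ ^ 2 * ‖WithLp.toLp 2 x‖ ^ 2
  rw [← mul_pow, ← sq_abs, mul_comm]
  gcongr
  exact abs_real_inner_le_norm _ _

lemma secondMomentMatrix_smul (Y : Ω → Vec d) (q : ℝ) :
    secondMomentMatrix P (fun ω => q • Y ω) = q ^ 2 • secondMomentMatrix P Y := by
  ext k l
  simp only [secondMomentMatrix, Matrix.of_apply, Matrix.smul_apply, smul_eq_mul,
    PiLp.smul_apply, ← integral_const_mul]
  congr 1
  ext ω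
  ring

lemma covarianceMatrix_eq_secondMomentMatrix {Y : Ω → Vec d} (hY : MemLp Y 2 P)
    (hmean : ∫ ω, Y ω ∂P = 0) : covarianceMatrix P Y = secondMomentMatrix P Y := by
  have h0 : ∀ k, ∫ ω, Y ω k ∂P = 0 := by
    intro k
    have := (EuclideanSpace.proj k : Vec d →L[ℝ] ℝ).integral_comp_comm
      (hY.integrable (by norm_num))
    rw [hmean, map_zero] at this
    exact this
  ext k l
  simp [covarianceMatrix, secondMomentMatrix, covariance, h0]

end GaussianCovariance

/-! ### Gaussian perimeter, and sandwiching a set between smoothed indicators. -/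

section Perimeter

variable {d : ℕ} {𝒜 : Set (Set (Vec d))} {ρ : Set (Vec d) → Vec d → ℝ} {κ : ℝ} {A : Set (Vec d)}

lemma IsAdmissibleClass.smul_mem (h : IsAdmissibleClass 𝒜 ρ κ) (hA : A ∈ 𝒜) {q : ℝ} (hq : 1 ≤ q) :
    (fun x => q • x) '' A ∈ 𝒜 := by
  rcases hq.eq_or_lt with rfl | hq
  · simpa using hA
  · exact h.scale_mem A hA q hq

/-- A translation followed by a dilation by `r⁻¹`. For `r ≤ 1` both operations preserve the class.
-/
lemma preimage_add_smul (A : Set (Vec d)) (y : Vec d) {r : ℝ} (hr : 0 < r) :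
    {w | y + r • w ∈ A} = (fun x => r⁻¹ • x) '' ((fun x => x + -y) '' A) := by
  rw [Set.image_image]
  ext w
  constructor
  · intro hw
    exact ⟨_, hw, by simp [smul_smul, hr.ne']⟩
  · rintro ⟨x, hx, rfl⟩
    change y + r • r⁻¹ • (x + -y) ∈ A
    rw [smul_smul, mul_inv_cancel₀ hr.ne', one_smul]
    simpa using hx

lemma IsAdmissibleClass.preimage_mem (h : IsAdmissibleClass 𝒜 ρ κ) (hA : A ∈ 𝒜) (y : Vec d)
    {r : ℝ} (hr : 0 < r) (hr1 : r ≤ 1) : {w | y + r • w ∈ A} ∈ 𝒜 := by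
  rw [preimage_add_smul A y hr]
  exact h.smul_mem (h.translate_mem A hA _) (one_le_inv_iff₀.2 ⟨hr, hr1⟩)

lemma IsAdmissibleClass.abs_dist_preimage_le (h : IsAdmissibleClass 𝒜 ρ κ) (hA : A ∈ 𝒜)
    (y : Vec d) {r : ℝ} (hr : 0 < r) (hr1 : r ≤ 1) (w : Vec d) :
    |ρ {w | y + r • w ∈ A} w| ≤ r⁻¹ * |ρ A (y + r • w)| := by
  have h1 := h.dist_scale _ (h.translate_mem A hA (-y)) r⁻¹ (one_le_inv_iff₀.2 ⟨hr, hr1⟩) (r • w)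
  rw [← preimage_add_smul A y hr, smul_smul, inv_mul_cancel₀ hr.ne', one_smul] at h1
  have h2 := h.dist_translate A hA (-y) (y + r • w)
  rw [show y + r • w + -y = r • w by abel] at h2
  rwa [h2] at h1

lemma classGaussPerimeter_outer_le (hγ : classGaussPerimeter 𝒜 ρ ≠ ⊤) (hA : A ∈ 𝒜) {ε : ℝ}
    (hε : 0 < ε) :
    (stdGaussian (Vec d)).real (sublevel ρ A ε \ A) ≤ (classGaussPerimeter 𝒜 ρ).toReal * ε ∧
    (stdGaussian (Vec d)).real (A \ sublevel ρ A (-ε)) ≤ (classGaussPerimeter 𝒜 ρ).toReal * ε := by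
  have h1 : gaussPerimeter ρ A ≤ classGaussPerimeter 𝒜 ρ :=
    le_iSup₂_of_le (f := fun (A : Set (Vec d)) (_ : A ∈ 𝒜) => gaussPerimeter ρ A) A hA le_rfl
  have h2 : max (stdGaussian (Vec d) (sublevel ρ A ε \ A) / ENNReal.ofReal ε)
      (stdGaussian (Vec d) (A \ sublevel ρ A (-ε)) / ENNReal.ofReal ε) ≤ gaussPerimeter ρ A :=
    le_iSup₂_of_le (f := fun (ε : ℝ) (_ : 0 < ε) =>
      max (stdGaussian (Vec d) (sublevel ρ A ε \ A) / ENNReal.ofReal ε)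
      (stdGaussian (Vec d) (A \ sublevel ρ A (-ε)) / ENNReal.ofReal ε)) ε hε le_rfl
  have key : ∀ B : Set (Vec d), stdGaussian (Vec d) B / ENNReal.ofReal ε
      ≤ classGaussPerimeter 𝒜 ρ →
      (stdGaussian (Vec d)).real B ≤ (classGaussPerimeter 𝒜 ρ).toReal * ε := by
    intro B hB
    rw [ENNReal.div_le_iff (by simpa using hε) ENNReal.ofReal_ne_top] at hB
    have := ENNReal.toReal_mono (ENNReal.mul_ne_top hγ ENNReal.ofReal_ne_top) hB
    rwa [ENNReal.toReal_mul, ENNReal.toReal_ofReal hε.le] at this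
  exact ⟨key _ ((le_max_left _ _).trans (h2.trans h1)),
    key _ ((le_max_right _ _).trans (h2.trans h1))⟩

/-- Under the affine preimage the outer layer of width ε lands in one of width at most ε/r, by (A5)
and (A6), and the preimage is again in the class. -/
lemma IsAdmissibleClass.measureReal_outer_le (h : IsAdmissibleClass 𝒜 ρ κ)
    (hγ : classGaussPerimeter 𝒜 ρ ≠ ⊤) (hA : A ∈ 𝒜) {ε r : ℝ} (hε : 0 < ε) (hr : 0 < r)
    (hr1 : r ≤ 1) (y : Vec d) :
    (stdGaussian (Vec d)).real {w | y + r • w ∈ sublevel ρ A ε \ A}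
      ≤ (classGaussPerimeter 𝒜 ρ).toReal * (ε / r) := by
  refine le_trans (measureReal_mono ?_)
    (classGaussPerimeter_outer_le hγ (h.preimage_mem hA y hr hr1) (div_pos hε hr)).1
  intro w hw
  refine ⟨?_, hw.2⟩
  have h1 := h.abs_dist_preimage_le hA y hr hr1 w
  have h2 : ρ A (y + r • w) ≤ ε := hw.1
  rw [abs_of_nonneg (h.nonneg_of_notMem A hA _ hw.2)] at h1
  change ρ {w | y + r • w ∈ A} w ≤ ε / r
  calc _ ≤ _ := le_abs_self _
    _ ≤ _ := h1
    _ ≤ r⁻¹ * ε := by gcongr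
    _ = ε / r := by rw [div_eq_inv_mul]

lemma IsAdmissibleClass.measureReal_inner_le (h : IsAdmissibleClass 𝒜 ρ κ)
    (hγ : classGaussPerimeter 𝒜 ρ ≠ ⊤) (hA : A ∈ 𝒜) {ε : ℝ} (hε : 0 < ε) (y : Vec d) :
    (stdGaussian (Vec d)).real {w | y + w ∈ A \ sublevel ρ A (-ε)}
      ≤ (classGaussPerimeter 𝒜 ρ).toReal * ε := by
  refine le_trans (measureReal_mono ?_)
    (classGaussPerimeter_outer_le hγ (h.translate_mem A hA (-y)) hε).2
  intro w hw
  refine ⟨⟨y + w, hw.1, by simp⟩, fun hw2 => hw.2 ?_⟩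
  have h2 := h.dist_translate A hA (-y) (y + w)
  rw [show y + w + -y = w by abel] at h2
  change ρ A (y + w) ≤ -ε
  rw [← h2]
  exact hw2

lemma measureReal_conv (τ μ : Measure (Vec d)) [IsProbabilityMeasure τ] [IsProbabilityMeasure μ]
    {B : Set (Vec d)} (hB : MeasurableSet B) :
    (τ ∗ μ).real B = ∫ y, μ.real {w | y + w ∈ B} ∂τ := by
  have h1 := integral_conv (μ := τ) (ν := μ) (f := B.indicator fun _ => (1 : ℝ))
    ((integrable_const (1 : ℝ)).indicator hB)
  rw [integral_indicator_const _ hB, smul_eq_mul, mul_one] at h1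
  rw [h1]
  congr 1
  ext y
  have : MeasurableSet {w | y + w ∈ B} := (measurable_const_add y) hB
  rw [← mul_one (μ.real _), ← smul_eq_mul, ← integral_indicator_const _ this]
  rfl

lemma integrable_measureReal_translate (τ μ : Measure (Vec d)) [IsProbabilityMeasure τ]
    [IsProbabilityMeasure μ] {B : Set (Vec d)} (hB : MeasurableSet B) :
    Integrable (fun y => μ.real {w | y + w ∈ B}) τ := by
  refine (integrable_const (1 : ℝ)).mono' ?_ (ae_of_all _ fun y => ?_)
  · have h1 : Measurable fun y => μ {w | y + w ∈ B} :=
      measurable_measure_prodMk_left (ν := μ) (s := {p : Vec d × Vec d | p.1 + p.2 ∈ B})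
        (measurable_add hB)
    exact h1.ennreal_toReal.aestronglyMeasurable
  · rw [Real.norm_eq_abs, abs_of_nonneg measureReal_nonneg]
    exact measureReal_le_one

lemma measureReal_conv_le {τ μ : Measure (Vec d)} [IsProbabilityMeasure τ]
    [IsProbabilityMeasure μ] {B : Set (Vec d)} (hB : MeasurableSet B) {p : ℝ}
    (hp : ∀ y, μ.real {w | y + w ∈ B} ≤ p) : (τ ∗ μ).real B ≤ p := by
  rw [measureReal_conv τ μ hB]
  refine (integral_mono (integrable_measureReal_translate τ μ hB) (integrable_const p) hp).trans ?_
  simp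

/-- Comparison of the measures of a set with those of the integrals of smoothed indicators. -/
lemma IsAdmissibleClass.abs_measureReal_sub_le (h : IsAdmissibleClass 𝒜 ρ κ) {ε : ℝ}
    (hε : 0 < ε) (μ ν : Measure (Vec d)) [IsProbabilityMeasure μ] [IsProbabilityMeasure ν]
    {e p : ℝ} (hout : ∀ A ∈ 𝒜, ν.real (sublevel ρ A ε \ A) ≤ p)
    (hin : ∀ A ∈ 𝒜, ν.real (A \ sublevel ρ A (-ε)) ≤ p)
    (hf : ∀ A ∈ 𝒜, |∫ w, smoothInd ρ A ε w ∂μ - ∫ w, smoothInd ρ A ε w ∂ν| ≤ e)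
    (hA : A ∈ 𝒜) : |μ.real A - ν.real A| ≤ e + p := by
  have hint : ∀ (m : Measure (Vec d)) [IsProbabilityMeasure m], ∀ B ∈ 𝒜,
      Integrable (smoothInd ρ B ε) m := fun m _ B hB =>
    (integrable_const (1 : ℝ)).mono'
      (h.isSmoothTest hB hε).continuous.aestronglyMeasurable
      (ae_of_all _ fun w => (h.isSmoothTest hB hε).abs_le_one _)
  have hlow : ∀ (m : Measure (Vec d)) [IsProbabilityMeasure m], ∀ B ∈ 𝒜,
      m.real B ≤ ∫ w, smoothInd ρ B ε w ∂m := by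
    intro m _ B hB
    rw [← mul_one (m.real B), ← smul_eq_mul, ← integral_indicator_const _ (h.measurableSet B hB)]
    refine integral_mono ((integrable_const _).indicator (h.measurableSet B hB)) (hint m B hB)
      fun w => ?_
    refine Set.indicator_le' (fun x hx => ?_) (fun x _ => (h.isSmoothTest hB hε).nonneg x) w
    exact (cutoff_of_nonpos hε (h.nonpos_of_mem B hB x hx)).ge
  have hup : ∀ (m : Measure (Vec d)) [IsProbabilityMeasure m], ∀ B ∈ 𝒜, ∀ D, MeasurableSet D →
      {x | ρ B x < ε} ⊆ D → ∫ w, smoothInd ρ B ε w ∂m ≤ m.real D := by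
    intro m _ B hB D hD hsub
    rw [← mul_one (m.real D), ← smul_eq_mul, ← integral_indicator_const _ hD]
    refine integral_mono (hint m B hB) ((integrable_const _).indicator hD) fun w => ?_
    refine Set.le_indicator (fun x hx => (h.isSmoothTest hB hε).le_one x) (fun x hx => ?_) w
    exact (cutoff_of_le hε (not_lt.1 fun hlt => hx (hsub hlt))).le
  have hAm := h.measurableSet A hA
  have he := (abs_nonneg _).trans (hf A hA)
  have hp := measureReal_nonneg.trans (hout A hA)
  rw [abs_le]
  constructor
  · have hsub : sublevel ρ A (-ε) ⊆ A := fun x hx => by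
      by_contra hxA
      have h1 := h.nonneg_of_notMem A hA x hxA
      have h2 : ρ A x ≤ -ε := hx
      linarith
    have h1 : ν.real A ≤ ν.real (sublevel ρ A (-ε)) + p := by
      rw [← measureReal_sdiff_add_inter (h.measurableSet_sublevel hA (-ε)),
        Set.inter_eq_right.2 hsub]
      linarith [hin A hA]
    -- For the lower bound the smaller set A^{-ε} is smoothed: by (A3) its smoothed indicator
    -- vanishes outside `A`, while `ν` loses at most `p` in passing from `A` to A^{-ε}. If A^{-ε} is
    -- empty, `A` itself has `ν`-measure at most `p`.
    rcases h.shrink_enlarge A hA ε hε with h0 | h0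
    · rw [h0, measureReal_empty] at h1
      linarith [measureReal_nonneg (μ := μ) (s := A)]
    rcases h.sublevel_mem A hA (-ε) with h2 | h2 | h2
    · have h3 := hup μ _ h2 A hAm h0
      have h4 := hlow ν _ h2
      have h5 := (abs_le.1 (hf _ h2)).1
      linarith
    · rw [h2, measureReal_empty] at h1
      linarith [measureReal_nonneg (μ := μ) (s := A)]
    · rw [h2, Set.univ_subset_iff] at hsub
      rw [hsub, probReal_univ, probReal_univ]
      linarith
  · have h1 := hlow μ A hA
    have h2 := hup ν A hA (sublevel ρ A ε) (h.measurableSet_sublevel hA ε) fun x hx => by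
      have h2 : ρ A x < ε := hx
      exact h2.le
    have h3 : ν.real (sublevel ρ A ε) ≤ ν.real A + ν.real (sublevel ρ A ε \ A) := by
      rw [← measureReal_sdiff_add_inter (s := sublevel ρ A ε) hAm]
      linarith [measureReal_mono (μ := ν) (Set.inter_subset_right : sublevel ρ A ε ∩ A ⊆ A)]
    linarith [(abs_le.1 (hf A hA)).2, hout A hA]

end Perimeter

/-! ### Probability of the boundary layer. -/

section Comparison

variable {d : ℕ} {𝒜 : Set (Set (Vec d))} {ρ : Set (Vec d) → Vec d → ℝ} {κ : ℝ} {A : Set (Vec d)}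

lemma measureReal_map_smul (μ : Measure (Vec d)) (c : ℝ) {B : Set (Vec d)} (hB : MeasurableSet B)
    (y : Vec d) : (μ.map (c • ·)).real {w | y + w ∈ B} = μ.real {w | y + c • w ∈ B} := by
  exact map_measureReal_apply (by fun_prop) ((measurable_const_add y) hB)

/-- Transfers a bound for the measures dilated by `q` back to the original ones: `y + c • w = y + (c
/ q) • (q • w)`, and `c / q ≤ 1` keeps the preimage in the class. -/
lemma IsAdmissibleClass.abs_measureReal_preimage_sub_le (h : IsAdmissibleClass 𝒜 ρ κ)
    (μ μ' : Measure (Vec d)) [IsProbabilityMeasure μ] [IsProbabilityMeasure μ'] {q δ : ℝ}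
    (hq : 1 ≤ q) (hδ0 : 0 ≤ δ)
    (hδ : ∀ A ∈ 𝒜, |(μ.map (q • ·)).real A - (μ'.map (q • ·)).real A| ≤ δ) (hA : A ∈ 𝒜) (t : ℝ)
    (y : Vec d) {c : ℝ} (hc : 0 < c) (hc1 : c ≤ 1) :
    |μ.real {w | y + c • w ∈ sublevel ρ A t} - μ'.real {w | y + c • w ∈ sublevel ρ A t}| ≤ δ := by
  have hq0 : 0 < q := by linarith
  rcases h.sublevel_mem A hA t with h1 | h1 | h1
  · have h2 := h.preimage_mem h1 y (div_pos hc hq0) ((div_le_one hq0).2 (by linarith))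
    have h3 := hδ _ h2
    have h4 := h.measurableSet _ h2
    rw [map_measureReal_apply (by fun_prop) h4, map_measureReal_apply (by fun_prop) h4] at h3
    have e : (fun x : Vec d => q • x) ⁻¹' {w | y + (c / q) • w ∈ sublevel ρ A t}
        = {w | y + c • w ∈ sublevel ρ A t} := by
      ext w
      change y + (c / q) • q • w ∈ sublevel ρ A t ↔ y + c • w ∈ sublevel ρ A t
      rw [smul_smul, div_mul_cancel₀ _ hq0.ne']
    rwa [e] at h3
  · simpa [h1] using hδ0
  · simpa [h1] using hδ0

/-- The layer lies in the difference of the sublevel sets at ε and at 0. Passing from `μ` to `μ'`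
costs δ for each of them, hence 2δ. For `μ'` the perimeter bound applies to the component of scale
`r`, which becomes `c * r` after the dilation. -/
lemma IsAdmissibleClass.measureReal_annulus_le (h : IsAdmissibleClass 𝒜 ρ κ)
    (hγ : classGaussPerimeter 𝒜 ρ ≠ ⊤) (hA : A ∈ 𝒜) (μ μ' τ τ' : Measure (Vec d))
    [IsProbabilityMeasure μ] [IsProbabilityMeasure μ'] [IsProbabilityMeasure τ]
    [IsProbabilityMeasure τ'] {r c ε δ : ℝ} (hr : 0 < r) (hr1 : r ≤ 1) (hc : 0 < c) (hc1 : c ≤ 1)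
    (hε : 0 < ε) (hμ' : μ' = τ' ∗ (stdGaussian (Vec d)).map (r • ·))
    (hδ : ∀ t y, |μ.real {w | y + c • w ∈ sublevel ρ A t}
      - μ'.real {w | y + c • w ∈ sublevel ρ A t}| ≤ δ) (x : Vec d) :
    ((μ.map (c • ·)) ∗ τ).real {w | x + w ∈ {x | 0 < ρ A x ∧ ρ A x < ε}}
      ≤ (classGaussPerimeter 𝒜 ρ).toReal * (ε / (c * r)) + 2 * δ := by
  have hUm : MeasurableSet {x | 0 < ρ A x ∧ ρ A x < ε} :=
    (h.isOpen_annulus hA hε).measurableSet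
  have hsm : ∀ t y, MeasurableSet {w : Vec d | y + c • w ∈ sublevel ρ A t} := fun t y =>
    (by fun_prop : Measurable fun w : Vec d => y + c • w) (h.measurableSet_sublevel hA t)
  have hD : MeasurableSet (sublevel ρ A ε \ A) :=
    (h.measurableSet_sublevel hA ε).diff (h.measurableSet A hA)
  rw [Measure.conv_comm]
  refine measureReal_conv_le ((measurable_const_add x) hUm) fun z => ?_
  rw [measureReal_map_smul μ c ((measurable_const_add x) hUm)]
  have e1 : {w : Vec d | z + c • w ∈ {w | x + w ∈ {x | 0 < ρ A x ∧ ρ A x < ε}}}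
      ⊆ {w | (x + z) + c • w ∈ sublevel ρ A ε} \ {w | (x + z) + c • w ∈ sublevel ρ A 0} := by
    intro w hw
    have hw1 : 0 < ρ A (x + (z + c • w)) ∧ ρ A (x + (z + c • w)) < ε := hw
    rw [← add_assoc] at hw1
    exact ⟨hw1.2.le, fun h0 => absurd hw1.1 (not_lt.2 h0)⟩
  have hsub : {w | (x + z) + c • w ∈ sublevel ρ A 0} ⊆ {w | (x + z) + c • w ∈ sublevel ρ A ε} :=
    fun w hw => by
      have h0 : ρ A ((x + z) + c • w) ≤ 0 := hw
      exact h0.trans hε.le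
  have hdiff : μ'.real {w | (x + z) + c • w ∈ sublevel ρ A ε}
      - μ'.real {w | (x + z) + c • w ∈ sublevel ρ A 0}
      ≤ (classGaussPerimeter 𝒜 ρ).toReal * (ε / (c * r)) := by
    rw [← measureReal_sdiff hsub (hsm 0 _)]
    refine (measureReal_mono (s₂ := {w | (x + z) + c • w ∈ sublevel ρ A ε \ A})
      fun w hw => ⟨hw.1, fun hA' => hw.2 (h.nonpos_of_mem A hA _ hA')⟩).trans ?_
    have hD' : MeasurableSet {w | (x + z) + c • w ∈ sublevel ρ A ε \ A} :=
      (by fun_prop : Measurable fun w : Vec d => x + z + c • w) hD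
    rw [hμ']
    refine measureReal_conv_le hD' fun v => ?_
    rw [measureReal_map_smul _ r hD']
    have e2 : {w : Vec d | v + r • w ∈ {w | (x + z) + c • w ∈ sublevel ρ A ε \ A}}
        = {w | (x + z + c • v) + (c * r) • w ∈ sublevel ρ A ε \ A} := by
      ext w
      change x + z + c • (v + r • w) ∈ sublevel ρ A ε \ A
        ↔ x + z + c • v + (c * r) • w ∈ sublevel ρ A ε \ A
      rw [smul_add, smul_smul, add_assoc (x + z)]
    rw [e2]
    exact h.measureReal_outer_le hγ hA hε (mul_pos hc hr) (mul_le_one₀ hc1 hr.le hr1) _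
  refine (measureReal_mono e1).trans ?_
  rw [measureReal_sdiff hsub (hsm 0 _)]
  linarith [(abs_le.1 (hδ ε (x + z))).2, (abs_le.1 (hδ 0 (x + z))).1]

end Comparison

/-! ### Integration of the two derivative bounds. -/

section Integration

/-- Both `F - Φ` and `F + Φ` are monotone, so `Φ'` need not be integrable. -/
lemma abs_sub_le_of_abs_deriv_le {Φ Φ' F F' : ℝ → ℝ} {a b : ℝ} (hab : a ≤ b)
    (hΦ : ∀ x ∈ Set.Icc a b, HasDerivAt Φ (Φ' x) x) (hF : ∀ x ∈ Set.Icc a b, HasDerivAt F (F' x) x)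
    (hle : ∀ x ∈ Set.Ioo a b, |Φ' x| ≤ F' x) : |Φ b - Φ a| ≤ F b - F a := by
  have hca : ContinuousOn (fun x => F x - Φ x) (Set.Icc a b) := fun x hx =>
    ((hF x hx).sub (hΦ x hx)).continuousAt.continuousWithinAt
  have hcb : ContinuousOn (fun x => F x + Φ x) (Set.Icc a b) := fun x hx =>
    ((hF x hx).add (hΦ x hx)).continuousAt.continuousWithinAt
  have h1 : MonotoneOn (fun x => F x - Φ x) (Set.Icc a b) := by
    refine monotoneOn_of_hasDerivWithinAt_nonneg (convex_Icc a b) hca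
      (f' := fun x => F' x - Φ' x) (fun x hx => ?_) fun x hx => ?_
    · exact ((hF x (interior_subset hx)).sub (hΦ x (interior_subset hx))).hasDerivWithinAt
    · rw [interior_Icc] at hx
      linarith [le_abs_self (Φ' x), hle x hx]
  have h2 : MonotoneOn (fun x => F x + Φ x) (Set.Icc a b) := by
    refine monotoneOn_of_hasDerivWithinAt_nonneg (convex_Icc a b) hcb
      (f' := fun x => F' x + Φ' x) (fun x hx => ?_) fun x hx => ?_
    · exact ((hF x (interior_subset hx)).add (hΦ x (interior_subset hx))).hasDerivWithinAt
    · rw [interior_Icc] at hx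
      linarith [neg_abs_le (Φ' x), hle x hx]
  have h3 := h1 (Set.left_mem_Icc.2 hab) (Set.right_mem_Icc.2 hab) hab
  have h4 := h2 (Set.left_mem_Icc.2 hab) (Set.right_mem_Icc.2 hab) hab
  rw [abs_le]
  constructor <;> simp only at h3 h4 <;> linarith

/-- Integration of two bounds for a derivative over a quarter of the period. -/
lemma abs_sub_le_of_abs_deriv_le_trig {Φ Φ' : ℝ → ℝ} {m a b α₀ : ℝ} (ha : 0 ≤ a) (hb : 0 ≤ b)
    (hα₀ : 0 < α₀) (hα₀' : α₀ < Real.pi / 2) (hΦ : ∀ x, HasDerivAt Φ (Φ' x) x)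
    (hsmall : ∀ x ∈ Set.Ioo 0 (Real.pi / 2), |Φ' x| ≤ m)
    (hlarge : ∀ x ∈ Set.Ioo 0 (Real.pi / 2), |Φ' x| ≤
      a * (Real.cos x ^ 2 / Real.sin x ^ 2) + b * (Real.sin x * Real.cos x ^ 2)) :
    |Φ (Real.pi / 2) - Φ 0| ≤ m * α₀ + a / α₀ + b / 3 := by
  have h1 : |Φ α₀ - Φ 0| ≤ m * α₀ - m * 0 :=
    abs_sub_le_of_abs_deriv_le (F := fun x => m * x) hα₀.le (fun x _ => hΦ x)
      (fun x _ => ((hasDerivAt_id x).const_mul m).congr_deriv (mul_one m))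
      fun x hx => hsmall x ⟨hx.1, hx.2.trans hα₀'⟩
  have hsin : ∀ x ∈ Set.Icc α₀ (Real.pi / 2), 0 < Real.sin x := fun x hx =>
    Real.sin_pos_of_pos_of_lt_pi (by linarith [hx.1]) (by linarith [hx.2, Real.pi_pos])
  have h2 := abs_sub_le_of_abs_deriv_le (Φ := Φ) (Φ' := Φ')
    -- Primitives of cot² and of sin cos². At α₀ the first one is then controlled by cot α₀ ≤ 1/α₀.
    (F := fun x => a * (-(Real.cos x / Real.sin x) - x) + b * (-(Real.cos x ^ 3 / 3)))
    (F' := fun x => a * (Real.cos x ^ 2 / Real.sin x ^ 2) + b * (Real.sin x * Real.cos x ^ 2))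
    hα₀'.le (fun x _ => hΦ x) (fun x hx => by
      have hs := hsin x hx
      refine ((((((Real.hasDerivAt_cos x).div (Real.hasDerivAt_sin x) hs.ne').neg).sub
        (hasDerivAt_id x)).const_mul a).add
        (((((Real.hasDerivAt_cos x).pow 3).div_const 3).neg).const_mul b)).congr_deriv ?_
      have := Real.sin_sq_add_cos_sq x
      field_simp
      push_cast
      ring) fun x hx => hlarge x ⟨hα₀.trans hx.1, hx.2⟩
  simp only [Real.cos_pi_div_two, Real.sin_pi_div_two] at h2
  have hs0 := hsin α₀ ⟨le_rfl, hα₀'.le⟩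
  have hc0 : 0 < Real.cos α₀ := Real.cos_pos_of_mem_Ioo ⟨by linarith, hα₀'⟩
  have hcot : Real.cos α₀ / Real.sin α₀ ≤ 1 / α₀ := by
    have := Real.lt_tan hα₀ hα₀'
    rw [Real.tan_eq_sin_div_cos] at this
    rw [← inv_div, one_div]
    exact inv_anti₀ hα₀ this.le
  have hc3 : Real.cos α₀ ^ 3 ≤ 1 := pow_le_one₀ hc0.le (Real.cos_le_one _)
  have h3 : |Φ (Real.pi / 2) - Φ 0| ≤ |Φ (Real.pi / 2) - Φ α₀| + |Φ α₀ - Φ 0| :=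
    abs_sub_le _ _ _
  have h4 : a * (Real.cos α₀ / Real.sin α₀) ≤ a * (1 / α₀) := by gcongr
  have h5 : b * Real.cos α₀ ^ 3 ≤ b * 1 := by gcongr
  have h6 : a * (α₀ - Real.pi / 2) ≤ 0 := mul_nonpos_of_nonneg_of_nonpos ha (by linarith)
  rw [div_eq_mul_one_div a]
  linarith

end Integration

/-! ### The two regimes of the angle for sums without one summand. -/

section LeaveOneOut
open Matrix
open scoped MatrixOrder

variable {d : ℕ} {𝒜 : Set (Set (Vec d))} {ρ : Set (Vec d) → Vec d → ℝ} {κ : ℝ} {A : Set (Vec d)}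
variable {Ω I : Type*} [MeasurableSpace Ω] {P : Measure Ω} [IsProbabilityMeasure P]

lemma thirdConst_nonneg : 0 ≤ thirdConst := by
  unfold thirdConst
  positivity

lemma memLp_two_of_integrable_norm_cube {Y : Ω → Vec d} (hY : Measurable Y)
    (h3 : Integrable (fun ω => ‖Y ω‖ ^ 3) P) : MemLp Y 2 P :=
  (memLp_two_iff_integrable_sq_norm hY.aestronglyMeasurable).2
    (integrable_norm_of_integrable_norm_cube hY h3).2

/-- The bound for large angles. -/
lemma IsAdmissibleClass.abs_smoothD2_leaveOneOut_sub_le [DecidableEq I]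
    (h : IsAdmissibleClass 𝒜 ρ κ) (hA : A ∈ 𝒜) {X : I → Ω → Vec d} (hX : ∀ i, Measurable (X i))
    (t : Finset I) {S T : Matrix (Fin d) (Fin d) ℝ} (hS : (S - 1).PosSemidef) {r : ℝ} (hr0 : 0 < r)
    (hr1 : r ≤ 1) (hT : (T - r ^ 2 • 1).PosSemidef) {i : I} {δ ε c s : ℝ} (hε : 0 < ε)
    (hc : 0 < c) (hs : 0 < s) (hcs : s ^ 2 + c ^ 2 = 1)
    (hδ : ∀ b y, |(P.map fun ω => ∑ j ∈ t.erase i, X j ω).real {w | y + c • w ∈ sublevel ρ A b}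
      - (multivariateGaussian 0 T).real {w | y + c • w ∈ sublevel ρ A b}| ≤ δ) (x u v : Vec d) :
    |smoothD2 (smoothIndGrad ρ A ε) (leaveOneOut P X t (multivariateGaussian 0 (S - 1)) c s i) s
        (x + u) v
      - smoothD2 (smoothIndGrad ρ A ε) (leaveOneOut P X t (multivariateGaussian 0 (S - 1)) c s i) s
        x v| ≤ thirdConst * (δ / s ^ 3 + 1 / 2 / r ^ 3) * ‖u‖ * ‖v‖ ^ 2 := by
  have hf := h.isSmoothTest hA hε
  have hRp : IsProbabilityMeasure (P.map fun ω => ∑ j ∈ t.erase i, X j ω) :=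
    Measure.isProbabilityMeasure_map (Finset.measurable_sum _ fun i _ => hX i).aemeasurable
  have hone : ∀ a : ℝ, (a ^ 2 • (1 : Matrix (Fin d) (Fin d) ℝ)).PosSemidef := fun a =>
    PosSemidef.one.smul (sq_nonneg a)
  have hT0 : T.PosSemidef := by
    have := hT.add (hone r)
    rwa [sub_add_cancel] at this
  -- The Gaussian counterpart has covariance c²T + s²S = [c²(T − r²I) + s²(S − I)] + (s² + c²r²)I.
  -- Its isotropic part has scale σ ≥ r at every angle, so its contribution does not blow up as s
  -- tends to 0.
  have hσ2 : r ^ 2 ≤ s ^ 2 + c ^ 2 * r ^ 2 := by nlinarith [sq_nonneg s, pow_le_one₀ hr0.le hr1 (n := 2)]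
  set σ := √(s ^ 2 + c ^ 2 * r ^ 2) with hσdef
  have hσsq : σ ^ 2 = s ^ 2 + c ^ 2 * r ^ 2 := Real.sq_sqrt (by positivity)
  have hσ0 : 0 < σ := Real.sqrt_pos.2 (by positivity)
  have hrσ : r ≤ σ := Real.le_sqrt_of_sq_le hσ2
  unfold leaveOneOut
  have key := hf.abs_smoothD2_sub_le_of_integral_le
    ((P.map fun ω => ∑ j ∈ t.erase i, X j ω).map (c • ·)) ((multivariateGaussian 0 T).map (c • ·))
    ((multivariateGaussian 0 (S - 1)).map (s • ·))
    (multivariateGaussian 0 (c ^ 2 • (T - r ^ 2 • 1) + s ^ 2 • (S - 1)))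
    hs hσ0 (δ := δ) (fun y => h.abs_integral_smoothInd_sub_le hA hε _ _ y fun b => by
      rw [measureReal_map_smul _ c (h.measurableSet_sublevel hA b),
        measureReal_map_smul _ c (h.measurableSet_sublevel hA b)]
      exact hδ b y) (by
      rw [multivariateGaussian_map_smul hT0, multivariateGaussian_map_smul hS, stdGaussian_map_smul,
        stdGaussian_map_smul, multivariateGaussian_conv (hT0.smul (sq_nonneg c))
        (hS.smul (sq_nonneg s)), multivariateGaussian_conv
        ((hT0.smul (sq_nonneg c)).add (hS.smul (sq_nonneg s))) (hone s),
        multivariateGaussian_conv ((hT.smul (sq_nonneg c)).add (hS.smul (sq_nonneg s))) (hone σ),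
        hσsq]
      congr 1
      module) x u v
  refine key.trans ?_
  have := thirdConst_nonneg
  gcongr

/-- The bound for small angles. -/
lemma IsAdmissibleClass.abs_smoothD2_leaveOneOut_sub_le_of_perimeter [DecidableEq I]
    (h : IsAdmissibleClass 𝒜 ρ κ) (hγ : classGaussPerimeter 𝒜 ρ ≠ ⊤) (hA : A ∈ 𝒜)
    {X : I → Ω → Vec d} (hX : ∀ i, Measurable (X i))
    (t : Finset I) {S T : Matrix (Fin d) (Fin d) ℝ} {r : ℝ} (hr0 : 0 < r)
    (hr1 : r ≤ 1) (hT : (T - r ^ 2 • 1).PosSemidef) {i : I} {δ ε c s : ℝ} (hε : 0 < ε)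
    (hc : 0 < c) (hc1 : c ≤ 1) (hs : 0 < s)
    (hδ : ∀ b y, |(P.map fun ω => ∑ j ∈ t.erase i, X j ω).real {w | y + c • w ∈ sublevel ρ A b}
      - (multivariateGaussian 0 T).real {w | y + c • w ∈ sublevel ρ A b}| ≤ δ) (x u v : Vec d) :
    |smoothD2 (smoothIndGrad ρ A ε) (leaveOneOut P X t (multivariateGaussian 0 (S - 1)) c s i) s
        (x + u) v
      - smoothD2 (smoothIndGrad ρ A ε) (leaveOneOut P X t (multivariateGaussian 0 (S - 1)) c s i) s
        x v| ≤ 4 * (1 + κ) / ε ^ 2 * √(2 / Real.pi)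
          * ((classGaussPerimeter 𝒜 ρ).toReal * (ε / (c * r)) + 2 * δ) / s * ‖u‖ * ‖v‖ ^ 2 := by
  have hκ := h.curvature_nonneg
  have hRp : IsProbabilityMeasure (P.map fun ω => ∑ j ∈ t.erase i, X j ω) :=
    Measure.isProbabilityMeasure_map (Finset.measurable_sum _ fun i _ => hX i).aemeasurable
  refine (h.isSmoothTest hA hε).abs_smoothD2_sub_le_of_measure_le (by positivity) _ hs
    (fun y => ?_) x u v
  unfold leaveOneOut
  -- Since T ≥ r²I, the measure N(0,T) has an isotropic component of scale `r`, to which the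
  -- perimeter bound applies.
  exact h.measureReal_annulus_le hγ hA _ (multivariateGaussian 0 T) _
    (multivariateGaussian 0 (T - r ^ 2 • 1)) hr0 hr1 hc hc1 hε (by
      rw [stdGaussian_map_smul, multivariateGaussian_conv hT (PosSemidef.one.smul (sq_nonneg r)),
        sub_add_cancel]) hδ y

/-- Comparison of the expectations of a smoothed indicator, given a bound for the sums without
one summand. -/
lemma IsAdmissibleClass.abs_integral_smoothInd_sum_sub_le [DecidableEq I]
    (h : IsAdmissibleClass 𝒜 ρ κ) (hγ : classGaussPerimeter 𝒜 ρ ≠ ⊤) (hA : A ∈ 𝒜)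
    {X : I → Ω → Vec d} (hX : ∀ i, Measurable (X i)) (hindep : iIndepFun X P) (t : Finset I)
    (h3 : ∀ i ∈ t, Integrable (fun ω => ‖X i ω‖ ^ 3) P) (hmean : ∀ i ∈ t, ∫ ω, X i ω ∂P = 0)
    (hS : (∑ i ∈ t, secondMomentMatrix P (X i) - 1).PosSemidef) {r : ℝ} (hr0 : 0 < r)
    (hr1 : r ≤ 1)
    (hT : ∀ i ∈ t, (∑ j ∈ t.erase i, secondMomentMatrix P (X j) - r ^ 2 • 1).PosSemidef)
    {δ ε α₀ : ℝ} (hε : 0 < ε) (hδ0 : 0 ≤ δ) (hα₀ : 0 < α₀) (hα₀' : α₀ < Real.pi / 2)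
    (hδ : ∀ i ∈ t, ∀ b y, ∀ c : ℝ, 0 < c → c ≤ 1 →
      |(P.map fun ω => ∑ j ∈ t.erase i, X j ω).real {w | y + c • w ∈ sublevel ρ A b}
        - (multivariateGaussian 0 (∑ j ∈ t.erase i, secondMomentMatrix P (X j))).real
          {w | y + c • w ∈ sublevel ρ A b}| ≤ δ) {β : ℝ}
    (hβ : ∑ i ∈ t, ∫ ω, ‖X i ω‖ ^ 3 ∂P = β) :
    |∫ w, smoothInd ρ A ε w ∂(P.map fun ω => ∑ i ∈ t, X i ω)
      - ∫ w, smoothInd ρ A ε w ∂(multivariateGaussian 0 (∑ i ∈ t, secondMomentMatrix P (X i)))| ≤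
      3 / 2 * β * (4 * (1 + κ) / ε ^ 2 * √(2 / Real.pi)
        * ((classGaussPerimeter 𝒜 ρ).toReal * (ε / r) + 2 * δ)) * α₀
      + 3 / 2 * β * thirdConst * δ / α₀ + 3 / 2 * β * thirdConst * (1 / 2 / r ^ 3) / 3 := by
  have hκ := h.curvature_nonneg
  have hC := thirdConst_nonneg
  have hf := h.isSmoothTest hA hε
  have hW : Measurable fun ω => ∑ i ∈ t, X i ω := Finset.measurable_sum _ fun i _ => hX i
  have hWi : Integrable (fun ω => ∑ i ∈ t, X i ω) P :=
    integrable_finsetSum _ fun i hi => integrable_of_integrable_norm_cube (hX i) (h3 i hi)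
  have hβ0 : 0 ≤ β := by
    rw [← hβ]
    positivity
  set S := ∑ i ∈ t, secondMomentMatrix P (X i) with hSdef
  set γ := (classGaussPerimeter 𝒜 ρ).toReal with hγdef
  have hγ0 : 0 ≤ γ := ENNReal.toReal_nonneg
  have hS0 : S.PosSemidef := by
    have := hS.add PosSemidef.one
    rwa [sub_add_cancel] at this
  have hν : Integrable (fun g : Vec d => g) (multivariateGaussian 0 S) :=
    IsGaussian.integrable_id
  have hν₀ : multivariateGaussian 0 S
      = multivariateGaussian 0 (S - 1) ∗ stdGaussian (Vec d) := by
    rw [← multivariateGaussian_zero_one, multivariateGaussian_conv hS PosSemidef.one,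
      sub_add_cancel]
  have hbound : ∀ s c B : ℝ, 0 < s → 0 < c → 0 ≤ B →
      (∀ i ∈ t, ∀ x u v, |smoothD2 (smoothIndGrad ρ A ε)
          (leaveOneOut P X t (multivariateGaussian 0 (S - 1)) c s i) s (x + u) v
        - smoothD2 (smoothIndGrad ρ A ε)
          (leaveOneOut P X t (multivariateGaussian 0 (S - 1)) c s i) s x v|
        ≤ B * ‖u‖ * ‖v‖ ^ 2) → _ := fun s c B hs hc hB0 hB =>
    hf.abs_deriv_interp_le hX hindep t h3 hmean _ _ hν
      (toEuclideanCLM (𝕜 := ℝ) (CFC.sqrt S)) multivariateGaussian_zero_eq_map hν₀ (fun k l => by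
        rw [sum_sqrt_apply_basisFun hS0, hSdef, Matrix.sum_apply]
        rfl) hs hc.le hB0 hB
  have hpos : ∀ x ∈ Set.Ioo 0 (Real.pi / 2), 0 < Real.sin x ∧ 0 < Real.cos x := fun x hx =>
    ⟨Real.sin_pos_of_pos_of_lt_pi hx.1 (by linarith [hx.2, Real.pi_pos]),
      Real.cos_pos_of_mem_Ioo ⟨by linarith [hx.1, Real.pi_pos], hx.2⟩⟩
  have main := abs_sub_le_of_abs_deriv_le_trig
    (m := 3 / 2 * β * (4 * (1 + κ) / ε ^ 2 * √(2 / Real.pi) * (γ * (ε / r) + 2 * δ)))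
    (a := 3 / 2 * β * thirdConst * δ) (b := 3 / 2 * β * thirdConst * (1 / 2 / r ^ 3))
    (by positivity) (by positivity) hα₀ hα₀'
    (hf.hasDerivAt_interp (multivariateGaussian 0 S) hν hW hWi)
    (fun x hx => by
      obtain ⟨hs, hc⟩ := hpos x hx
      have hc1 := Real.cos_le_one x
      refine (hbound _ _ _ hs hc (by positivity) fun i hi =>
        h.abs_smoothD2_leaveOneOut_sub_le_of_perimeter hγ hA hX t hr0 hr1 (hT i hi) hε hc
          hc1 hs fun b y => hδ i hi b y _ hc hc1).trans ?_
      rw [hβ]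
      -- The prefactor sin x cos² x cancels both the 1/sin x of the smoothing and the 1/cos x of the
      -- layer, so the bound is uniform in the angle.
      have e : 3 / 2 * (Real.sin x * Real.cos x ^ 2) * (4 * (1 + κ) / ε ^ 2 * √(2 / Real.pi)
          * (γ * (ε / (Real.cos x * r)) + 2 * δ) / Real.sin x) * β
          = 3 / 2 * β * (4 * (1 + κ) / ε ^ 2 * √(2 / Real.pi)
            * (Real.cos x * (γ * (ε / r)) + Real.cos x ^ 2 * (2 * δ))) := by
        field_simp
      rw [e]
      have hc2 : Real.cos x ^ 2 ≤ 1 := pow_le_one₀ hc.le hc1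
      exact mul_le_mul_of_nonneg_left (mul_le_mul_of_nonneg_left
        (add_le_add (mul_le_of_le_one_left (by positivity) hc1)
          (mul_le_of_le_one_left (by positivity) hc2)) (by positivity)) (by positivity))
    (fun x hx => by
      obtain ⟨hs, hc⟩ := hpos x hx
      refine (hbound _ _ _ hs hc (by positivity) fun i hi =>
        h.abs_smoothD2_leaveOneOut_sub_le hA hX t hS hr0 hr1 (hT i hi) hε hc hs
          (Real.sin_sq_add_cos_sq x) fun b y =>
            hδ i hi b y _ hc (Real.cos_le_one x)).trans (le_of_eq ?_)
      rw [hβ]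
      field_simp)
  have e1 : interp P (multivariateGaussian 0 S) (smoothInd ρ A ε) (fun ω => ∑ i ∈ t, X i ω) 0
      = ∫ w, smoothInd ρ A ε w ∂(P.map fun ω => ∑ i ∈ t, X i ω) := by
    rw [integral_map hW.aemeasurable hf.continuous.aestronglyMeasurable]
    simp only [interp, Real.cos_zero, Real.sin_zero, one_smul, zero_smul, add_zero]
    rw [integral_fun_fst (fun ω => smoothInd ρ A ε (∑ i ∈ t, X i ω))]
    simp
  have e2 : interp P (multivariateGaussian 0 S) (smoothInd ρ A ε) (fun ω => ∑ i ∈ t, X i ω)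
      (Real.pi / 2) = ∫ w, smoothInd ρ A ε w ∂(multivariateGaussian 0 S) := by
    simp only [interp, Real.cos_pi_div_two, Real.sin_pi_div_two, one_smul, zero_smul, zero_add]
    rw [integral_fun_snd]
    simp
  rw [e1, e2, abs_sub_comm] at main
  exact main

end LeaveOneOut

/-! ### Numerical constants. -/

section Constants

lemma sqrt_two_div_pi_le : √(2 / Real.pi) ≤ 0.798 := by
  refine Real.sqrt_le_iff.2 ⟨by norm_num, ?_⟩
  rw [div_le_iff₀ Real.pi_pos]
  nlinarith [Real.pi_gt_d4]

lemma thirdConst_le : thirdConst ≤ 2.007 := by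
  have hpi := Real.pi_pos
  have h1 : √(2 / Real.pi) * √(2 * Real.pi) = 2 := by
    rw [← Real.sqrt_mul (by positivity), show 2 / Real.pi * (2 * Real.pi) = 2 ^ 2 by field_simp]
    exact Real.sqrt_sq (by norm_num)
  have h2 : √(2 * Real.pi) ^ 2 = 2 * Real.pi := Real.sq_sqrt (by positivity)
  have h3 : 0 < √(2 * Real.pi) := by positivity
  have h4 : √3 ≤ 1.73206 := Real.sqrt_le_iff.2 ⟨by norm_num, by norm_num⟩
  have h5 : Real.exp (-(1 / 2)) ≤ 0.60654 := by
    have h6 : Real.exp (-(1 / 2)) ^ 2 * Real.exp 1 = 1 := by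
      rw [← Real.exp_nat_mul, ← Real.exp_add]
      norm_num
    have h7 := Real.exp_one_gt_d9
    by_contra! hlt
    have h8 : (0.60654 : ℝ) ^ 2 ≤ Real.exp (-(1 / 2)) ^ 2 := by gcongr
    nlinarith
  have h9 : thirdConst = 6 * √3 * Real.exp (-(1 / 2)) / Real.pi := by
    have e : √(2 / Real.pi) = 2 / √(2 * Real.pi) := by
      rw [eq_div_iff h3.ne', h1]
    rw [thirdConst, e]
    calc _ = 12 * √3 * Real.exp (-(1 / 2)) / √(2 * Real.pi) ^ 2 := by
          field_simp
          norm_num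
      _ = _ := by
        rw [h2]
        field_simp
        norm_num
  rw [h9, div_le_iff₀ hpi]
  calc 6 * √3 * Real.exp (-(1 / 2)) ≤ 6 * 1.73206 * 0.60654 := by gcongr
    _ ≤ 2.007 * 3.1415 := by norm_num
    _ ≤ 2.007 * Real.pi := by
      gcongr
      exact Real.pi_gt_d4.le

/-- The choice of the smoothing parameters closes the induction. -/
lemma constants_close {γ k β K r : ℝ} (hγ : 0 ≤ γ) (hk : 0 < k) (hβ : 0 < β)
    (hK27 : 27 ≤ K) (hK50 : 1 + 50 * (γ * k) ≤ K) (hr0 : 0 < r) (hr : r ^ 2 = 8 / 9) :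
    3 / 2 * β * (4 * k ^ 2 / (22.8 * β * k) ^ 2 * √(2 / Real.pi)
        * (γ * (22.8 * β * k / r) + 2 * (1.01 * K * β))) * (12.768 * β)
      + 3 / 2 * β * thirdConst * (1.01 * K * β) / (12.768 * β)
      + 3 / 2 * β * thirdConst * (1 / 2 / r ^ 3) / 3 + γ * (22.8 * β * k) ≤ K * β := by
  have hh := sqrt_two_div_pi_le
  have hC := thirdConst_le
  have hC0 := thirdConst_nonneg
  have hr1 : 0.9428 ≤ r := by nlinarith
  have hri : 1 / r ≤ 1.061 := by
    rw [div_le_iff₀ hr0]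
    linarith
  have hr3 : 1 / r ^ 3 ≤ 1.194 := by
    rw [div_le_iff₀ (by positivity), pow_succ, hr]
    linarith
  have hx : 0 ≤ γ * k := by positivity
  -- The parameters are ε = 22.8 βk and α₀ = 0.56 · 22.8 β = 12.768 β, so β factors out of the whole
  -- expression.
  have e : 3 / 2 * β * (4 * k ^ 2 / (22.8 * β * k) ^ 2 * √(2 / Real.pi)
        * (γ * (22.8 * β * k / r) + 2 * (1.01 * K * β))) * (12.768 * β)
      + 3 / 2 * β * thirdConst * (1.01 * K * β) / (12.768 * β)
      + 3 / 2 * β * thirdConst * (1 / 2 / r ^ 3) / 3 + γ * (22.8 * β * k)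
      = β * ((γ * k) * (22.8 + 3.36 * √(2 / Real.pi) * (1 / r))
        + K * (1.01 / 22.8) * (6.72 * √(2 / Real.pi) + 1.5 / 0.56 * thirdConst)
        + 0.25 * thirdConst * (1 / r ^ 3)) := by
    field_simp
    ring
  rw [e, mul_comm K β]
  refine mul_le_mul_of_nonneg_left ?_ hβ.le
  calc _ ≤ (γ * k) * (22.8 + 3.36 * 0.798 * 1.061)
        + K * (1.01 / 22.8) * (6.72 * 0.798 + 1.5 / 0.56 * 2.007) + 0.25 * 2.007 * 1.194 := by
        gcongr
    -- What remains is roughly 25.65 γk + 0.6 ≤ 0.524 K. It follows from a convex combination of the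
    -- two lower bounds for K, with most of the weight on 1 + 50 γk and a little on 27.
    _ ≤ K := by
      norm_num
      linarith

/-- Here v and τ stand for the second and third absolute moments of the removed summand. The
dilation by 1/√(1−v) is costly only if v is not small, but then τ, which is lost from β, is not
small either. -/
lemma leaveOneOut_moment_le {v τ β : ℝ} (hv : 0 ≤ v) (hτ : √v ^ 3 ≤ τ) (hτβ : τ ≤ β)
    (hβ : β < 1 / 27) :
    v ≤ 1 / 9 ∧ (√(1 - v))⁻¹ ^ 3 * (β - τ) ≤ 1.01 * β := by
  set σ := √v
  have hσ0 : 0 ≤ σ := Real.sqrt_nonneg v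
  have hσv : σ ^ 2 = v := Real.sq_sqrt hv
  have hσ : σ ≤ 1 / 3 := by
    by_contra! hlt
    have : (1 / 3 : ℝ) ^ 3 < σ ^ 3 := by gcongr
    linarith
  have hv9 : v ≤ 1 / 9 := by nlinarith
  refine ⟨hv9, ?_⟩
  have hp : 0 < √(1 - v) := Real.sqrt_pos.2 (by linarith)
  have hp2 : √(1 - v) ^ 2 = 1 - v := Real.sq_sqrt (by linarith)
  set p := √(1 - v)
  have hp1 : p ≤ 1 := by nlinarith
  -- The difference of the two sides is (p − 1)²(p + 1/2).
  have hp3 : 1 - 3 / 2 * v ≤ p ^ 3 := by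
    nlinarith [mul_nonneg (sq_nonneg (p - 1)) (by positivity : 0 ≤ p + 1 / 2)]
  have hβ0 : 0 ≤ β := (by positivity : 0 ≤ σ ^ 3).trans (hτ.trans hτβ)
  rw [inv_pow, inv_mul_le_iff₀ (by positivity)]
  -- For σ ≥ 0 this cubic is smallest near σ = 0.037, where it is still positive. Multiplied by 27β,
  -- it gives `h2` after σ³ is bounded below by 27βσ³; note 1.515 = 1.01 · 3/2.
  have h1 : 0 ≤ 0.01 / 27 + σ ^ 3 - 1.515 / 27 * σ ^ 2 := by
    nlinarith [mul_nonneg (sq_nonneg (σ - 0.04)) hσ0, sq_nonneg (σ - 0.04)]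
  have h2 : β - σ ^ 3 ≤ (1 - 3 / 2 * v) * (1.01 * β) := by
    rw [← hσv]
    nlinarith [mul_nonneg (by linarith : 0 ≤ 1 - 27 * β) (by positivity : 0 ≤ σ ^ 3),
      mul_nonneg hβ0 h1]
  have h3 : (1 - 3 / 2 * v) * (1.01 * β) ≤ p ^ 3 * (1.01 * β) := by gcongr
  linarith

end Constants

/-! ### Induction over finite sums. -/

section FiniteSum
open Matrix

variable {d : ℕ} {𝒜 : Set (Set (Vec d))} {ρ : Set (Vec d) → Vec d → ℝ} {κ : ℝ} {A : Set (Vec d)}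
variable {Ω I : Type*} [MeasurableSpace Ω] {P : Measure Ω} [IsProbabilityMeasure P]

/-- Integrate (x − σ)²(x + σ/2) ≥ 0, that is, x³ ≥ (3/2)σx² − σ³/2, at x = ‖Y‖. -/
lemma sqrt_integral_sq_pow_three_le {Y : Ω → Vec d} (hY : Measurable Y)
    (h3 : Integrable (fun ω => ‖Y ω‖ ^ 3) P) :
    √(∫ ω, ‖Y ω‖ ^ 2 ∂P) ^ 3 ≤ ∫ ω, ‖Y ω‖ ^ 3 ∂P := by
  have h2 := (integrable_norm_of_integrable_norm_cube hY h3).2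
  set σ := √(∫ ω, ‖Y ω‖ ^ 2 ∂P) with hσ
  have hσ0 : 0 ≤ σ := Real.sqrt_nonneg _
  have hσ2 : σ ^ 2 = ∫ ω, ‖Y ω‖ ^ 2 ∂P := Real.sq_sqrt (by positivity)
  have h4 : ∫ ω, (3 / 2 * σ * ‖Y ω‖ ^ 2 - 1 / 2 * σ ^ 3) ∂P ≤ ∫ ω, ‖Y ω‖ ^ 3 ∂P := by
    refine integral_mono ((h2.const_mul _).sub (integrable_const _)) h3 fun ω => ?_
    have := mul_nonneg (sq_nonneg (‖Y ω‖ - σ)) (by positivity : 0 ≤ ‖Y ω‖ + σ / 2)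
    simp only
    nlinarith
  rw [integral_sub (h2.const_mul _) (integrable_const _), integral_const_mul, ← hσ2] at h4
  simp only [integral_const, probReal_univ, one_smul] at h4
  nlinarith

lemma abs_measureReal_sub_le_one {E : Type*} [MeasurableSpace E] (μ ν : Measure E)
    [IsProbabilityMeasure μ] [IsProbabilityMeasure ν] (B : Set E) : |μ.real B - ν.real B| ≤ 1 := by
  have h1 : μ.real B ≤ 1 := measureReal_le_one
  have h2 : ν.real B ≤ 1 := measureReal_le_one
  rw [abs_le]
  constructor <;>
  linarith [measureReal_nonneg (μ := μ) (s := B), measureReal_nonneg (μ := ν) (s := B)]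

lemma measure_eq_of_subsingleton {E : Type*} [MeasurableSpace E] [Subsingleton E]
    (μ ν : Measure E) [IsProbabilityMeasure μ] [IsProbabilityMeasure ν] : μ = ν := by
  refine Measure.ext fun B _ => ?_
  rcases B.eq_empty_or_nonempty with rfl | hB
  · simp
  · rw [hB.eq_univ, measure_univ, measure_univ]

lemma secondMomentMatrix_eq_zero {Y : Ω → Vec d} (h3 : Integrable (fun ω => ‖Y ω‖ ^ 3) P)
    (h0 : ∫ ω, ‖Y ω‖ ^ 3 ∂P = 0) : secondMomentMatrix P Y = 0 := by
  have h4 := (integral_eq_zero_iff_of_nonneg (fun ω => by positivity) h3).1 h0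
  ext k l
  rw [secondMomentMatrix, Matrix.of_apply, Matrix.zero_apply]
  refine integral_eq_zero_of_ae ?_
  filter_upwards [h4] with ω hω
  have h5 : ‖Y ω‖ ^ 3 = 0 := hω
  rw [pow_eq_zero_iff (by norm_num), norm_eq_zero] at h5
  simp [h5]

lemma sum_integral_norm_cube_pos (hd : 0 < d) {X : I → Ω → Vec d} (t : Finset I) (h3 : ∀ i ∈ t, Integrable (fun ω => ‖X i ω‖ ^ 3) P)
    (hS : (∑ i ∈ t, secondMomentMatrix P (X i) - 1).PosSemidef) :
    0 < ∑ i ∈ t, ∫ ω, ‖X i ω‖ ^ 3 ∂P := by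
  refine lt_of_le_of_ne (by positivity) fun h0 => ?_
  have h1 := (Finset.sum_eq_zero_iff_of_nonneg fun i _ =>
    (by positivity : 0 ≤ ∫ ω, ‖X i ω‖ ^ 3 ∂P)).1 h0.symm
  have h2 : ∀ i ∈ t, secondMomentMatrix P (X i) = 0 := fun i hi =>
    secondMomentMatrix_eq_zero (h3 i hi) (h1 i hi)
  rw [Finset.sum_eq_zero h2, zero_sub] at hS
  have h6 := hS.diag_nonneg (i := ⟨0, hd⟩)
  simp at h6
  linarith

lemma posSemidef_sum_erase_sub [DecidableEq I] {X : I → Ω → Vec d} {t : Finset I} {i : I}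
    (hi : i ∈ t) (hL2 : MemLp (X i) 2 P)
    (hS : (∑ i ∈ t, secondMomentMatrix P (X i) - 1).PosSemidef) :
    (∑ j ∈ t.erase i, secondMomentMatrix P (X j)
      - (1 - ∫ ω, ‖X i ω‖ ^ 2 ∂P) • (1 : Matrix (Fin d) (Fin d) ℝ)).PosSemidef := by
  have h4 := hS.add (posSemidef_smul_one_sub_secondMomentMatrix hL2)
  rw [← Finset.add_sum_erase t _ hi] at h4
  convert h4 using 1
  module

/-- Rescaling a bound for the sum without one summand. -/
lemma IsAdmissibleClass.abs_measureReal_sum_erase_sub_le [DecidableEq I]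
    (h : IsAdmissibleClass 𝒜 ρ κ) {K : ℝ} (hK : 0 ≤ K) {X : I → Ω → Vec d}
    (hX : ∀ i, Measurable (X i)) (hindep : iIndepFun X P) {t : Finset I}
    (h3 : ∀ i ∈ t, Integrable (fun ω => ‖X i ω‖ ^ 3) P) (hmean : ∀ i ∈ t, ∫ ω, X i ω ∂P = 0)
    (hS : (∑ i ∈ t, secondMomentMatrix P (X i) - 1).PosSemidef) {i : I} (hi : i ∈ t)
    (ih : ∀ X : I → Ω → Vec d, (∀ i, Measurable (X i)) → iIndepFun X P →
      (∀ j ∈ t.erase i, Integrable (fun ω => ‖X j ω‖ ^ 3) P) →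
      (∀ j ∈ t.erase i, ∫ ω, X j ω ∂P = 0) →
      (∑ j ∈ t.erase i, secondMomentMatrix P (X j) - 1).PosSemidef → ∀ A ∈ 𝒜,
      |(P.map fun ω => ∑ j ∈ t.erase i, X j ω).real A
        - (multivariateGaussian 0 (∑ j ∈ t.erase i, secondMomentMatrix P (X j))).real A|
        ≤ K * ∑ j ∈ t.erase i, ∫ ω, ‖X j ω‖ ^ 3 ∂P)
    {β : ℝ} (hβ : ∑ i ∈ t, ∫ ω, ‖X i ω‖ ^ 3 ∂P = β) (hβ27 : β < 1 / 27) {B : Set (Vec d)}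
    (hB : B ∈ 𝒜) (b : ℝ) (y : Vec d) {c : ℝ} (hc : 0 < c) (hc1 : c ≤ 1) :
    |(P.map fun ω => ∑ j ∈ t.erase i, X j ω).real {w | y + c • w ∈ sublevel ρ B b}
      - (multivariateGaussian 0 (∑ j ∈ t.erase i, secondMomentMatrix P (X j))).real
        {w | y + c • w ∈ sublevel ρ B b}| ≤ 1.01 * K * β := by
  have hβ0 : 0 ≤ β := by
    rw [← hβ]
    positivity
  have hL2 : ∀ i ∈ t, MemLp (X i) 2 P := fun i hi =>
    memLp_two_of_integrable_norm_cube (hX i) (h3 i hi)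
  have hτ : ∑ j ∈ t.erase i, ∫ ω, ‖X j ω‖ ^ 3 ∂P = β - ∫ ω, ‖X i ω‖ ^ 3 ∂P := by
    rw [← hβ, ← Finset.add_sum_erase t _ hi]
    ring
  obtain ⟨hv, hmom⟩ := leaveOneOut_moment_le (by positivity : 0 ≤ ∫ ω, ‖X i ω‖ ^ 2 ∂P)
    (sqrt_integral_sq_pow_three_le (hX i) (h3 i hi))
    ((Finset.single_le_sum (f := fun i => ∫ ω, ‖X i ω‖ ^ 3 ∂P)
      (fun j _ => by positivity) hi).trans_eq hβ) hβ27
  have hPSD := posSemidef_sum_erase_sub hi (hL2 i hi) hS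
  have hRm : Measurable fun ω => ∑ j ∈ t.erase i, X j ω :=
    Finset.measurable_sum _ fun i _ => hX i
  have hRp : IsProbabilityMeasure (P.map fun ω => ∑ j ∈ t.erase i, X j ω) :=
    Measure.isProbabilityMeasure_map hRm.aemeasurable
  have hTp : (∑ j ∈ t.erase i, secondMomentMatrix P (X j)).PosSemidef :=
    posSemidef_sum _ fun j hj => posSemidef_secondMomentMatrix (hL2 j (Finset.mem_of_mem_erase hj))
  have hv0 : 0 ≤ ∫ ω, ‖X i ω‖ ^ 2 ∂P := by positivity
  set v := ∫ ω, ‖X i ω‖ ^ 2 ∂P with hvdef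
  -- The dilation that turns the lower bound (1 − v)I for the remaining covariance into I. Third
  -- moments are multiplied by q³.
  set q := (√(1 - v))⁻¹ with hqdef
  have hp0 : 0 < √(1 - v) := Real.sqrt_pos.2 (by linarith)
  have hq0 : 0 < q := inv_pos.2 hp0
  have hq1 : 1 ≤ q := (one_le_inv₀ hp0).2 (Real.sqrt_le_one.2 (by linarith))
  have hq2 : q ^ 2 * (1 - v) = 1 := by
    rw [hqdef, inv_pow, Real.sq_sqrt (by linarith)]
    exact inv_mul_cancel₀ (by linarith)
  have hcube : ∀ j, ∀ ω, ‖q • X j ω‖ ^ 3 = q ^ 3 * ‖X j ω‖ ^ 3 := fun j ω => by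
    rw [norm_smul, Real.norm_of_nonneg hq0.le, mul_pow]
  have key := ih (fun j ω => q • X j ω)
    (fun j => (hX j).const_smul q)
    (hindep.comp (fun _ x => q • x) fun _ => measurable_const_smul q)
    (fun j hj => by
      simp_rw [hcube]
      exact (h3 j (Finset.mem_of_mem_erase hj)).const_mul _)
    (fun j hj => by rw [integral_smul, hmean j (Finset.mem_of_mem_erase hj), smul_zero])
    (by
      simp_rw [secondMomentMatrix_smul]
      rw [← Finset.smul_sum]
      have h4 := hPSD.smul (sq_nonneg q)
      rwa [smul_sub, smul_smul, hq2, one_smul] at h4)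
  simp_rw [secondMomentMatrix_smul, hcube, integral_const_mul] at key
  rw [← Finset.smul_sum, ← Finset.mul_sum, hτ, ← multivariateGaussian_map_smul hTp] at key
  have e : (P.map fun ω => ∑ j ∈ t.erase i, q • X j ω)
      = (P.map fun ω => ∑ j ∈ t.erase i, X j ω).map (q • ·) := by
    rw [Measure.map_map (by fun_prop) hRm]
    congr 1
    ext ω
    simp [Finset.smul_sum]
  rw [e] at key
  have hKq : K * (q ^ 3 * (β - ∫ ω, ‖X i ω‖ ^ 3 ∂P)) ≤ 1.01 * K * β := by
    have := mul_le_mul_of_nonneg_left hmom (by linarith : 0 ≤ K)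
    linarith
  have hkey : ∀ B ∈ 𝒜, |((P.map fun ω => ∑ j ∈ t.erase i, X j ω).map (q • ·)).real B
      - ((multivariateGaussian 0 (∑ j ∈ t.erase i, secondMomentMatrix P (X j))).map
        (q • ·)).real B| ≤ 1.01 * K * β := fun B hB => (key B hB).trans hKq
  clear key
  have hδ0 : 0 ≤ 1.01 * K * β := by positivity
  exact h.abs_measureReal_preimage_sub_le (P.map fun ω => ∑ j ∈ t.erase i, X j ω)
    (multivariateGaussian 0 (∑ j ∈ t.erase i, secondMomentMatrix P (X j))) hq1 hδ0
    hkey hB b y hc hc1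

/-- The Berry-Esseen bound for finite sums whose covariance matrix dominates the identity. -/
theorem IsAdmissibleClass.abs_measureReal_sum_sub_le [DecidableEq I]
    (h : IsAdmissibleClass 𝒜 ρ κ) (hγ : classGaussPerimeter 𝒜 ρ ≠ ⊤) {K : ℝ} (hK27 : 27 ≤ K)
    (hK50 : 1 + 50 * ((classGaussPerimeter 𝒜 ρ).toReal * √(1 + κ)) ≤ K)
    (t : Finset I) : ∀ X : I → Ω → Vec d, (∀ i, Measurable (X i)) → iIndepFun X P →
      (∀ i ∈ t, Integrable (fun ω => ‖X i ω‖ ^ 3) P) → (∀ i ∈ t, ∫ ω, X i ω ∂P = 0) →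
      (∑ i ∈ t, secondMomentMatrix P (X i) - 1).PosSemidef → ∀ A ∈ 𝒜,
      |(P.map fun ω => ∑ i ∈ t, X i ω).real A
        - (multivariateGaussian 0 (∑ i ∈ t, secondMomentMatrix P (X i))).real A|
        ≤ K * ∑ i ∈ t, ∫ ω, ‖X i ω‖ ^ 3 ∂P := by
  have hκ := h.curvature_nonneg
  induction t using Finset.strongInduction with
  | H t ih =>
  intro X hX hindep h3 hmean hS A hA
  have hWp : IsProbabilityMeasure (P.map fun ω => ∑ i ∈ t, X i ω) :=
    Measure.isProbabilityMeasure_map (Finset.measurable_sum _ fun i _ => hX i).aemeasurable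
  set β := ∑ i ∈ t, ∫ ω, ‖X i ω‖ ^ 3 ∂P with hβ
  have hβ0 : 0 ≤ β := by positivity
  -- In dimension zero β vanishes, so that the choice of ε below would degenerate.
  rcases Nat.eq_zero_or_pos d with rfl | hd
  · rw [measure_eq_of_subsingleton (P.map fun ω => ∑ i ∈ t, X i ω)
      (multivariateGaussian 0 (∑ i ∈ t, secondMomentMatrix P (X i))), sub_self, abs_zero]
    positivity
  -- A bound of at least 1 is trivial. Otherwise K ≥ 27 forces β < 1/27, and every summand has
  -- second moment at most 1/9.
  rcases le_or_gt 1 (K * β) with hbig | hsmall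
  · exact (abs_measureReal_sub_le_one _ _ A).trans hbig
  have hβpos : 0 < β := sum_integral_norm_cube_pos hd t h3 hS
  have hβ27 : β < 1 / 27 := by nlinarith
  have hL2 : ∀ i ∈ t, MemLp (X i) 2 P := fun i hi =>
    memLp_two_of_integrable_norm_cube (hX i) (h3 i hi)
  have hmom : ∀ i ∈ t, ∫ ω, ‖X i ω‖ ^ 2 ∂P ≤ 1 / 9 := fun i hi =>
    (leaveOneOut_moment_le (by positivity) (sqrt_integral_sq_pow_three_le (hX i) (h3 i hi))
      (Finset.single_le_sum (f := fun i => ∫ ω, ‖X i ω‖ ^ 3 ∂P)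
        (fun j _ => by positivity) hi) hβ27).1
  -- 8/9 = 1 − 1/9 is a lower bound for all leave-one-out covariances at once.
  set r := √(8 / 9 : ℝ) with hrdef
  have hr2 : r ^ 2 = 8 / 9 := Real.sq_sqrt (by norm_num)
  have hr0 : 0 < r := Real.sqrt_pos.2 (by norm_num)
  have hr1 : r ≤ 1 := Real.sqrt_le_one.2 (by norm_num)
  have hT : ∀ i ∈ t, (∑ j ∈ t.erase i, secondMomentMatrix P (X j)
      - r ^ 2 • (1 : Matrix (Fin d) (Fin d) ℝ)).PosSemidef := fun i hi => by
    have h4 := (posSemidef_sum_erase_sub hi (hL2 i hi) hS).add ((PosSemidef.one (n := Fin d) (R := ℝ)).smul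
      (by linarith [hmom i hi] : 0 ≤ (1 - ∫ ω, ‖X i ω‖ ^ 2 ∂P) - 8 / 9))
    rw [hr2]
    convert h4 using 1
    module
  have hδ : ∀ i ∈ t, ∀ B ∈ 𝒜, ∀ b y, ∀ c : ℝ, 0 < c → c ≤ 1 →
      |(P.map fun ω => ∑ j ∈ t.erase i, X j ω).real {w | y + c • w ∈ sublevel ρ B b}
        - (multivariateGaussian 0 (∑ j ∈ t.erase i, secondMomentMatrix P (X j))).real
          {w | y + c • w ∈ sublevel ρ B b}| ≤ 1.01 * K * β := fun i hi B hB b y c hc hc1 =>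
    h.abs_measureReal_sum_erase_sub_le (by linarith) hX hindep h3 hmean hS hi
      (ih (t.erase i) (Finset.erase_ssubset hi)) hβ.symm hβ27 hB b y hc hc1
  set k := √(1 + κ) with hkdef
  have hk0 : 0 < k := Real.sqrt_pos.2 (by linarith)
  have hk2 : k ^ 2 = 1 + κ := Real.sq_sqrt (by linarith)
  have hε : 0 < 22.8 * β * k := by positivity
  have hclose := constants_close (γ := (classGaussPerimeter 𝒜 ρ).toReal) ENNReal.toReal_nonneg hk0
    hβpos hK27 hK50 hr0 hr2
  rw [hk2] at hclose
  -- As S ≥ I, N(0,S) is a mixture of translates of N(0,I) and inherits its perimeter bounds.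
  have hν : multivariateGaussian 0 (∑ i ∈ t, secondMomentMatrix P (X i))
      = multivariateGaussian 0 (∑ i ∈ t, secondMomentMatrix P (X i) - 1)
        ∗ stdGaussian (Vec d) := by
    rw [← multivariateGaussian_zero_one, multivariateGaussian_conv hS PosSemidef.one,
      sub_add_cancel]
  refine (h.abs_measureReal_sub_le hε (P.map fun ω => ∑ i ∈ t, X i ω)
    (multivariateGaussian 0 (∑ i ∈ t, secondMomentMatrix P (X i)))
    (p := (classGaussPerimeter 𝒜 ρ).toReal * (22.8 * β * k)) (fun B hB => ?_) (fun B hB => ?_)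
    (fun B hB => h.abs_integral_smoothInd_sum_sub_le hγ hB hX hindep t h3 hmean hS hr0 hr1 hT
      (δ := 1.01 * K * β) (α₀ := 12.768 * β) hε (by positivity) (by positivity)
      (by linarith [Real.pi_gt_three]) (fun i hi => hδ i hi B hB) hβ.symm) hA).trans hclose
  · rw [hν]
    refine measureReal_conv_le ((h.measurableSet_sublevel hB _).diff (h.measurableSet B hB))
      fun y => ?_
    have := h.measureReal_outer_le hγ hB hε one_pos le_rfl y
    simpa only [one_smul, div_one] using this
  · rw [hν]
    exact measureReal_conv_le ((h.measurableSet B hB).diff (h.measurableSet_sublevel hB _))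
      fun y => h.measureReal_inner_le hγ hB hε y

end FiniteSum

/-! ### Passage to countable sums. -/

section Countable
open Matrix
open scoped MatrixOrder

variable {d : ℕ}

/-- A crude bound by the sum of the absolute entries suffices, because it will be applied to
matrices tending to zero. -/
lemma posSemidef_sum_abs_smul_one_sub {M : Matrix (Fin d) (Fin d) ℝ} (hM : M.IsHermitian) :
    ((∑ k, ∑ l, |M k l|) • (1 : Matrix (Fin d) (Fin d) ℝ) - M).PosSemidef := by
  refine PosSemidef.of_dotProduct_mulVec_nonneg
    ((isHermitian_one.smul (IsSelfAdjoint.all _)).sub hM) fun x => ?_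
  rw [star_trivial, Matrix.sub_mulVec, dotProduct_sub, Matrix.smul_mulVec, Matrix.one_mulVec,
    dotProduct_smul, sub_nonneg, smul_eq_mul, dotProduct, Finset.sum_mul]
  refine Finset.sum_le_sum fun k _ => ?_
  rw [Matrix.mulVec, dotProduct, Finset.mul_sum, Finset.sum_mul]
  refine Finset.sum_le_sum fun l _ => ?_
  have hk : ∀ k, x k ^ 2 ≤ x ⬝ᵥ x := fun k => by
    rw [dotProduct, sq]
    exact Finset.single_le_sum (f := fun i => x i * x i) (fun i _ => mul_self_nonneg _)
      (Finset.mem_univ k)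
  have h1 : |x k * x l| ≤ x ⬝ᵥ x := by
    rw [abs_le]
    constructor <;> nlinarith [hk k, hk l, sq_nonneg (x k + x l), sq_nonneg (x k - x l)]
  calc x k * (M k l * x l) ≤ |x k * (M k l * x l)| := le_abs_self _
    _ = |M k l| * |x k * x l| := by rw [← abs_mul]; ring_nf
    _ ≤ |M k l| * (x ⬝ᵥ x) := by gcongr

lemma tendsto_integral_multivariateGaussian {S : ℕ → Matrix (Fin d) (Fin d) ℝ}
    (hS : ∀ᶠ n in atTop, (S n).PosSemidef) (hlim : Tendsto S atTop (𝓝 1))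
    (f : BoundedContinuousFunction (Vec d) ℝ) :
    Tendsto (fun n => ∫ w, f w ∂(multivariateGaussian 0 (S n))) atTop
      (𝓝 (∫ w, f w ∂(stdGaussian (Vec d)))) := by
  let μ : ℕ → ProbabilityMeasure (Vec d) := fun n => ⟨multivariateGaussian 0 (S n), inferInstance⟩
  let ν : ProbabilityMeasure (Vec d) := ⟨stdGaussian (Vec d), inferInstance⟩
  have h1 : Tendsto μ atTop (𝓝 ν) := by
    refine ProbabilityMeasure.tendsto_iff_tendsto_charFun.2 fun x => ?_
    change Tendsto (fun n => charFun (multivariateGaussian 0 (S n)) x) atTop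
      (𝓝 (charFun (stdGaussian (Vec d)) x))
    rw [← multivariateGaussian_zero_one, charFun_multivariateGaussian PosSemidef.one]
    refine Tendsto.congr' (f₁ := fun n => Complex.exp ((inner ℝ x (0 : Vec d) : ℝ) * Complex.I
      - ((x.ofLp ⬝ᵥ S n *ᵥ x.ofLp : ℝ) : ℂ) / 2)) ?_ ?_
    · filter_upwards [hS] with n hn
      rw [charFun_multivariateGaussian hn]
    · have hc : Continuous fun M : Matrix (Fin d) (Fin d) ℝ => Complex.exp
          ((inner ℝ x (0 : Vec d) : ℝ) * Complex.I - ((x.ofLp ⬝ᵥ M *ᵥ x.ofLp : ℝ) : ℂ) / 2) := by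
        fun_prop
      exact (hc.tendsto 1).comp hlim
  exact ProbabilityMeasure.tendsto_iff_forall_integral_tendsto.1 h1 f

variable {𝒜 : Set (Set (Vec d))} {ρ : Set (Vec d) → Vec d → ℝ} {κ : ℝ} {A : Set (Vec d)}
variable {Ω I : Type*} [MeasurableSpace Ω] {P : Measure Ω} [IsProbabilityMeasure P]

/-- The Berry-Esseen bound for smoothed indicators and rescaled finite sums. -/
lemma IsAdmissibleClass.abs_integral_smoothInd_smul_sum_sub_le
    (h : IsAdmissibleClass 𝒜 ρ κ) (hγ : classGaussPerimeter 𝒜 ρ ≠ ⊤) {K : ℝ} (hK27 : 27 ≤ K)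
    (hK50 : 1 + 50 * ((classGaussPerimeter 𝒜 ρ).toReal * √(1 + κ)) ≤ K) {X : I → Ω → Vec d}
    (hX : ∀ i, Measurable (X i)) (hindep : iIndepFun X P)
    (h3 : ∀ i, Integrable (fun ω => ‖X i ω‖ ^ 3) P) (hmean : ∀ i, ∫ ω, X i ω ∂P = 0)
    (t : Finset I) {β : ℝ} (hβ : ∑ i ∈ t, ∫ ω, ‖X i ω‖ ^ 3 ∂P ≤ β) {q : ℝ} (hq : 0 ≤ q)
    (hS : (q ^ 2 • ∑ i ∈ t, secondMomentMatrix P (X i) - 1).PosSemidef) (hA : A ∈ 𝒜) {ε : ℝ}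
    (hε : 0 < ε) :
    |∫ ω, smoothInd ρ A ε (q • ∑ i ∈ t, X i ω) ∂P - ∫ w, smoothInd ρ A ε w
      ∂(multivariateGaussian 0 (q ^ 2 • ∑ i ∈ t, secondMomentMatrix P (X i)))|
      ≤ K * (q ^ 3 * β) := by
  classical
  have hcube : ∀ j, ∀ ω, ‖q • X j ω‖ ^ 3 = q ^ 3 * ‖X j ω‖ ^ 3 := fun j ω => by
    rw [norm_smul, Real.norm_of_nonneg hq, mul_pow]
  have hsum : ∑ i ∈ t, secondMomentMatrix P (fun ω => q • X i ω)
      = q ^ 2 • ∑ i ∈ t, secondMomentMatrix P (X i) := by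
    simp_rw [secondMomentMatrix_smul]
    rw [Finset.smul_sum]
  have key := h.abs_measureReal_sum_sub_le hγ hK27 hK50 t (fun i ω => q • X i ω)
    (fun i => (hX i).const_smul q)
    (hindep.comp (fun _ x => q • x) fun _ => measurable_const_smul q)
    (fun i _ => by
      simp_rw [hcube]
      exact (h3 i).const_mul _)
    (fun i _ => by rw [integral_smul, hmean i, smul_zero]) (by rwa [hsum])
  simp_rw [hsum, hcube, integral_const_mul] at key
  rw [← Finset.mul_sum] at key
  have hm : Measurable fun ω => ∑ i ∈ t, q • X i ω :=
    Finset.measurable_sum _ fun i _ => (hX i).const_smul q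
  have hWp : IsProbabilityMeasure (P.map fun ω => ∑ i ∈ t, q • X i ω) :=
    Measure.isProbabilityMeasure_map hm.aemeasurable
  have hle : K * (q ^ 3 * ∑ i ∈ t, ∫ ω, ‖X i ω‖ ^ 3 ∂P) ≤ K * (q ^ 3 * β) := by
    gcongr
  have hδ0 : 0 ≤ K * (q ^ 3 * β) :=
    le_trans (mul_nonneg (by linarith) (by positivity)) hle
  have h1 : ∀ b (y : Vec d), |(P.map fun ω => ∑ i ∈ t, q • X i ω).real
      {w | y + w ∈ sublevel ρ A b} - (multivariateGaussian 0
        (q ^ 2 • ∑ i ∈ t, secondMomentMatrix P (X i))).real {w | y + w ∈ sublevel ρ A b}|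
      ≤ K * (q ^ 3 * β) := fun b y => by
    have := h.abs_measureReal_preimage_sub_le (P.map fun ω => ∑ i ∈ t, q • X i ω)
      (multivariateGaussian 0 (q ^ 2 • ∑ i ∈ t, secondMomentMatrix P (X i))) le_rfl hδ0
      (fun B hB => by
        simp only [one_smul, Measure.map_id']
        exact (key B hB).trans hle) hA b y one_pos le_rfl
    simpa only [one_smul] using this
  have h2 := h.abs_integral_smoothInd_sub_le hA hε _ _ 0 fun b => h1 b 0
  simp only [zero_add] at h2
  rw [integral_map hm.aemeasurable (h.isSmoothTest hA hε).continuous.aestronglyMeasurable] at h2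
  simp_rw [← Finset.smul_sum] at h2
  exact h2

/-- The Berry-Esseen bound for countable sums, for finite third moments and perimeter. -/
theorem IsAdmissibleClass.abs_measureReal_preimage_sub_stdGaussian_le
    (h : IsAdmissibleClass 𝒜 ρ κ) (hγ : classGaussPerimeter 𝒜 ρ ≠ ⊤) {K : ℝ} (hK27 : 27 ≤ K)
    (hK50 : 1 + 50 * ((classGaussPerimeter 𝒜 ρ).toReal * √(1 + κ)) ≤ K) {X : I → Ω → Vec d}
    {W : Ω → Vec d} (hX : ∀ i, Measurable (X i)) (hW : Measurable W) (hindep : iIndepFun X P)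
    (h3 : ∀ i, Integrable (fun ω => ‖X i ω‖ ^ 3) P) (hmean : ∀ i, ∫ ω, X i ω ∂P = 0)
    (hvar : HasSum (fun i => secondMomentMatrix P (X i)) (1 : Matrix (Fin d) (Fin d) ℝ))
    (hsum : IsAlmostSureSum P X W) {β : ℝ}
    (hβ : ∀ t : Finset I, ∑ i ∈ t, ∫ ω, ‖X i ω‖ ^ 3 ∂P ≤ β) (hA : A ∈ 𝒜) :
    |P.real (W ⁻¹' A) - (stdGaussian (Vec d)).real A| ≤ K * β := by
  obtain ⟨s, hs, hex, hlim⟩ := hsum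
  set S : ℕ → Matrix (Fin d) (Fin d) ℝ := fun n => ∑ i ∈ s n, secondMomentMatrix P (X i) with hSdef
  have hSlim : Tendsto S atTop (𝓝 1) :=
    hvar.comp (tendsto_atTop_finset_of_monotone hs hex)
  have hSherm : ∀ n, (S n).IsHermitian := fun n =>
    (posSemidef_sum (s n) fun i _ => posSemidef_secondMomentMatrix
      (memLp_two_of_integrable_norm_cube (hX i) (h3 i))).isHermitian
  set e : ℕ → ℝ := fun n => ∑ k, ∑ l, |(1 - S n) k l| with hedef
  have helim : Tendsto e atTop (𝓝 0) := by
    have hc : Continuous fun M : Matrix (Fin d) (Fin d) ℝ => ∑ k, ∑ l, |(1 - M) k l| := by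
      fun_prop
    have := (hc.tendsto 1).comp hSlim
    simp only [sub_self, Matrix.zero_apply, abs_zero, Finset.sum_const_zero] at this
    exact this
  -- From I − S_n ≤ e_n I and q_n²(1 − e_n) = 1 it follows that q_n² S_n ≥ I, so the finite theorem
  -- applies to the partial sums dilated by q_n.
  set q : ℕ → ℝ := fun n => (√(1 - e n))⁻¹ with hqdef
  have hqlim : Tendsto q atTop (𝓝 1) := by
    have h1 : Tendsto (fun n => √(1 - e n)) atTop (𝓝 (√(1 - 0))) :=
      (Real.continuous_sqrt.tendsto _).comp (helim.const_sub 1)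
    rw [sub_zero, Real.sqrt_one] at h1
    simpa using h1.inv₀ one_ne_zero
  have hqS : ∀ᶠ n in atTop, (q n ^ 2 • S n - 1).PosSemidef := by
    filter_upwards [helim.eventually_lt_const one_pos] with n hn
    have h1 : q n ^ 2 * (1 - e n) = 1 := by
      rw [hqdef, inv_pow, Real.sq_sqrt (by linarith)]
      exact inv_mul_cancel₀ (by linarith)
    have h2 := (posSemidef_sum_abs_smul_one_sub (isHermitian_one.sub (hSherm n))).smul
      (sq_nonneg (q n))
    convert h2 using 1
    rw [show q n ^ 2 • S n - 1 = q n ^ 2 • S n - (q n ^ 2 * (1 - e n)) • 1 by rw [h1, one_smul]]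
    change _ = q n ^ 2 • (e n • 1 - (1 - S n))
    module
  have hqSlim : Tendsto (fun n => q n ^ 2 • S n) atTop (𝓝 1) := by
    have := (hqlim.pow 2).smul hSlim
    simpa using this
  have hWp : IsProbabilityMeasure (P.map W) := Measure.isProbabilityMeasure_map hW.aemeasurable
  -- The limit is taken for smoothed indicators because the law of `W` may charge the boundary of a
  -- set of the class.
  have hsmooth : ∀ ε : ℝ, 0 < ε → ∀ B ∈ 𝒜, |∫ w, smoothInd ρ B ε w ∂(P.map W)
      - ∫ w, smoothInd ρ B ε w ∂(stdGaussian (Vec d))| ≤ K * β := by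
    intro ε hε B hB
    have hf := h.isSmoothTest hB hε
    have hfc := hf.continuous
    have hl1 : Tendsto (fun n => ∫ ω, smoothInd ρ B ε (q n • ∑ i ∈ s n, X i ω) ∂P) atTop
        (𝓝 (∫ w, smoothInd ρ B ε w ∂(P.map W))) := by
      rw [integral_map hW.aemeasurable hfc.aestronglyMeasurable]
      refine tendsto_integral_of_dominated_convergence (fun _ => 1) (fun n => ?_)
        (integrable_const 1) (fun n => ae_of_all _ fun ω => hf.abs_le_one _) ?_
      · have hm : Measurable fun ω => q n • ∑ i ∈ s n, X i ω :=
          (Finset.measurable_sum _ fun i _ => hX i).const_smul (q n)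
        exact (hfc.measurable.comp hm).aestronglyMeasurable
      · filter_upwards [hlim] with ω hω
        have := hqlim.smul hω
        rw [one_smul] at this
        exact (hfc.tendsto _).comp this
    have hl2 : Tendsto (fun n => ∫ w, smoothInd ρ B ε w
        ∂(multivariateGaussian 0 (q n ^ 2 • S n))) atTop
        (𝓝 (∫ w, smoothInd ρ B ε w ∂(stdGaussian (Vec d)))) := by
      refine tendsto_integral_multivariateGaussian ?_ hqSlim
        (BoundedContinuousFunction.ofNormedAddCommGroup _ hfc 1 fun x => hf.abs_le_one x)
      filter_upwards [hqS] with n hn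
      have := hn.add PosSemidef.one
      rwa [sub_add_cancel] at this
    have hl3 : Tendsto (fun n => K * (q n ^ 3 * β)) atTop (𝓝 (K * β)) := by
      have := ((hqlim.pow 3).mul_const β).const_mul K
      simpa using this
    refine le_of_tendsto_of_tendsto (hl1.sub hl2).abs hl3 ?_
    filter_upwards [hqS] with n hn
    exact h.abs_integral_smoothInd_smul_sum_sub_le hγ hK27 hK50 hX hindep h3 hmean (s n)
      (hβ (s n)) (by positivity) hn hB hε
  rw [show P.real (W ⁻¹' A) = (P.map W).real A from
    (map_measureReal_apply hW (h.measurableSet A hA)).symm]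
  -- The bound for smoothed indicators does not depend on ε, so only the layer term γ* ε has to
  -- vanish.
  have hlimε : Tendsto (fun ε : ℝ => K * β + (classGaussPerimeter 𝒜 ρ).toReal * ε) (𝓝[>] 0)
      (𝓝 (K * β)) := by
    have hc : Continuous fun ε : ℝ => K * β + (classGaussPerimeter 𝒜 ρ).toReal * ε := by fun_prop
    have := hc.tendsto 0
    rw [mul_zero, add_zero] at this
    exact this.mono_left nhdsWithin_le_nhds
  refine ge_of_tendsto hlimε ?_
  filter_upwards [self_mem_nhdsWithin] with ε hε
  exact h.abs_measureReal_sub_le hε _ _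
    (fun B hB => (classGaussPerimeter_outer_le hγ hB hε).1)
    (fun B hB => (classGaussPerimeter_outer_le hγ hB hε).2) (hsmooth ε hε) hA

lemma integrable_norm_cube_of_lintegral_ne_top {Y : Ω → Vec d} (hY : Measurable Y)
    (h : ∫⁻ ω, ‖Y ω‖ₑ ^ 3 ∂P ≠ ⊤) :
    Integrable (fun ω => ‖Y ω‖ ^ 3) P ∧
      ∫ ω, ‖Y ω‖ ^ 3 ∂P = (∫⁻ ω, ‖Y ω‖ₑ ^ 3 ∂P).toReal := by
  have e : ∀ ω, ‖‖Y ω‖ ^ 3‖ₑ = ‖Y ω‖ₑ ^ 3 := fun ω => by rw [enorm_pow, enorm_norm]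
  have hm : AEStronglyMeasurable (fun ω => ‖Y ω‖ ^ 3) P := by fun_prop
  constructor
  · refine ⟨hm, ?_⟩
    rw [hasFiniteIntegral_iff_enorm]
    simp_rw [e]
    exact h.lt_top
  · have h1 := integral_norm_eq_lintegral_enorm hm
    simp_rw [e] at h1
    rw [← h1]
    congr 1
    ext ω
    rw [norm_pow, norm_norm]

/-- The Berry-Esseen bound with values in `[0, ∞]`. -/
theorem IsAdmissibleClass.ofReal_abs_measureReal_preimage_sub_le
    (h : IsAdmissibleClass 𝒜 ρ κ) {X : I → Ω → Vec d} {W : Ω → Vec d}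
    (hX : ∀ i, Measurable (X i)) (hW : Measurable W) (hindep : iIndepFun X P)
    (hL2 : ∀ i, MemLp (X i) 2 P) (hmean : ∀ i, ∫ ω, X i ω ∂P = 0)
    (hvar : HasSum (fun i => covarianceMatrix P (X i)) (1 : Matrix (Fin d) (Fin d) ℝ))
    (hsum : IsAlmostSureSum P X W) (hA : A ∈ 𝒜) :
    ENNReal.ofReal |P.real (W ⁻¹' A) - (stdGaussian (Vec d)).real A| ≤
      max 27 (1 + 50 * classGaussPerimeter 𝒜 ρ * ENNReal.ofReal √(1 + κ)) *
        ∑' i, ∫⁻ ω, ‖X i ω‖ₑ ^ 3 ∂P := by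
  have hκ := h.curvature_nonneg
  have hk0 : 0 < √(1 + κ) := Real.sqrt_pos.2 (by linarith)
  simp_rw [fun i => covarianceMatrix_eq_secondMomentMatrix (hL2 i) (hmean i)] at hvar
  rcases eq_or_ne (∑' i, ∫⁻ ω, ‖X i ω‖ₑ ^ 3 ∂P) ⊤ with hβ | hβ
  · rw [hβ, ENNReal.mul_top (ne_of_gt (lt_max_of_lt_left (by norm_num)))]
    exact le_top
  have hβi : ∀ i, ∫⁻ ω, ‖X i ω‖ₑ ^ 3 ∂P ≠ ⊤ := fun i => ENNReal.ne_top_of_tsum_ne_top hβ i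
  have h3 := fun i => integrable_norm_cube_of_lintegral_ne_top (hX i) (hβi i)
  rcases Nat.eq_zero_or_pos d with rfl | hd
  · have hWp : IsProbabilityMeasure (P.map W) := Measure.isProbabilityMeasure_map hW.aemeasurable
    rw [show P.real (W ⁻¹' A) = (P.map W).real A from
      (map_measureReal_apply hW (h.measurableSet A hA)).symm,
      measure_eq_of_subsingleton (P.map W) (stdGaussian (Vec 0)), sub_self, abs_zero,
      ENNReal.ofReal_zero]
    exact zero_le
  -- In positive dimension vanishing third moments contradict the total covariance I. This ensures
  -- that an infinite perimeter makes the right-hand side infinite rather than ∞ · 0 = 0.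
  have hβ0 : ∑' i, ∫⁻ ω, ‖X i ω‖ₑ ^ 3 ∂P ≠ 0 := by
    intro h0
    rw [ENNReal.tsum_eq_zero] at h0
    have hz : ∀ i, secondMomentMatrix P (X i) = 0 := fun i => by
      have h4 := (h3 i).2
      rw [h0 i, ENNReal.toReal_zero] at h4
      exact secondMomentMatrix_eq_zero (h3 i).1 h4
    simp_rw [hz] at hvar
    have h5 := congrFun (congrFun (hvar.unique hasSum_zero) ⟨0, hd⟩) ⟨0, hd⟩
    simp at h5
  rcases eq_or_ne (classGaussPerimeter 𝒜 ρ) ⊤ with hγ | hγ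
  · rw [hγ, ENNReal.mul_top (by norm_num), ENNReal.top_mul (by simpa using hk0), add_top,
      max_eq_right le_top, ENNReal.top_mul hβ0]
    exact le_top
  have hγ0 : 0 ≤ (classGaussPerimeter 𝒜 ρ).toReal := ENNReal.toReal_nonneg
  have key := h.abs_measureReal_preimage_sub_stdGaussian_le hγ (le_max_left _ _) (le_max_right 27 _)
    hX hW hindep (fun i => (h3 i).1) hmean hvar hsum
    (β := (∑' i, ∫⁻ ω, ‖X i ω‖ₑ ^ 3 ∂P).toReal) (fun t => by
      simp_rw [fun i => (h3 i).2]
      rw [← ENNReal.toReal_sum fun i _ => hβi i]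
      exact ENNReal.toReal_mono hβ (ENNReal.sum_le_tsum t)) hA
  refine (ENNReal.ofReal_le_ofReal key).trans (le_of_eq ?_)
  rw [ENNReal.ofReal_mul (le_max_of_le_left (by norm_num)), ENNReal.ofReal_toReal hβ,
    ENNReal.ofReal_max, ENNReal.ofReal_add zero_le_one (by positivity), ENNReal.ofReal_mul
    (by norm_num), ENNReal.ofReal_mul hγ0, ENNReal.ofReal_toReal hγ, ENNReal.ofReal_one, mul_assoc]
  norm_num

end Countable

theorem mainTheorem2 {d : ℕ} {Ω I : Type*} [MeasurableSpace Ω] (P : Measure Ω)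
    [IsProbabilityMeasure P] [Countable I] (X : I → Ω → Vec d) (W : Ω → Vec d)
    (hX : ∀ i, Measurable (X i)) (hW : Measurable W)
    (hindep : iIndepFun X P)
    (hL2 : ∀ i, MemLp (X i) 2 P)
    (hmean : ∀ i, ∫ ω, X i ω ∂P = 0)
    (hvar : HasSum (fun i => covarianceMatrix P (X i)) (1 : Matrix (Fin d) (Fin d) ℝ))
    (hsum : IsAlmostSureSum P X W)
    (𝒜 : Set (Set (Vec d))) (ρ : Set (Vec d) → Vec d → ℝ) (κ : ℝ)
    (h𝒜 : IsAdmissibleClass 𝒜 ρ κ) :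
    (∀ A ∈ 𝒜, ENNReal.ofReal |P.real (W ⁻¹' A) - (stdGaussian (Vec d)).real A| ≤
      max 27 (1 + 53 * classGaussPerimeter 𝒜 ρ * ENNReal.ofReal (Real.sqrt (1 + κ))) *
        ∑' i, ∫⁻ ω, ‖X i ω‖ₑ ^ 3 ∂P) ∧
    (ClosedUnderSymmetricMaps 𝒜 →
      ∀ A ∈ 𝒜, ENNReal.ofReal |P.real (W ⁻¹' A) - (stdGaussian (Vec d)).real A| ≤
        max 27 (1 + 50 * classGaussPerimeter 𝒜 ρ * ENNReal.ofReal (Real.sqrt (1 + κ))) *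
          ∑' i, ∫⁻ ω, ‖X i ω‖ₑ ^ 3 ∂P) := by
  have key := fun A (hA : A ∈ 𝒜) => h𝒜.ofReal_abs_measureReal_preimage_sub_le hX hW hindep hL2
    hmean hvar hsum hA
  refine ⟨fun A hA => (key A hA).trans ?_, fun _ => key⟩
  gcongr
  norm_num
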